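/- Let $n\ge 10$ be an integer and let $c\in(0,1/2)$ be such that $cn$ is an integer. Let $\Delta_{4,n}$ be the set of points $x\in\mathbb{R}^4_{\ge 0}$ with $x_1+x_2+x_3+x_4=1$ whose coordinates are all multiples of $1/n$, and let $G$ be the graph on $\Delta_{4,n}$ with edge set $E_{4,n}=\{xy:\|x-y\|_1=2/n\}$. Its terminals are the unit vectors $s_i=e^i$, $i=1,\dots,4$. Write $\mathrm{Support}(x)=\{i:x_i\neq 0\}$. A cut is a map $P:\Delta_{4,n}\to\{1,\dots,5\}$ with $P(s_i)=i$ for $i\le 4$; it is non-opposite if $P(x)\in\mathrm{Support}(x)\cup\{5\}$ for all $x$. For edge weights $w:E_{4,n}\to\mathbb{R}_{\ge 0}$, the cost of $P$ is the sum of $w(xy)$ over all edges $xy$ with $P(x)\ne P(y)$. Let $L_{ij}$ be the set of edges both of whose end nodes have support contained in $\{i,j\}$, and let the face $F$ be the subgraph of $G$ induced by the nodes with $x_4=0$. Define four instances (edge weights): * $I_1$: put $\rho=3/(5n)$ and, for $i\le 3$, let $T_i$ be the set of nodes of $F$ with $x_i>2/3$. For edges of $F$ with both end nodes in $T_i$: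 the $m$-th closest edge to $s_i$ on $L_{ij}$ ($j\le 3$, $j\ne i$, $m=1,2,\dots$) has weight $(n/3-m+1)\rho$; an edge on no $L_{ij}$ has weight $0$ if its end nodes have the same $i$-th coordinate, and $\rho$ otherwise. All other edges of $F$ have weight $\rho$, and all edges not in $F$ have weight $0$. * $I_2$: weight $1/3$ on the edges of $L_{12}\cup L_{23}\cup L_{13}$ and $0$ elsewhere. * $I_3$: weight $1/(9c)$ on the red edges and $0$ elsewhere, where the red edges are those lying on the three sides of one of the triangles $\{x: x_4=0,\ x_k\ge 1-c\}$, $k=1,2,3$ (so there are exactly $9cn$ red edges). * $I_4$: weight $1/n^2$ on every edge. Let $\lambda_1,\dots,\lambda_4\ge 0$ with $\sum_{i=1}^4\lambda_i=1$, and let $I=\sum_{i=1}^4\lambda_iI_i$ (the convex combination of the edge weights). Then every non-opposite cut has cost on $I$ at least the minimum of the following two terms: (i) $\displaystyle \lambda_2+\left(1.2-\frac1n\right)\lambda_1+\min_{\alpha\in[0,1/2]}\left\{0.4\,\alpha\lambda_1+3\left(\frac12-\alpha\right)\lambda_4\right\}$; (ii) $\displaystyle 2\lambda_2+\left(1.2-\frac{5}{2n}\right)\lambda_1+3\min\left\{\frac{2\lambda_3}{9c},\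 \min_{\alpha\in[0,c^2/2]}\left\{0.4\,\alpha\lambda_1+3\left(\frac{c^2}{2}-\alpha\right)\lambda_4\right\}\right\}$. -/

import Mathlib

namespace MultiwayCut

/-- The discretized simplex `Δ_{4,n} = Δ_4 ∩ ((1/n)ℤ)^4`. A point `x` is stored through its
integer coordinates `n * x i`, so the coordinates are natural numbers with sum `n`.
Coordinates (and terminals) `1, 2, 3, 4` are the elements `0, 1, 2, 3` of `Fin 4`. -/
abbrev Node (n : ℕ) : Type := {x : Fin 4 → ℕ // ∑ i, x i = n}

instance instFintypeNode (n : ℕ) : Fintype (Node n) :=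
  Fintype.subtype (Finset.Nat.antidiagonalTuple 4 n)
    (fun _ => Finset.Nat.mem_antidiagonalTuple)

/-- The set of indices of nonzero coordinates. -/
def support {n : ℕ} (x : Node n) : Finset (Fin 4) :=
  Finset.univ.filter (fun i => x.1 i ≠ 0)

/-- The terminal `s_i = e^i`. -/
def terminal (n : ℕ) (i : Fin 4) : Node n :=
  ⟨Pi.single i n, by simp⟩

/-- The graph on `Δ_{4,n}`: nodes are adjacent iff their `ℓ₁`-distance is `2/n`
(that is, `2` in the integer coordinates). -/
def graph (n : ℕ) : SimpleGraph (Node n) where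
  Adj x y := ∑ i, |(x.1 i : ℤ) - (y.1 i : ℤ)| = 2
  symm := ⟨fun x y h => by simpa only [abs_sub_comm] using h⟩
  loopless := ⟨fun x h => by simp at h⟩

instance instDecidableRelGraph (n : ℕ) : DecidableRel (graph n).Adj :=
  fun x y => inferInstanceAs (Decidable (∑ i, |(x.1 i : ℤ) - (y.1 i : ℤ)| = 2))

/-- A cut labels the nodes with `1, ..., 5` (here `0, ..., 4` in `Fin 5`) so that the `i`-th
terminal gets label `i`. -/
def IsCut {n : ℕ} (P : Node n → Fin 5) : Prop :=
  ∀ i : Fin 4, P (terminal n i) = i.castSucc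

/-- A non-opposite cut gives every node a label from its support, or the extra label `5`. -/
def IsNonOpposite {n : ℕ} (P : Node n → Fin 5) : Prop :=
  IsCut P ∧ ∀ x : Node n, P x = Fin.last 4 ∨ ∃ i ∈ support x, P x = i.castSucc

/-- The cut-set `δ(P)`: the edges whose end nodes have different labels. -/
def cutSet {n : ℕ} (P : Node n → Fin 5) : Finset (Sym2 (Node n)) :=
  (graph n).edgeFinset.filter (fun e => ∃ x ∈ e, ∃ y ∈ e, P x ≠ P y)

/-- The cost of a cut for given edge weights. -/
noncomputable def cost {n : ℕ} (w : Sym2 (Node n) → ℝ) (P : Node n → Fin 5) : ℝ :=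
  ∑ e ∈ cutSet P, w e

/-- `L_{ij}`: the edges between nodes whose support is contained in `{i, j}`. -/
def boundary (n : ℕ) (i j : Fin 4) : Set (Sym2 (Node n)) :=
  {e | e ∈ (graph n).edgeSet ∧ ∀ x ∈ e, support x ⊆ {i, j}}

/-- The edges of `Face(s_1, s_2, s_3)`, the subgraph induced by the nodes with `x_4 = 0`. -/
def faceEdges (n : ℕ) : Set (Sym2 (Node n)) :=
  {e | e ∈ (graph n).edgeSet ∧ ∀ x ∈ e, support x ⊆ {0, 1, 2}}

/-- The edges of the subgraph induced by the corner triangle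
`T_i = {x ∈ Face(s_1, s_2, s_3) : x_i > 2/3}`. -/
def cornerEdges (n : ℕ) (i : Fin 4) : Set (Sym2 (Node n)) :=
  {e | e ∈ faceEdges n ∧ ∀ x ∈ e, 2 * n < 3 * x.1 i}

/-- The unit `ρ = 3/(5n)` of the edge weights of the instance on the face. -/
noncomputable def rho (n : ℕ) : ℝ := 3 / (5 * n)

/-- The number of edges by which `e` is away from `s_i` in direction of the `i`-th coordinate:
on the boundary `L_{ij}` this is `0` for the edge closest to `s_i`, `1` for the second
closest edge, and so on. -/
def depth {n : ℕ} (i : Fin 4) (e : Sym2 (Node n)) : ℕ :=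
  n - (e.map (fun x => x.1 i)).sup

open Classical in
/-- Weight of an edge of the corner triangle `T_i`: on the boundary the weights are
`(n/3) ρ, (n/3 - 1) ρ, ...` from `s_i` on; a non-boundary edge has weight `0` if it is parallel
to the side opposite to `s_i` (its end nodes have the same `i`-th coordinate), and `ρ` if not. -/
noncomputable def cornerWeight (n : ℕ) (i : Fin 4) (e : Sym2 (Node n)) : ℝ :=
  if ∃ j : Fin 4, j ≠ i ∧ j ≠ 3 ∧ e ∈ boundary n i j then
    ((n : ℝ) / 3 - (depth i e : ℝ)) * rho n
  else if ∀ x ∈ e, ∀ y ∈ e, x.1 i = y.1 i then 0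
  else rho n

open Classical in
/-- Instance `I_1`: edges inside the corner triangles of the face `Face(s_1, s_2, s_3)` are
weighted by `cornerWeight`, the remaining edges of the face (those inside the middle hexagon
and those joining it to a corner triangle) have weight `ρ`, all other edges weight `0`. -/
noncomputable def weight₁ (n : ℕ) (e : Sym2 (Node n)) : ℝ :=
  if e ∈ cornerEdges n 0 then cornerWeight n 0 e
  else if e ∈ cornerEdges n 1 then cornerWeight n 1 e
  else if e ∈ cornerEdges n 2 then cornerWeight n 2 e
  else if e ∈ faceEdges n then rho n
  else 0

open Classical in
/-- Instance `I_2`: weight `1/3` on the edges of `L_{12}`, `L_{23}`, `L_{13}`. -/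
noncomputable def weight₂ (n : ℕ) (e : Sym2 (Node n)) : ℝ :=
  if e ∈ boundary n 0 1 ∪ boundary n 1 2 ∪ boundary n 0 2 then 1 / 3 else 0

/-- The red edges near `s_k`: the edges of the three sides of the triangle
`{x : x_4 = 0, x_k ≥ 1 - c}`. One side lies on the line `x_k = 1 - c`, the other two lie on the
boundary of the face. -/
def redEdges (n : ℕ) (c : ℝ) (k : Fin 4) : Set (Sym2 (Node n)) :=
  {e | e ∈ faceEdges n ∧
    ((∀ x ∈ e, (x.1 k : ℝ) = (1 - c) * n) ∨
      ∃ j : Fin 4, j ≠ k ∧ j ≠ 3 ∧ e ∈ boundary n j k ∧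
        ∀ x ∈ e, (1 - c) * n ≤ (x.1 k : ℝ))}

open Classical in
/-- Instance `I_3`: weight `1/(9c)` on the red edges. -/
noncomputable def weight₃ (n : ℕ) (c : ℝ) (e : Sym2 (Node n)) : ℝ :=
  if e ∈ redEdges n c 0 ∪ redEdges n c 1 ∪ redEdges n c 2 then 1 / (9 * c) else 0

/-- Instance `I_4`: weight `1/n²` on every edge. -/
noncomputable def weight₄ (n : ℕ) (_e : Sym2 (Node n)) : ℝ := 1 / (n : ℝ) ^ 2

/-- The convex combination `I = l₁ I_1 + l₂ I_2 + l₃ I_3 + l₄ I_4`. -/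
noncomputable def combinedWeight (n : ℕ) (c l₁ l₂ l₃ l₄ : ℝ) (e : Sym2 (Node n)) : ℝ :=
  l₁ * weight₁ n e + l₂ * weight₂ n e + l₃ * weight₃ n c e + l₄ * weight₄ n e

/-- The minimum over `α ∈ [0, b]` of `0.4 α l₁ + 3 (b - α) l₄` (the infimum of a continuous
function on a nonempty compact interval, hence attained). -/
noncomputable def minTerm (b l₁ l₄ : ℝ) : ℝ :=
  sInf ((fun α : ℝ => 0.4 * α * l₁ + 3 * (b - α) * l₄) '' Set.Icc 0 b)

end MultiwayCut

namespace MultiwayCut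

/-- The discrete metric. -/
def disc {α : Type*} [DecidableEq α] (x y : α) : ℝ := if x = y then 0 else 1

/-- The indicator function of a finite set. -/
def ind {α : Type*} [DecidableEq α] (X : Finset α) (x : α) : ℝ := if x ∈ X then 1 else 0

section Walks

variable {α : Type*} [DecidableEq α]

@[simp] lemma disc_self (x : α) : disc x x = 0 := by simp [disc]

lemma disc_of_ne {x y : α} (h : x ≠ y) : disc x y = 1 := by simp [disc, h]

lemma disc_comm (x y : α) : disc x y = disc y x := by
  unfold disc; simp only [eq_comm]

lemma disc_nonneg (x y : α) : 0 ≤ disc x y := by unfold disc; split_ifs <;> norm_num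

lemma disc_le_one (x y : α) : disc x y ≤ 1 := by unfold disc; split_ifs <;> norm_num

lemma disc_triangle (x y z : α) : disc x z ≤ disc x y + disc y z := by
  by_cases h : x = y
  · subst h; simp
  · rw [disc_of_ne h]; linarith [disc_le_one x z, disc_nonneg y z]

lemma ind_nonneg (X : Finset α) (x : α) : 0 ≤ ind X x := by unfold ind; split_ifs <;> norm_num

lemma ind_of_mem {X : Finset α} {x : α} (h : x ∈ X) : ind X x = 1 := by simp [ind, h]

lemma ind_of_notMem {X : Finset α} {x : α} (h : x ∉ X) : ind X x = 0 := by simp [ind, h]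

lemma ind_sub_le_disc (X : Finset α) (x y : α) : ind X y - ind X x ≤ disc x y := by
  unfold ind disc
  by_cases h : x = y
  · subst h; simp
  · simp only [h, if_false]; split_ifs <;> norm_num

lemma disc_le_sum_Ico (f : ℕ → α) {i j : ℕ} (h : i ≤ j) :
    disc (f i) (f j) ≤ ∑ k ∈ Finset.Ico i j, disc (f k) (f (k + 1)) := by
  induction j, h using Nat.le_induction with
  | base => simp
  | succ j hj ih =>
    rw [Finset.sum_Ico_succ_top hj]
    linarith [disc_triangle (f i) (f j) (f (j + 1))]

lemma disc_le_sum_range (f : ℕ → α) (L : ℕ) :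
    disc (f 0) (f L) ≤ ∑ k ∈ Finset.range L, disc (f k) (f (k + 1)) := by
  rw [Finset.range_eq_Ico]; exact disc_le_sum_Ico f (Nat.zero_le _)

lemma disc_add_disc_le_sum_range (f : ℕ → α) {i L : ℕ} (h : i ≤ L) :
    disc (f 0) (f i) + disc (f i) (f L) ≤ ∑ k ∈ Finset.range L, disc (f k) (f (k + 1)) := by
  rw [Finset.range_eq_Ico, ← Finset.sum_Ico_consecutive _ (Nat.zero_le i) h]
  exact add_le_add (disc_le_sum_Ico f (Nat.zero_le _)) (disc_le_sum_Ico f h)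

lemma disc_add_three_le_sum_range (f : ℕ → α) {i j L : ℕ} (hij : i ≤ j) (h : j ≤ L) :
    disc (f 0) (f i) + disc (f i) (f j) + disc (f j) (f L)
      ≤ ∑ k ∈ Finset.range L, disc (f k) (f (k + 1)) := by
  rw [Finset.range_eq_Ico, ← Finset.sum_Ico_consecutive _ (Nat.zero_le j) h,
    ← Finset.sum_Ico_consecutive _ (Nat.zero_le i) hij]
  exact add_le_add (add_le_add (disc_le_sum_Ico f (Nat.zero_le _)) (disc_le_sum_Ico f hij))
    (disc_le_sum_Ico f h)

lemma sum_ind_add_ind (X : Finset α) (v : ℕ → α) (L : ℕ) :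
    ∑ j ∈ Finset.range (L + 1), 2 * ind X (v j)
      = ∑ j ∈ Finset.range L, (ind X (v j) + ind X (v (j + 1))) + ind X (v 0) + ind X (v L) := by
  induction L with
  | zero => simp; ring
  | succ L ih => rw [Finset.sum_range_succ, ih, Finset.sum_range_succ _ L]; ring

lemma strip_cross (X : Finset α) (u v : ℕ → α) (L : ℕ) :
    ∑ j ∈ Finset.range L, (ind X (v j) + ind X (v (j + 1))) + ind X (v 0) + ind X (v L)
        - ∑ j ∈ Finset.range (L + 1), (ind X (u j) + ind X (u (j + 1)))
      ≤ ∑ j ∈ Finset.range (L + 1), (disc (u j) (v j) + disc (u (j + 1)) (v j)) := by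
  rw [← sum_ind_add_ind, ← Finset.sum_sub_distrib]
  refine Finset.sum_le_sum fun j _ => ?_
  linarith [ind_sub_le_disc X (u j) (v j), ind_sub_le_disc X (u (j + 1)) (v j)]

lemma strip_row_le (u v : ℕ → α) (L : ℕ) :
    ∑ j ∈ Finset.range L, disc (v j) (v (j + 1))
      ≤ ∑ j ∈ Finset.range (L + 1), (disc (u j) (v j) + disc (u (j + 1)) (v j)) := by
  rw [Finset.sum_add_distrib, Finset.sum_range_succ', Finset.sum_range_succ (fun j => disc (u (j + 1)) (v j))]
  have : ∑ j ∈ Finset.range L, disc (v j) (v (j + 1)) ≤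
      ∑ j ∈ Finset.range L, (disc (u (j + 1)) (v (j + 1)) + disc (u (j + 1)) (v j)) := by
    refine Finset.sum_le_sum fun j _ => ?_
    have := disc_triangle (v j) (u (j + 1)) (v (j + 1))
    rw [disc_comm (v j) (u (j + 1))] at this; linarith
  rw [Finset.sum_add_distrib] at this
  linarith [disc_nonneg (u 0) (v 0), disc_nonneg (u (L + 1)) (v L)]

/-- The cut edges of a strip between a lower row `u` and an upper row `v` together with those of
the upper row are bounded below by the growth of the number of edges that leave `X` upwards. -/
lemma strip_bound (X : Finset α) (u v : ℕ → α) (L : ℕ)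
    (h : v 0 ∈ X ∨ ∃ j ≤ L, v j ≠ v 0) :
    2 + ∑ j ∈ Finset.range L, (ind X (v j) + ind X (v (j + 1)))
        - ∑ j ∈ Finset.range (L + 1), (ind X (u j) + ind X (u (j + 1)))
      ≤ ∑ j ∈ Finset.range (L + 1), (disc (u j) (v j) + disc (u (j + 1)) (v j))
        + ∑ j ∈ Finset.range L, disc (v j) (v (j + 1)) := by
  have hV := strip_cross X u v L
  have hRV := strip_row_le u v L
  have h0 := disc_le_sum_range v L
  have hu : 0 ≤ ∑ j ∈ Finset.range (L + 1), (ind X (u j) + ind X (u (j + 1))) :=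
    Finset.sum_nonneg fun j _ => add_nonneg (ind_nonneg _ _) (ind_nonneg _ _)
  have hR : 0 ≤ ∑ j ∈ Finset.range L, disc (v j) (v (j + 1)) :=
    Finset.sum_nonneg fun j _ => disc_nonneg _ _
  by_cases ha : v 0 ∈ X
  · rw [ind_of_mem ha] at hV
    by_cases hb : v L ∈ X
    · rw [ind_of_mem hb] at hV; linarith
    · rw [disc_of_ne (ne_of_mem_of_not_mem ha hb)] at h0
      rw [ind_of_notMem hb] at hV; linarith
  · rw [ind_of_notMem ha] at hV
    by_cases hb : v L ∈ X
    · rw [disc_of_ne (ne_of_mem_of_not_mem hb ha).symm] at h0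
      rw [ind_of_mem hb] at hV; linarith
    · rw [ind_of_notMem hb] at hV
      by_cases hx : ∃ j ≤ L, v j ∈ X
      · obtain ⟨j, hj, hjX⟩ := hx
        have := disc_add_disc_le_sum_range v hj
        rw [disc_of_ne (ne_of_mem_of_not_mem hjX ha).symm,
          disc_of_ne (ne_of_mem_of_not_mem hjX hb)] at this
        linarith
      · push Not at hx
        have hz : ∑ j ∈ Finset.range L, (ind X (v j) + ind X (v (j + 1))) = 0 := by
          refine Finset.sum_eq_zero fun j hj => ?_
          have := Finset.mem_range.1 hj
          rw [ind_of_notMem (hx j (by omega)), ind_of_notMem (hx (j + 1) (by omega)), add_zero]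
        obtain ⟨j, hj, hne⟩ := h.resolve_left ha
        have := disc_add_disc_le_sum_range v hj
        rw [disc_of_ne hne.symm] at this
        linarith [disc_nonneg (v j) (v L)]

/-- If the upper row has a third label besides those of its ends, the bound improves by one. -/
lemma strip_bound_succ (X : Finset α) (u v : ℕ → α) (L : ℕ) (h0 : v 0 ∉ X) (hL : v L ∉ X)
    {j : ℕ} (hj : j ≤ L) (hjX : v j ∉ X) (hj0 : v j ≠ v 0) (hjL : v j ≠ v L) :
    3 + ∑ j ∈ Finset.range L, (ind X (v j) + ind X (v (j + 1)))
        - ∑ j ∈ Finset.range (L + 1), (ind X (u j) + ind X (u (j + 1)))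
      ≤ ∑ j ∈ Finset.range (L + 1), (disc (u j) (v j) + disc (u (j + 1)) (v j))
        + ∑ j ∈ Finset.range L, disc (v j) (v (j + 1)) := by
  have hV := strip_cross X u v L
  have hRV := strip_row_le u v L
  have hu : 0 ≤ ∑ j ∈ Finset.range (L + 1), (ind X (u j) + ind X (u (j + 1))) :=
    Finset.sum_nonneg fun j _ => add_nonneg (ind_nonneg _ _) (ind_nonneg _ _)
  rw [ind_of_notMem h0, ind_of_notMem hL] at hV
  by_cases hx : ∃ i ≤ L, v i ∈ X
  · obtain ⟨i, hi, hiX⟩ := hx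
    have hi0 : v i ≠ v 0 := fun e => h0 (e ▸ hiX)
    have hiL : v i ≠ v L := fun e => hL (e ▸ hiX)
    have hij : v i ≠ v j := fun e => hjX (e ▸ hiX)
    rcases le_total i j with hle | hle
    · have := disc_add_three_le_sum_range v hle hj
      rw [disc_of_ne hi0.symm, disc_of_ne hij, disc_of_ne hjL] at this
      linarith
    · have := disc_add_three_le_sum_range v hle hi
      rw [disc_of_ne hj0.symm, disc_of_ne hij.symm, disc_of_ne hiL] at this
      linarith
  · push Not at hx
    have hz : ∑ j ∈ Finset.range L, (ind X (v j) + ind X (v (j + 1))) = 0 := by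
      refine Finset.sum_eq_zero fun j hj => ?_
      have := Finset.mem_range.1 hj
      rw [ind_of_notMem (hx j (by omega)), ind_of_notMem (hx (j + 1) (by omega)), add_zero]
    have := disc_add_disc_le_sum_range v hj
    rw [disc_of_ne hj0.symm, disc_of_ne hjL] at this
    linarith

end Walks


/-- A labelling of the nodes `(a, b, c)`, `a + b + c = n`, of a triangle by labels from the support
(`l₁`, `l₂`, `l₃` belonging to the three coordinates) or the extra label `z`. -/
structure IsLabelling (n : ℕ) (l₁ l₂ l₃ z : Fin 5) (F : ℕ → ℕ → ℕ → Fin 5) : Prop where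
  ne₁₂ : l₁ ≠ l₂
  ne₁₃ : l₁ ≠ l₃
  ne₂₃ : l₂ ≠ l₃
  ne₁ : l₁ ≠ z
  ne₂ : l₂ ≠ z
  ne₃ : l₃ ≠ z
  mem : ∀ a b c, a + b + c = n → F a b c = l₁ ∨ F a b c = l₂ ∨ F a b c = l₃ ∨ F a b c = z
  supp₁ : ∀ b c, b + c = n → F 0 b c ≠ l₁
  supp₂ : ∀ a c, a + c = n → F a 0 c ≠ l₂
  supp₃ : ∀ a b, a + b = n → F a b 0 ≠ l₃
  term₁ : F n 0 0 = l₁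
  term₂ : F 0 n 0 = l₂
  term₃ : F 0 0 n = l₃

/-- The `j`-th label in the row with third coordinate `c`. -/
def rowLabel (n : ℕ) (F : ℕ → ℕ → ℕ → Fin 5) (c j : ℕ) : Fin 5 := F (n - c - j) j c

/-- The number of cut edges in row `c`. -/
def rowCut (n : ℕ) (F : ℕ → ℕ → ℕ → Fin 5) (c : ℕ) : ℝ :=
  ∑ j ∈ Finset.range (n - c), disc (rowLabel n F c j) (rowLabel n F c (j + 1))

/-- The number of cut edges between the rows `c` and `c + 1`. -/
def stripCut (n : ℕ) (F : ℕ → ℕ → ℕ → Fin 5) (c : ℕ) : ℝ :=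
  ∑ j ∈ Finset.range (n - c), (disc (rowLabel n F c j) (rowLabel n F (c + 1) j)
    + disc (rowLabel n F c (j + 1)) (rowLabel n F (c + 1) j))

/-- The number of edges from nodes of row `c` with label in `X` to row `c + 1`. -/
def upEdges (n : ℕ) (F : ℕ → ℕ → ℕ → Fin 5) (X : Finset (Fin 5)) (c : ℕ) : ℝ :=
  ∑ j ∈ Finset.range (n - c), (ind X (rowLabel n F c j) + ind X (rowLabel n F c (j + 1)))

/-- The number of cut edges of the triangle. -/
def unitCut (n : ℕ) (F : ℕ → ℕ → ℕ → Fin 5) : ℝ :=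
  ∑ c ∈ Finset.range n, (rowCut n F c + stripCut n F c)

section Sweep

variable {n : ℕ} {l₁ l₂ l₃ z : Fin 5} {F : ℕ → ℕ → ℕ → Fin 5}

lemma rowCut_nonneg (c : ℕ) : 0 ≤ rowCut n F c := Finset.sum_nonneg fun _ _ => disc_nonneg _ _

lemma upEdges_self (X : Finset (Fin 5)) : upEdges n F X n = 0 := by simp [upEdges]

lemma upEdges_eq_zero {X : Finset (Fin 5)} {c : ℕ} (h : ∀ j ≤ n - c, rowLabel n F c j ∉ X) :
    upEdges n F X c = 0 := by
  refine Finset.sum_eq_zero fun j hj => ?_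
  have := Finset.mem_range.1 hj
  rw [ind_of_notMem (h j (by omega)), ind_of_notMem (h (j + 1) (by omega)), add_zero]

lemma upEdges_pair (h : l₃ ≠ z) (c : ℕ) :
    upEdges n F {l₃, z} c = upEdges n F {l₃} c + upEdges n F {z} c := by
  rw [upEdges, upEdges, upEdges, ← Finset.sum_add_distrib]
  have key : ∀ x, ind ({l₃, z} : Finset (Fin 5)) x = ind {l₃} x + ind {z} x := by
    intro x
    simp only [ind, Finset.mem_insert, Finset.mem_singleton]
    by_cases h1 : x = l₃
    · simp [h1, h]
    · simp [h1]
  refine Finset.sum_congr rfl fun j _ => ?_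
  rw [key, key]; ring

lemma unitCut_eq : unitCut n F =
    rowCut n F 0 + ∑ c ∈ Finset.Ico 0 n, (stripCut n F c + rowCut n F (c + 1)) := by
  have h : rowCut n F n = 0 := by simp [rowCut]
  rw [← Finset.range_eq_Ico, unitCut, Finset.sum_add_distrib, Finset.sum_add_distrib]
  have := Finset.sum_range_succ (rowCut n F) n
  rw [Finset.sum_range_succ', h] at this
  linarith

lemma rowLabel_start (hF : IsLabelling n l₁ l₂ l₃ z F) {c : ℕ} (hc : c ≤ n) :
    rowLabel n F c 0 = l₁ ∨ rowLabel n F c 0 = l₃ ∨ rowLabel n F c 0 = z := by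
  have h := hF.mem (n - c) 0 c (by omega)
  have h2 := hF.supp₂ (n - c) c (by omega)
  simp only [rowLabel, Nat.sub_zero]
  tauto

lemma rowLabel_end (hF : IsLabelling n l₁ l₂ l₃ z F) {c : ℕ} (hc : c ≤ n) :
    rowLabel n F c (n - c) ≠ l₁ := by
  have h := hF.supp₁ (n - c) c (by omega)
  simpa [rowLabel] using h

lemma strip_ge (hF : IsLabelling n l₁ l₂ l₃ z F) {X : Finset (Fin 5)} (h3 : l₃ ∈ X) {c : ℕ}
    (hc : c < n) (hX : z ∈ X ∨ ∃ j ≤ n - (c + 1), rowLabel n F (c + 1) j ≠ z) :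
    2 + upEdges n F X (c + 1) - upEdges n F X c ≤ stripCut n F c + rowCut n F (c + 1) := by
  have e : n - c = n - (c + 1) + 1 := by omega
  have := strip_bound X (rowLabel n F c) (rowLabel n F (c + 1)) (n - (c + 1)) ?_
  · simpa only [upEdges, stripCut, rowCut, e] using this
  · rcases rowLabel_start hF (c := c + 1) hc with h | h | h
    · exact Or.inr ⟨_, le_rfl, h ▸ rowLabel_end hF hc⟩
    · exact Or.inl (h ▸ h3)
    · rcases hX with hX | hX
      · exact Or.inl (h ▸ hX)
      · exact Or.inr (h ▸ hX)

lemma strip_ge_succ (hF : IsLabelling n l₁ l₂ l₃ z F) {c : ℕ} (hc : c < n)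
    (h₁ : F (n - (c + 1)) 0 (c + 1) = l₁) (h₂ : F 0 (n - (c + 1)) (c + 1) = l₂)
    (hz : ∃ j ≤ n - (c + 1), rowLabel n F (c + 1) j = z) :
    3 + upEdges n F {l₃} (c + 1) - upEdges n F {l₃} c ≤ stripCut n F c + rowCut n F (c + 1) := by
  have e : n - c = n - (c + 1) + 1 := by omega
  obtain ⟨j, hj, hjz⟩ := hz
  have h₁' : rowLabel n F (c + 1) 0 = l₁ := by simpa [rowLabel] using h₁
  have h₂' : rowLabel n F (c + 1) (n - (c + 1)) = l₂ := by simpa [rowLabel] using h₂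
  have := strip_bound_succ {l₃} (rowLabel n F c) (rowLabel n F (c + 1)) (n - (c + 1))
    (by simpa [h₁'] using hF.ne₁₃) (by simpa [h₂'] using hF.ne₂₃) hj
    (by simpa [hjz] using hF.ne₃.symm) (by rw [hjz, h₁']; exact hF.ne₁.symm)
    (by rw [hjz, h₂']; exact hF.ne₂.symm)
  simpa only [upEdges, stripCut, rowCut, e] using this

lemma sweep_pair (hF : IsLabelling n l₁ l₂ l₃ z F) {a b : ℕ} (hab : a ≤ b) (hb : b ≤ n) :
    2 * ((b : ℝ) - a) + upEdges n F {l₃, z} b - upEdges n F {l₃, z} a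
      ≤ ∑ c ∈ Finset.Ico a b, (stripCut n F c + rowCut n F (c + 1)) := by
  induction b, hab using Nat.le_induction with
  | base => simp
  | succ b hab ih =>
    rw [Finset.sum_Ico_succ_top hab]
    have := strip_ge hF (X := {l₃, z}) (by simp) (c := b) (by omega) (Or.inl (by simp))
    have := ih (by omega)
    push_cast
    linarith

open Classical in
lemma sweep_single (hF : IsLabelling n l₁ l₂ l₃ z F) {a b : ℕ} (hab : a ≤ b) (hb : b ≤ n)
    (hu : ∀ c, a < c → c ≤ b → ∃ j ≤ n - c, rowLabel n F c j ≠ z) :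
    2 * ((b : ℝ) - a) + upEdges n F {l₃} b - upEdges n F {l₃} a
        + ((Finset.Ioc a b).filter fun c => F (n - c) 0 c = l₁ ∧ F 0 (n - c) c = l₂ ∧
            ∃ j ≤ n - c, rowLabel n F c j = z).card
      ≤ ∑ c ∈ Finset.Ico a b, (stripCut n F c + rowCut n F (c + 1)) := by
  induction b, hab using Nat.le_induction with
  | base => simp
  | succ b hab ih =>
    rw [Finset.sum_Ico_succ_top hab, ← Finset.insert_Ioc_right_eq_Ioc_add_one hab,
      Finset.filter_insert]
    have ih := ih (by omega) (fun c h h' => hu c h (by omega))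
    split_ifs with hg
    · rw [Finset.card_insert_of_notMem (by simp)]
      have := strip_ge_succ hF (c := b) (by omega) hg.1 hg.2.1 hg.2.2
      push_cast
      linarith
    · have := strip_ge hF (X := {l₃}) (by simp) (c := b) (by omega)
        (Or.inr (hu (b + 1) (by omega) le_rfl))
      push_cast
      linarith

lemma upEdges_bottom (hF : IsLabelling n l₁ l₂ l₃ z F) : upEdges n F {l₃} 0 = 0 := by
  refine upEdges_eq_zero fun j hj => ?_
  simpa [rowLabel] using hF.supp₃ (n - j) j (by omega)

lemma one_le_rowCut_zero (hF : IsLabelling n l₁ l₂ l₃ z F) : 1 ≤ rowCut n F 0 := by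
  have := disc_le_sum_range (rowLabel n F 0) n
  rw [disc_of_ne (by simpa [rowLabel, hF.term₁, hF.term₂] using hF.ne₁₂)] at this
  simpa [rowCut] using this

lemma unitCut_ge_add_card (hF : IsLabelling n l₁ l₂ l₃ z F) {D : ℕ} (hD : D ≤ n)
    (hu : ∀ c ≤ n, ∃ j ≤ n - c, rowLabel n F c j ≠ z)
    (h₁ : ∀ c ≤ D, F (n - c) 0 c = l₁) (h₂ : ∀ c ≤ D, F 0 (n - c) c = l₂) {S : Finset ℕ}
    (hS : ∀ c ∈ S, 1 ≤ c ∧ c ≤ D ∧ ∃ j ≤ n - c, rowLabel n F c j = z) :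
    2 * n + 1 + (S.card : ℝ) ≤ unitCut n F := by
  classical
  have h := sweep_single hF (Nat.zero_le n) le_rfl (fun c _ hc => hu c hc)
  rw [upEdges_self, upEdges_bottom hF] at h
  have hc : (S.card : ℝ) ≤ ((Finset.Ioc 0 n).filter fun c => F (n - c) 0 c = l₁ ∧
      F 0 (n - c) c = l₂ ∧ ∃ j ≤ n - c, rowLabel n F c j = z).card := by
    refine Nat.cast_le.2 (Finset.card_le_card fun c hc => ?_)
    obtain ⟨h1, h2, h3⟩ := hS c hc
    simp only [Finset.mem_filter, Finset.mem_Ioc]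
    exact ⟨by omega, h₁ c h2, h₂ c h2, h3⟩
  rw [unitCut_eq]
  have := one_le_rowCut_zero hF
  push_cast at h
  linarith

lemma unitCut_ge_add_upEdges (hF : IsLabelling n l₁ l₂ l₃ z F) {s : ℕ} (hs : s ≤ n)
    (hz : ∀ j ≤ n, rowLabel n F 0 j ≠ z)
    (hu : ∀ c, s < c → c ≤ n → ∃ j ≤ n - c, rowLabel n F c j ≠ z) :
    2 * n + 1 + upEdges n F {z} s ≤ unitCut n F := by
  have ha := sweep_pair hF (Nat.zero_le s) hs
  have hb := sweep_single hF hs le_rfl hu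
  have h0 : upEdges n F {z} 0 = 0 := upEdges_eq_zero fun j hj => by simpa using hz j (by simpa using hj)
  rw [upEdges_pair hF.ne₃, upEdges_pair hF.ne₃, upEdges_bottom hF, h0] at ha
  rw [upEdges_self] at hb
  rw [unitCut_eq, ← Finset.sum_Ico_consecutive _ (Nat.zero_le s) hs]
  have := one_le_rowCut_zero hF
  have hn := Nat.cast_nonneg (α := ℝ) ((Finset.Ioc s n).filter fun c => F (n - c) 0 c = l₁ ∧
            F 0 (n - c) c = l₂ ∧ ∃ j ≤ n - c, rowLabel n F c j = z).card
  classical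
  push_cast at ha
  linarith

lemma unitCut_ge_of_row (hF : IsLabelling n l₁ l₂ l₃ z F) {b : ℕ} (hb : b ≤ n)
    (hz : ∀ j ≤ n - b, rowLabel n F b j ≠ z) (h₁ : ∀ c ≤ b, F (n - c) 0 c = l₁) :
    2 * n + 1 ≤ unitCut n F := by
  have ha := sweep_single hF (Nat.zero_le b) hb (fun c _ hc => ⟨0, Nat.zero_le _, by
    rw [rowLabel, Nat.sub_zero, h₁ c hc]; exact hF.ne₁⟩)
  have hb' := sweep_pair hF hb le_rfl
  have h0 : upEdges n F {z} b = 0 := upEdges_eq_zero fun j hj => by simpa using hz j hj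
  rw [upEdges_bottom hF] at ha
  rw [upEdges_self, upEdges_pair hF.ne₃, h0] at hb'
  rw [unitCut_eq, ← Finset.sum_Ico_consecutive _ (Nat.zero_le b) hb]
  have := one_le_rowCut_zero hF
  push_cast at ha
  have hn := Nat.cast_nonneg (α := ℝ) (Finset.card ((Finset.Ioc 0 b).filter fun c => F (n - c) 0 c = l₁ ∧
            F 0 (n - c) c = l₂ ∧ ∃ j ≤ n - c, rowLabel n F c j = z))
  linarith

/-- A row whose ends do not have the label `z` of some inner node has two cut edges. -/
lemma two_le_rowCut {c : ℕ} (h₁ : F (n - c) 0 c ≠ z) (h₂ : F 0 (n - c) c ≠ z)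
    (hz : ∃ j ≤ n - c, rowLabel n F c j = z) : 2 ≤ rowCut n F c := by
  obtain ⟨j, hj, hjz⟩ := hz
  have := disc_add_disc_le_sum_range (rowLabel n F c) hj
  rw [hjz, disc_of_ne (by simpa [rowLabel] using h₁),
    disc_of_ne (by simpa [rowLabel] using h₂.symm)] at this
  rw [rowCut]
  linarith

end Sweep

section CornerFlow

variable {α : Type*} [DecidableEq α]

lemma sum_triangle_comm (D : ℕ) (f : ℕ → ℕ → ℝ) :
    ∑ r ∈ Finset.range D, ∑ q ∈ Finset.range (D - r), f q r
      = ∑ q ∈ Finset.range D, ∑ r ∈ Finset.range (D - q), f q r :=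
  Finset.sum_comm' fun x y => by simp only [Finset.mem_range]; omega

lemma sum_range_sum_range (D : ℕ) (x : ℕ → ℝ) :
    ∑ r ∈ Finset.range (D + 1), ∑ i ∈ Finset.range r, x i
      = ∑ i ∈ Finset.range D, ((D : ℝ) - i) * x i := by
  induction D with
  | zero => simp
  | succ D ih =>
    rw [Finset.sum_range_succ, ih, Finset.sum_range_succ _ D, Finset.sum_range_succ _ D, ← add_assoc,
      ← Finset.sum_add_distrib]
    push_cast
    congr 1
    · exact Finset.sum_congr rfl fun i _ => by ring
    · ring

/-- Half of the flow from a corner node with label `l` to the row at depth `D + 1`: the paths run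
along the side `q = 0` and then along a line with constant `r`. -/
lemma corner_half (G : ℕ → ℕ → α) (D : ℕ) {δ : ℝ} (hδ : δ ≤ 1) {l z : α}
    (hl : G 0 0 = l) (hlz : l ≠ z) {S : Finset ℕ}
    (hS : ∀ r ∈ S, 1 ≤ r ∧ r ≤ D ∧ (∃ q, q + r ≤ D ∧ G q r = z) ∧ G (D - r + 1) r ≠ z) :
    ∑ r ∈ Finset.range (D + 1), disc l (G (D - r + 1) r) + S.card
      ≤ ∑ r ∈ Finset.range D, ∑ q ∈ Finset.range (D - r),
            (if r = 0 then 1 - δ else 1) * disc (G q r) (G (q + 1) r)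
        + ∑ r ∈ Finset.range D, ((D : ℝ) - r) * disc (G 0 r) (G 0 (r + 1))
        + ∑ r ∈ Finset.range (D + 1), disc (G (D - r) r) (G (D - r + 1) r)
        + δ * disc l (G D 0) := by
  have hcard : (S.card : ℝ) = ∑ r ∈ Finset.range (D + 1), if r ∈ S then (1 : ℝ) else 0 := by
    rw [Finset.sum_ite_mem, Finset.inter_eq_right.2 fun r hr => Finset.mem_range.2 (by
      have := hS r hr; omega)]
    simp
  have hlast : δ * disc l (G D 0)
      = ∑ r ∈ Finset.range (D + 1), if r = 0 then δ * disc l (G D 0) else 0 := by simp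
  have hfirst : ∑ r ∈ Finset.range D, ∑ q ∈ Finset.range (D - r),
            (if r = 0 then 1 - δ else 1) * disc (G q r) (G (q + 1) r)
      = ∑ r ∈ Finset.range (D + 1), ∑ q ∈ Finset.range (D - r),
            (if r = 0 then 1 - δ else 1) * disc (G q r) (G (q + 1) r) := by
    rw [Finset.sum_range_succ]; simp
  rw [hcard, hlast, hfirst, ← sum_range_sum_range, ← Finset.sum_add_distrib,
    ← Finset.sum_add_distrib, ← Finset.sum_add_distrib, ← Finset.sum_add_distrib]
  refine Finset.sum_le_sum fun r hr => ?_
  have hr := Finset.mem_range.1 hr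
  have h1 := disc_le_sum_range (fun i => G 0 i) r
  simp only [hl] at h1
  by_cases h0 : r = 0
  · subst h0
    have hS0 : 0 ∉ S := fun h => by have := hS 0 h; omega
    have h2 := disc_le_sum_range (fun q => G q 0) D
    simp only [hl] at h2
    simp only [hS0, if_false, if_true, Nat.sub_zero, Finset.range_zero, Finset.sum_empty,
      ← Finset.mul_sum]
    have h3 := disc_triangle l (G D 0) (G (D + 1) 0)
    nlinarith
  · simp only [h0, if_false, one_mul]
    by_cases hrS : r ∈ S
    · obtain ⟨-, -, ⟨q, hq, hqz⟩, hne⟩ := hS r hrS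
      have h2 := disc_add_disc_le_sum_range (fun q => G q r) (show q ≤ D - r by omega)
      simp only [hqz] at h2
      simp only [hrS, if_true]
      have h3 := disc_triangle z (G (D - r) r) (G (D - r + 1) r)
      rw [disc_of_ne hne.symm] at h3
      have h4 := disc_triangle l (G 0 r) z
      rw [disc_of_ne hlz] at h4
      linarith [disc_le_one l (G (D - r + 1) r)]
    · have h2 := disc_le_sum_range (fun q => G q r) (D - r)
      simp only [hrS, if_false]
      have h3 := disc_triangle l (G (D - r) r) (G (D - r + 1) r)
      have h4 := disc_triangle l (G 0 r) (G (D - r) r)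
      linarith

/-- The weighted cut of a corner triangle together with the edges below it is at least the number
of edges below it that are cut when the whole triangle gets the label `l` of its corner, up to
a loss on the two sides. -/
lemma corner_flow (G : ℕ → ℕ → α) (D : ℕ) {δ : ℝ} (hδ : δ ≤ 1) {l z : α}
    (hl : G 0 0 = l) (hlz : l ≠ z) {S : Finset ℕ}
    (hS : ∀ r ∈ S, 1 ≤ r ∧ r ≤ D ∧ (∃ q, q + r ≤ D ∧ G q r = z) ∧ G (D - r + 1) r ≠ z) :
    ∑ r ∈ Finset.range (D + 1), (disc l (G (D - r + 1) r) + disc l (G (D - r) (r + 1))) + S.card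
      ≤ ∑ r ∈ Finset.range D, ∑ q ∈ Finset.range (D - r),
            ((if r = 0 then (D : ℝ) + 1 - δ - q else 1) * disc (G q r) (G (q + 1) r)
              + (if q = 0 then (D : ℝ) + 1 - δ - r else 1) * disc (G q r) (G q (r + 1)))
        + ∑ r ∈ Finset.range (D + 1), (disc (G (D - r) r) (G (D - r + 1) r)
            + disc (G (D - r) r) (G (D - r) (r + 1)))
        + δ * (disc l (G D 0) + disc l (G 0 D)) := by
  have h1 := corner_half G D hδ hl hlz hS
  have h2 := corner_half (fun a b => G b a) D hδ hl hlz (S := ∅) (by simp)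
  have key : ∀ x : ℕ → ℕ → ℝ, ∑ r ∈ Finset.range D, ∑ q ∈ Finset.range (D - r),
      (if r = 0 then (D : ℝ) + 1 - δ - q else 1) * x q r
      = ∑ r ∈ Finset.range D, ∑ q ∈ Finset.range (D - r), (if r = 0 then 1 - δ else 1) * x q r
        + ∑ q ∈ Finset.range D, ((D : ℝ) - q) * x q 0 := by
    intro x
    have : ∑ q ∈ Finset.range D, ((D : ℝ) - q) * x q 0
      = ∑ r ∈ Finset.range D, ∑ q ∈ Finset.range (D - r),
          if r = 0 then ((D : ℝ) - q) * x q r else 0 := by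
      rcases Nat.eq_zero_or_pos D with h | h
      · subst h; simp
      · refine Eq.symm ((Finset.sum_eq_single_of_mem 0 (Finset.mem_range.2 h)
          fun r _ hr => by simp [hr]).trans ?_)
        simp
    rw [this, ← Finset.sum_add_distrib]
    refine Finset.sum_congr rfl fun r _ => ?_
    rw [← Finset.sum_add_distrib]
    refine Finset.sum_congr rfl fun q _ => ?_
    split_ifs <;> ring
  have e1 := key fun q r => disc (G q r) (G (q + 1) r)
  have e2 := key fun q r => disc (G r q) (G r (q + 1))
  have e3 : ∑ r ∈ Finset.range D, ∑ q ∈ Finset.range (D - r),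
      (if q = 0 then (D : ℝ) + 1 - δ - r else 1) * disc (G q r) (G q (r + 1))
      = ∑ r ∈ Finset.range D, ∑ q ∈ Finset.range (D - r),
      (if r = 0 then (D : ℝ) + 1 - δ - q else 1) * disc (G r q) (G r (q + 1)) :=
    sum_triangle_comm D fun q r =>
      (if q = 0 then (D : ℝ) + 1 - δ - r else 1) * disc (G q r) (G q (r + 1))
  have flip : ∀ f : ℕ → ℕ → ℝ, ∑ r ∈ Finset.range (D + 1), f r (D - r)
      = ∑ r ∈ Finset.range (D + 1), f (D - r) r := by
    intro f
    rw [← Finset.sum_range_reflect]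
    refine Finset.sum_congr rfl fun r hr => ?_
    have := Finset.mem_range.1 hr
    rw [show D + 1 - 1 - r = D - r by omega, show D - (D - r) = r by omega]
  have f1 := flip fun a b => disc l (G a (b + 1))
  have f2 := flip fun a b => disc (G a b) (G a (b + 1))
  simp only [Finset.sum_add_distrib, Finset.card_empty, Nat.cast_zero] at *
  linarith

end CornerFlow

section TriangleSums

/-- The triples of natural numbers with sum `N`. -/
def tri (N : ℕ) : Finset (ℕ × ℕ × ℕ) :=
  (Finset.range (N + 1) ×ˢ Finset.range (N + 1) ×ˢ Finset.range (N + 1)).filter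
    fun x => x.1 + x.2.1 + x.2.2 = N

@[simp] lemma mem_tri {N : ℕ} {x : ℕ × ℕ × ℕ} : x ∈ tri N ↔ x.1 + x.2.1 + x.2.2 = N := by
  simp only [tri, Finset.mem_filter, Finset.mem_product, Finset.mem_range]
  omega

lemma sum_tri_rotate (N : ℕ) (f : ℕ → ℕ → ℕ → ℝ) :
    ∑ x ∈ tri N, f x.2.1 x.2.2 x.1 = ∑ x ∈ tri N, f x.1 x.2.1 x.2.2 :=
  Finset.sum_nbij' (fun x => (x.2.1, x.2.2, x.1)) (fun x => (x.2.2, x.1, x.2.1))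
    (fun x hx => by simp only [mem_tri] at *; omega) (fun x hx => by simp only [mem_tri] at *; omega)
    (fun _ _ => rfl) (fun _ _ => rfl) (fun _ _ => rfl)

lemma sum_tri_rows {n : ℕ} (hn : 1 ≤ n) (f : ℕ → ℕ → ℕ → ℝ) :
    ∑ x ∈ tri (n - 1), f x.1 x.2.1 x.2.2
      = ∑ c ∈ Finset.range n, ∑ j ∈ Finset.range (n - c), f (n - 1 - c - j) j c := by
  rw [Finset.sum_sigma']
  refine Finset.sum_nbij' (fun x => ⟨x.2.2, x.2.1⟩) (fun y => (n - 1 - y.1 - y.2, y.2, y.1))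
    (fun x hx => ?_) (fun y hy => ?_) (fun x hx => ?_) (fun y hy => ?_) (fun x hx => ?_)
  · simp only [mem_tri, Finset.mem_sigma, Finset.mem_range] at *; omega
  · simp only [mem_tri, Finset.mem_sigma, Finset.mem_range] at *; omega
  · simp only [mem_tri] at hx
    rw [show n - 1 - x.2.2 - x.2.1 = x.1 by omega]
  · rfl
  · simp only [mem_tri] at hx
    rw [show n - 1 - x.2.2 - x.2.1 = x.1 by omega]

lemma sum_tri_corner {n D : ℕ} (hD : D < n) (f : ℕ → ℕ → ℕ → ℝ) :
    ∑ x ∈ (tri (n - 1)).filter (fun x => n - D ≤ x.1), f x.1 x.2.1 x.2.2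
      = ∑ r ∈ Finset.range D, ∑ q ∈ Finset.range (D - r), f (n - 1 - r - q) q r := by
  rw [Finset.sum_sigma']
  refine Finset.sum_nbij' (fun x => ⟨x.2.2, x.2.1⟩) (fun y => (n - 1 - y.1 - y.2, y.2, y.1))
    (fun x hx => ?_) (fun y hy => ?_) (fun x hx => ?_) (fun y hy => ?_) (fun x hx => ?_)
  · simp only [Finset.mem_filter, mem_tri, Finset.mem_sigma, Finset.mem_range] at *; omega
  · simp only [Finset.mem_filter, mem_tri, Finset.mem_sigma, Finset.mem_range] at *; omega
  · simp only [Finset.mem_filter, mem_tri] at hx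
    rw [show n - 1 - x.2.2 - x.2.1 = x.1 by omega]
  · rfl
  · simp only [Finset.mem_filter, mem_tri] at hx
    rw [show n - 1 - x.2.2 - x.2.1 = x.1 by omega]

lemma sum_tri_layer {n D : ℕ} (hD : D < n) (f : ℕ → ℕ → ℕ → ℝ) :
    ∑ x ∈ (tri (n - 1)).filter (fun x => x.1 + D + 1 = n), f x.1 x.2.1 x.2.2
      = ∑ r ∈ Finset.range (D + 1), f (n - D - 1) (D - r) r := by
  refine Finset.sum_nbij' (fun x => x.2.2) (fun r => (n - D - 1, D - r, r))
    (fun x hx => ?_) (fun y hy => ?_) (fun x hx => ?_) (fun y hy => ?_) (fun x hx => ?_)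
  · simp only [Finset.mem_filter, mem_tri, Finset.mem_range] at *; omega
  · simp only [Finset.mem_filter, mem_tri, Finset.mem_range] at *; omega
  · simp only [Finset.mem_filter, mem_tri] at hx
    rw [show n - D - 1 = x.1 by omega, show D - x.2.2 = x.2.1 by omega]
  · rfl
  · simp only [Finset.mem_filter, mem_tri] at hx
    rw [show n - D - 1 = x.1 by omega, show D - x.2.2 = x.2.1 by omega]

end TriangleSums

/-- The weight, in units of `ρ`, of the edge between `(p + 1, q, r)` and `(p, q + 1, r)`. -/
noncomputable def wt (n p q r : ℕ) : ℝ :=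
  if 2 * n < 3 * r then 0
  else if r = 0 ∧ 2 * n < 3 * p then (n : ℝ) / 3 - q
  else if r = 0 ∧ 2 * n < 3 * q then (n : ℝ) / 3 - p
  else 1

section Cells

variable (n : ℕ) (F : ℕ → ℕ → ℕ → Fin 5) (p q r : ℕ)

/-- Whether the edge of the cell `(p, q, r)` in the first two coordinates is cut. -/
def cutAB : ℝ := disc (F (p + 1) q r) (F p (q + 1) r)

/-- Whether the edge of the cell `(p, q, r)` in the last two coordinates is cut. -/
def cutBC : ℝ := disc (F p (q + 1) r) (F p q (r + 1))

/-- Whether the edge of the cell `(p, q, r)` in the outer two coordinates is cut. -/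
def cutCA : ℝ := disc (F p q (r + 1)) (F (p + 1) q r)

/-- The number of cut edges of a cell. -/
def cellCut : ℝ := cutAB F p q r + cutBC F p q r + cutCA F p q r

/-- The weight of the cut edges of a cell. -/
noncomputable def wcellCut : ℝ :=
  wt n p q r * cutAB F p q r + wt n q r p * cutBC F p q r + wt n r p q * cutCA F p q r

/-- The weight of the cut edges of the triangle. -/
noncomputable def wCut : ℝ := ∑ x ∈ tri (n - 1), wcellCut n F x.1 x.2.1 x.2.2

/-- The labelling after a cyclic shift of the coordinates. -/
def rot (F : ℕ → ℕ → ℕ → Fin 5) : ℕ → ℕ → ℕ → Fin 5 := fun a b c => F c a b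

/-- The labelling after a transposition of the last two coordinates. -/
def flip (F : ℕ → ℕ → ℕ → Fin 5) : ℕ → ℕ → ℕ → Fin 5 := fun a b c => F a c b

variable {n F p q r}

lemma cutAB_nonneg : 0 ≤ cutAB F p q r := disc_nonneg _ _
lemma cutBC_nonneg : 0 ≤ cutBC F p q r := disc_nonneg _ _
lemma cutCA_nonneg : 0 ≤ cutCA F p q r := disc_nonneg _ _

lemma cellCut_rot : cellCut (rot F) q r p = cellCut F p q r := by
  simp only [cellCut, cutAB, cutBC, cutCA, rot]; ring

lemma wcellCut_rot : wcellCut n (rot F) q r p = wcellCut n F p q r := by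
  simp only [wcellCut, cutAB, cutBC, cutCA, rot]; ring

lemma wt_comm (h : p + q + r = n - 1) (hn : 1 ≤ n) : wt n p q r = wt n q p r := by
  unfold wt
  split_ifs <;> first | rfl | omega

lemma wt_nonneg (h : p + q + r = n - 1) (hn : 1 ≤ n) : 0 ≤ wt n p q r := by
  unfold wt
  split_ifs with h1 h2 h3
  · exact le_rfl
  · have : 3 * q ≤ n := by omega
    have : (3 * q : ℝ) ≤ n := by exact_mod_cast this
    linarith
  · have : 3 * p ≤ n := by omega
    have : (3 * p : ℝ) ≤ n := by exact_mod_cast this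
    linarith
  · norm_num

lemma wcellCut_nonneg (h : p + q + r = n - 1) (hn : 1 ≤ n) : 0 ≤ wcellCut n F p q r :=
  add_nonneg (add_nonneg (mul_nonneg (wt_nonneg h hn) cutAB_nonneg)
    (mul_nonneg (wt_nonneg (by omega) hn) cutBC_nonneg))
    (mul_nonneg (wt_nonneg (by omega) hn) cutCA_nonneg)

lemma wcellCut_flip (h : p + q + r = n - 1) (hn : 1 ≤ n) :
    wcellCut n (flip F) p r q = wcellCut n F p q r := by
  simp only [wcellCut, cutAB, cutBC, cutCA, flip]
  rw [wt_comm (p := p) (q := r) (by omega) hn, wt_comm (p := r) (q := q) (by omega) hn,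
    wt_comm (p := q) (q := p) (by omega) hn, disc_comm (F (p + 1) q r) (F p q (r + 1)),
    disc_comm (F p q (r + 1)) (F p (q + 1) r), disc_comm (F p (q + 1) r) (F (p + 1) q r)]
  ring

lemma wCut_rot : wCut n (rot F) = wCut n F := by
  rw [wCut, ← sum_tri_rotate]
  exact Finset.sum_congr rfl fun x _ => wcellCut_rot

lemma sum_tri_flip (N : ℕ) (f : ℕ → ℕ → ℕ → ℝ) :
    ∑ x ∈ tri N, f x.1 x.2.2 x.2.1 = ∑ x ∈ tri N, f x.1 x.2.1 x.2.2 :=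
  Finset.sum_nbij' (fun x => (x.1, x.2.2, x.2.1)) (fun x => (x.1, x.2.2, x.2.1))
    (fun x hx => by simp only [mem_tri] at *; omega) (fun x hx => by simp only [mem_tri] at *; omega)
    (fun _ _ => rfl) (fun _ _ => rfl) (fun _ _ => rfl)

lemma unitCut_eq_sum (hn : 1 ≤ n) :
    unitCut n F = ∑ x ∈ tri (n - 1), cellCut F x.1 x.2.1 x.2.2 := by
  rw [sum_tri_rows hn, unitCut]
  refine Finset.sum_congr rfl fun c hc => ?_
  rw [rowCut, stripCut, ← Finset.sum_add_distrib]
  refine Finset.sum_congr rfl fun j hj => ?_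
  have := Finset.mem_range.1 hc
  have := Finset.mem_range.1 hj
  simp only [cellCut, cutAB, cutBC, cutCA, rowLabel]
  rw [show n - 1 - c - j + 1 = n - c - j by omega, show n - c - (j + 1) = n - 1 - c - j by omega,
    show n - (c + 1) - j = n - 1 - c - j by omega, disc_comm (F (n - 1 - c - j) j (c + 1)) (F (n - c - j) j c)]
  ring

lemma unitCut_rot (hn : 1 ≤ n) : unitCut n (rot F) = unitCut n F := by
  rw [unitCut_eq_sum hn, unitCut_eq_sum hn, ← sum_tri_rotate]
  exact Finset.sum_congr rfl fun x _ => cellCut_rot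

lemma IsLabelling.rot {l₁ l₂ l₃ z : Fin 5} (hF : IsLabelling n l₁ l₂ l₃ z F) :
    IsLabelling n l₂ l₃ l₁ z (rot F) where
  ne₁₂ := hF.ne₂₃
  ne₁₃ := hF.ne₁₂.symm
  ne₂₃ := hF.ne₁₃.symm
  ne₁ := hF.ne₂
  ne₂ := hF.ne₃
  ne₃ := hF.ne₁
  mem a b c h := by
    have := hF.mem c a b (by omega)
    simp only [MultiwayCut.rot]; tauto
  supp₁ b c h := hF.supp₂ _ _ (by omega)
  supp₂ a c h := hF.supp₃ _ _ (by omega)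
  supp₃ a b h := hF.supp₁ _ _ (by omega)
  term₁ := hF.term₂
  term₂ := hF.term₃
  term₃ := hF.term₁

end Cells

section Corners

/-- The contribution of a cell to the change of the cut when the corner triangle of depth `D` at
the first corner is filled with the label `l`. -/
noncomputable def cornerTerm (n D : ℕ) (l : Fin 5) (F : ℕ → ℕ → ℕ → Fin 5) (p q r : ℕ) : ℝ :=
  (if n - D ≤ p then wcellCut n F p q r else 0)
    + if p + D + 1 = n then
        cutAB F p q r + cutCA F p q r - disc l (F p (q + 1) r) - disc l (F p q (r + 1)) else 0

/-- The total change of the cut when the first corner triangle is filled. -/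
noncomputable def cornerGain (n D : ℕ) (l : Fin 5) (F : ℕ → ℕ → ℕ → Fin 5) : ℝ :=
  ∑ x ∈ tri (n - 1), cornerTerm n D l F x.1 x.2.1 x.2.2

/-- The labelling in which the three corner triangles of depth `D` are filled. -/
def fillCorners (n D : ℕ) (l₁ l₂ l₃ : Fin 5) (F : ℕ → ℕ → ℕ → Fin 5) : ℕ → ℕ → ℕ → Fin 5 :=
  fun a b c => if n - D ≤ a then l₁ else if n - D ≤ b then l₂ else if n - D ≤ c then l₃ else F a b c

variable {n D : ℕ} {l₁ l₂ l₃ z : Fin 5} {F : ℕ → ℕ → ℕ → Fin 5}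

lemma cornerGain_flip (hn : 1 ≤ n) {l : Fin 5} : cornerGain n D l (flip F) = cornerGain n D l F := by
  rw [cornerGain, ← sum_tri_flip]
  refine Finset.sum_congr rfl fun x hx => ?_
  simp only [cornerTerm, wcellCut_flip (mem_tri.1 hx) hn]
  congr 1
  simp only [cutAB, cutCA, flip]
  rw [disc_comm (F (x.1 + 1) x.2.1 x.2.2) (F x.1 x.2.1 (x.2.2 + 1)),
    disc_comm (F x.1 (x.2.1 + 1) x.2.2) (F (x.1 + 1) x.2.1 x.2.2)]
  split_ifs <;> ring

lemma wcellCut_middle (h₁ : 3 * D + 1 ≤ n) (h₂ : n ≤ 3 * D + 3) {p q r : ℕ}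
    (hp : p < n - D) (hq : q < n - D) (hr : r < n - D) :
    wcellCut n F p q r = cellCut F p q r := by
  have hw : ∀ a b c : ℕ, a < n - D → b < n - D → c < n - D → wt n a b c = 1 := by
    intro a b c ha hb hc
    unfold wt
    rw [if_neg (by omega), if_neg (by omega), if_neg (by omega)]
  simp only [wcellCut, cellCut, hw _ _ _ hp hq hr, hw _ _ _ hq hr hp, hw _ _ _ hr hp hq, one_mul]

lemma cellCut_fill_middle (h₁ : 3 * D + 1 ≤ n) (h₂ : n ≤ 3 * D + 3) (hD : 1 ≤ D) {p q r : ℕ}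
    (h : p + q + r = n - 1) :
    wcellCut n F p q r - cellCut (fillCorners n D l₁ l₂ l₃ F) p q r
      = cornerTerm n D l₁ F p q r + cornerTerm n D l₂ (rot F) q r p
        + cornerTerm n D l₃ (rot (rot F)) r p q := by
  have e2 : wcellCut n (rot F) q r p = wcellCut n F p q r := wcellCut_rot
  have e3 : wcellCut n (rot (rot F)) r p q = wcellCut n F p q r := by
    rw [wcellCut_rot, wcellCut_rot]
  simp only [cornerTerm, e2, e3]
  by_cases c1 : n - D ≤ p
  · rw [if_pos c1, if_neg (by omega), if_neg (by omega), if_neg (by omega), if_neg (by omega),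
      if_neg (by omega)]
    have : cellCut (fillCorners n D l₁ l₂ l₃ F) p q r = 0 := by
      simp [cellCut, cutAB, cutBC, cutCA, fillCorners, c1, show n - D ≤ p + 1 by omega]
    rw [this]; ring
  by_cases c2 : n - D ≤ q
  · rw [if_neg c1, if_pos c2, if_neg (by omega), if_neg (by omega), if_neg (by omega),
      if_neg (by omega)]
    have : cellCut (fillCorners n D l₁ l₂ l₃ F) p q r = 0 := by
      simp [cellCut, cutAB, cutBC, cutCA, fillCorners, c1, c2, show n - D ≤ q + 1 by omega,
        show ¬ n - D ≤ p + 1 by omega]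
    rw [this]; ring
  by_cases c3 : n - D ≤ r
  · rw [if_neg c1, if_neg c2, if_pos c3, if_neg (by omega), if_neg (by omega),
      if_neg (by omega)]
    have : cellCut (fillCorners n D l₁ l₂ l₃ F) p q r = 0 := by
      simp [cellCut, cutAB, cutBC, cutCA, fillCorners, c1, c2, c3, show n - D ≤ r + 1 by omega,
        show ¬ n - D ≤ p + 1 by omega, show ¬ n - D ≤ q + 1 by omega]
    rw [this]; ring
  rw [if_neg c1, if_neg c2, if_neg c3, wcellCut_middle h₁ h₂ (by omega) (by omega) (by omega)]
  by_cases d1 : p + D + 1 = n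
  · rw [if_pos d1, if_neg (by omega), if_neg (by omega)]
    simp only [cellCut, cutAB, cutBC, cutCA, fillCorners, c1, c2, c3, show n - D ≤ p + 1 by omega,
        show ¬ n - D ≤ q + 1 by omega, show ¬ n - D ≤ r + 1 by omega, if_true, if_false]
    rw [disc_comm (F p q (r + 1)) l₁]
    ring
  by_cases d2 : q + D + 1 = n
  · rw [if_pos d2, if_neg (by omega), if_neg (by omega)]
    simp only [cellCut, cutAB, cutBC, cutCA, fillCorners, rot, c1, c2, c3,
        show n - D ≤ q + 1 by omega,
        show ¬ n - D ≤ p + 1 by omega, show ¬ n - D ≤ r + 1 by omega, if_true, if_false]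
    rw [disc_comm (F (p + 1) q r) l₂]
    ring
  by_cases d3 : r + D + 1 = n
  · rw [if_pos d3, if_neg (by omega), if_neg (by omega)]
    simp only [cellCut, cutAB, cutBC, cutCA, fillCorners, rot, c1, c2, c3,
        show n - D ≤ r + 1 by omega,
        show ¬ n - D ≤ p + 1 by omega, show ¬ n - D ≤ q + 1 by omega, if_true, if_false]
    rw [disc_comm (F p (q + 1) r) l₃]
    ring
  rw [if_neg (by omega), if_neg (by omega), if_neg (by omega)]
  simp only [cellCut, cutAB, cutBC, cutCA, fillCorners, c1, c2, c3,
        show ¬ n - D ≤ r + 1 by omega,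
        show ¬ n - D ≤ p + 1 by omega, show ¬ n - D ≤ q + 1 by omega, if_false]
  ring

lemma wCut_eq_unitCut_fill_add (h₁ : 3 * D + 1 ≤ n) (h₂ : n ≤ 3 * D + 3) (hD : 1 ≤ D) :
    wCut n F = unitCut n (fillCorners n D l₁ l₂ l₃ F) + cornerGain n D l₁ F
      + cornerGain n D l₂ (rot F) + cornerGain n D l₃ (rot (rot F)) := by
  have a2 := sum_tri_rotate (n - 1) (cornerTerm n D l₂ (rot F))
  have a3 := sum_tri_rotate (n - 1) fun p q r => cornerTerm n D l₃ (rot (rot F)) q r p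
  have a4 := sum_tri_rotate (n - 1) (cornerTerm n D l₃ (rot (rot F)))
  rw [cornerGain, cornerGain, cornerGain, ← a2, ← a4, ← a3, unitCut_eq_sum (by omega), wCut,
    ← Finset.sum_add_distrib, ← Finset.sum_add_distrib, ← Finset.sum_add_distrib]
  refine Finset.sum_congr rfl fun x hx => ?_
  linarith [cellCut_fill_middle (F := F) (l₁ := l₁) (l₂ := l₂) (l₃ := l₃) h₁ h₂ hD (mem_tri.1 hx)]

lemma cornerGain_ge (h₁ : 3 * D + 1 ≤ n) (h₂ : n ≤ 3 * D + 3) {l : Fin 5} (hl : F n 0 0 = l)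
    (hlz : l ≠ z) {S : Finset ℕ}
    (hS : ∀ r ∈ S, 1 ≤ r ∧ r ≤ D ∧ (∃ a b, n - D ≤ a ∧ a + b + r = n ∧ F a b r = z) ∧
      F (n - D - 1) (D - r + 1) r ≠ z) :
    S.card ≤ cornerGain n D l F
      + ((D : ℝ) + 1 - n / 3) * (disc l (F (n - D) D 0) + disc l (F (n - D) 0 D)) := by
  have hn3 : (3 * D + 1 : ℝ) ≤ n := by exact_mod_cast h₁
  have key := corner_flow (fun q r => F (n - q - r) q r) D (δ := (D : ℝ) + 1 - n / 3)
    (by linarith) (l := l) (z := z) (by simpa using hl) hlz (S := S) (by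
      intro r hr
      obtain ⟨h1, h2, ⟨a, b, ha, hab, hF⟩, h4⟩ := hS r hr
      refine ⟨h1, h2, ⟨b, by omega, ?_⟩, ?_⟩
      · simp only [show n - b - r = a by omega, hF]
      · simpa only [show n - (D - r + 1) - r = n - D - 1 by omega] using h4)
  have hc := sum_tri_corner (n := n) (D := D) (by omega) (wcellCut n F)
  have hL := sum_tri_layer (n := n) (D := D) (by omega) fun p q r =>
    cutAB F p q r + cutCA F p q r - disc l (F p (q + 1) r) - disc l (F p q (r + 1))
  have hsplit : cornerGain n D l F
      = ∑ x ∈ (tri (n - 1)).filter (fun x => n - D ≤ x.1), wcellCut n F x.1 x.2.1 x.2.2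
        + ∑ x ∈ (tri (n - 1)).filter (fun x => x.1 + D + 1 = n),
          (cutAB F x.1 x.2.1 x.2.2 + cutCA F x.1 x.2.1 x.2.2 - disc l (F x.1 (x.2.1 + 1) x.2.2)
            - disc l (F x.1 x.2.1 (x.2.2 + 1))) := by
    unfold cornerGain cornerTerm
    rw [Finset.sum_add_distrib, ← Finset.sum_filter, ← Finset.sum_filter]
  have hc' : ∑ r ∈ Finset.range D, ∑ q ∈ Finset.range (D - r), wcellCut n F (n - 1 - r - q) q r
      = ∑ r ∈ Finset.range D, ∑ q ∈ Finset.range (D - r),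
            ((if r = 0 then (D : ℝ) + 1 - ((D : ℝ) + 1 - n / 3) - q else 1)
                * disc (F (n - q - r) q r) (F (n - (q + 1) - r) (q + 1) r)
              + (if q = 0 then (D : ℝ) + 1 - ((D : ℝ) + 1 - n / 3) - r else 1)
                * disc (F (n - q - r) q r) (F (n - q - (r + 1)) q (r + 1))) := by
    refine Finset.sum_congr rfl fun r hr => Finset.sum_congr rfl fun q hq => ?_
    have := Finset.mem_range.1 hr
    have := Finset.mem_range.1 hq
    have w1 : wt n (n - 1 - r - q) q r
        = if r = 0 then (D : ℝ) + 1 - ((D : ℝ) + 1 - n / 3) - q else 1 := by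
      unfold wt
      rw [if_neg (by omega)]
      by_cases h0 : r = 0
      · rw [if_pos (by omega), if_pos h0]; ring
      · rw [if_neg (by omega), if_neg (by omega), if_neg h0]
    have w2 : wt n q r (n - 1 - r - q) = 0 := by
      unfold wt
      rw [if_pos (by omega)]
    have w3 : wt n r (n - 1 - r - q) q
        = if q = 0 then (D : ℝ) + 1 - ((D : ℝ) + 1 - n / 3) - r else 1 := by
      unfold wt
      rw [if_neg (by omega), if_neg (by omega)]
      by_cases h0 : q = 0
      · rw [if_pos (by omega), if_pos h0]; ring
      · rw [if_neg (by omega), if_neg h0]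
    rw [wcellCut, w1, w2, w3, cutAB, cutCA, zero_mul, add_zero,
      show n - 1 - r - q + 1 = n - q - r by omega, show n - 1 - r - q = n - (q + 1) - r by omega,
      disc_comm (F (n - (q + 1) - r) q (r + 1)), show n - q - (r + 1) = n - (q + 1) - r by omega]
  have hL' : ∑ r ∈ Finset.range (D + 1), (cutAB F (n - D - 1) (D - r) r
        + cutCA F (n - D - 1) (D - r) r - disc l (F (n - D - 1) (D - r + 1) r)
        - disc l (F (n - D - 1) (D - r) (r + 1)))
      = ∑ r ∈ Finset.range (D + 1),
          (disc (F (n - (D - r) - r) (D - r) r) (F (n - (D - r + 1) - r) (D - r + 1) r)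
            + disc (F (n - (D - r) - r) (D - r) r) (F (n - (D - r) - (r + 1)) (D - r) (r + 1)))
        - ∑ r ∈ Finset.range (D + 1), (disc l (F (n - (D - r + 1) - r) (D - r + 1) r)
            + disc l (F (n - (D - r) - (r + 1)) (D - r) (r + 1))) := by
    rw [← Finset.sum_sub_distrib]
    refine Finset.sum_congr rfl fun r hr => ?_
    have := Finset.mem_range.1 hr
    rw [cutAB, cutCA, show n - D - 1 + 1 = n - (D - r) - r by omega,
      show n - (D - r + 1) - r = n - D - 1 by omega, show n - (D - r) - (r + 1) = n - D - 1 by omega,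
      disc_comm (F (n - D - 1) (D - r) (r + 1)) (F (n - (D - r) - r) (D - r) r)]
    ring
  rw [hc, hL, hc', hL'] at hsplit
  simp only [Nat.sub_zero] at key
  linarith

/-- The same bound for the lines on which the second coordinate is constant. -/
lemma cornerGain_ge_flip (h₁ : 3 * D + 1 ≤ n) (h₂ : n ≤ 3 * D + 3) {l : Fin 5} (hl : F n 0 0 = l)
    (hlz : l ≠ z) {S : Finset ℕ}
    (hS : ∀ r ∈ S, 1 ≤ r ∧ r ≤ D ∧ (∃ a b, n - D ≤ a ∧ a + b + r = n ∧ F a r b = z) ∧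
      F (n - D - 1) r (D - r + 1) ≠ z) :
    S.card ≤ cornerGain n D l F
      + ((D : ℝ) + 1 - n / 3) * (disc l (F (n - D) D 0) + disc l (F (n - D) 0 D)) := by
  have := cornerGain_ge (F := flip F) h₁ h₂ hl hlz hS
  rw [cornerGain_flip (by omega)] at this
  simp only [flip] at this
  linarith

/-- The number of those nodes on the sides at the bottom of the corner triangles that do not have
the label of the corner. -/
def sideDefect (n D : ℕ) (l₁ l₂ l₃ : Fin 5) (F : ℕ → ℕ → ℕ → Fin 5) : ℝ :=
  disc l₁ (F (n - D) D 0) + disc l₁ (F (n - D) 0 D) + disc l₂ (F D (n - D) 0)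
    + disc l₂ (F 0 (n - D) D) + disc l₃ (F D 0 (n - D)) + disc l₃ (F 0 D (n - D))

lemma unitCut_fill_le (hF : IsLabelling n l₁ l₂ l₃ z F) (h₁ : 3 * D + 1 ≤ n)
    (h₂ : n ≤ 3 * D + 3) (hD : 1 ≤ D) {S₁ S₂ S₃ : Finset ℕ}
    (hS₁ : ∀ r ∈ S₁, 1 ≤ r ∧ r ≤ D ∧ (∃ a b, n - D ≤ a ∧ a + b + r = n ∧ F a b r = z) ∧
      F (n - D - 1) (D - r + 1) r ≠ z)
    (hS₂ : ∀ r ∈ S₂, 1 ≤ r ∧ r ≤ D ∧ (∃ a b, n - D ≤ a ∧ a + b + r = n ∧ F b a r = z) ∧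
      F (D - r + 1) (n - D - 1) r ≠ z)
    (hS₃ : ∀ r ∈ S₃, 1 ≤ r ∧ r ≤ D ∧ (∃ a b, n - D ≤ a ∧ a + b + r = n ∧ F r b a = z) ∧
      F r (D - r + 1) (n - D - 1) ≠ z) :
    unitCut n (fillCorners n D l₁ l₂ l₃ F) + S₁.card + S₂.card + S₃.card
      ≤ wCut n F + ((D : ℝ) + 1 - n / 3) * sideDefect n D l₁ l₂ l₃ F := by
  have g1 := cornerGain_ge h₁ h₂ hF.term₁ hF.ne₁ hS₁
  have g2 := cornerGain_ge_flip (F := rot F) h₁ h₂ hF.term₂ hF.ne₂ hS₂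
  have g3 := cornerGain_ge_flip (F := rot (rot F)) h₁ h₂ hF.term₃ hF.ne₃ hS₃
  rw [wCut_eq_unitCut_fill_add (l₁ := l₁) (l₂ := l₂) (l₃ := l₃) h₁ h₂ hD, sideDefect]
  simp only [rot] at g2 g3 ⊢
  linarith

end Corners

section FillCorners

variable {n D : ℕ} {l₁ l₂ l₃ z : Fin 5} {F : ℕ → ℕ → ℕ → Fin 5}

lemma IsLabelling.fillCorners (hF : IsLabelling n l₁ l₂ l₃ z F) (h₁ : 3 * D + 1 ≤ n) :
    IsLabelling n l₁ l₂ l₃ z (fillCorners n D l₁ l₂ l₃ F) where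
  ne₁₂ := hF.ne₁₂
  ne₁₃ := hF.ne₁₃
  ne₂₃ := hF.ne₂₃
  ne₁ := hF.ne₁
  ne₂ := hF.ne₂
  ne₃ := hF.ne₃
  mem a b c h := by
    have := hF.mem a b c h
    unfold MultiwayCut.fillCorners
    split_ifs <;> tauto
  supp₁ b c h := by
    have := hF.supp₁ b c h
    have h1 := hF.ne₁₂.symm
    have h2 := hF.ne₁₃.symm
    unfold MultiwayCut.fillCorners
    split_ifs <;> first | assumption | omega
  supp₂ a c h := by
    have := hF.supp₂ a c h
    have h1 := hF.ne₁₂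
    have h2 := hF.ne₂₃.symm
    unfold MultiwayCut.fillCorners
    split_ifs <;> first | assumption | omega
  supp₃ a b h := by
    have := hF.supp₃ a b h
    have h1 := hF.ne₁₃
    have h2 := hF.ne₂₃
    unfold MultiwayCut.fillCorners
    split_ifs <;> first | assumption | omega
  term₁ := by simp [MultiwayCut.fillCorners]
  term₂ := by simp [MultiwayCut.fillCorners, show n - D ≠ 0 by omega]
  term₃ := by simp [MultiwayCut.fillCorners, show n - D ≠ 0 by omega]

lemma fillCorners_of_lt {a b c : ℕ} (ha : a < n - D) (hb : b < n - D) (hc : c < n - D) :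
    fillCorners n D l₁ l₂ l₃ F a b c = F a b c := by
  simp [fillCorners, not_le.2 ha, not_le.2 hb, not_le.2 hc]

lemma fillCorners_first {a b c : ℕ} (ha : n - D ≤ a) : fillCorners n D l₁ l₂ l₃ F a b c = l₁ := by
  simp [fillCorners, ha]

lemma fillCorners_second {a b c : ℕ} (ha : a < n - D) (hb : n - D ≤ b) :
    fillCorners n D l₁ l₂ l₃ F a b c = l₂ := by
  simp [fillCorners, not_le.2 ha, hb]

lemma fillCorners_third {a b c : ℕ} (ha : a < n - D) (hb : b < n - D) (hc : n - D ≤ c) :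
    fillCorners n D l₁ l₂ l₃ F a b c = l₃ := by
  simp [fillCorners, not_le.2 ha, not_le.2 hb, hc]

lemma unitCut_eq_sum_rowCut (hn : 1 ≤ n) : unitCut n F = ∑ c ∈ Finset.range n, rowCut n F c
    + ∑ c ∈ Finset.range n, rowCut n (rot F) c + ∑ c ∈ Finset.range n, rowCut n (rot (rot F)) c := by
  have key : ∀ G : ℕ → ℕ → ℕ → Fin 5,
      ∑ c ∈ Finset.range n, rowCut n G c = ∑ x ∈ tri (n - 1), cutAB G x.1 x.2.1 x.2.2 := by
    intro G
    rw [sum_tri_rows hn]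
    refine Finset.sum_congr rfl fun c hc => Finset.sum_congr rfl fun j hj => ?_
    have := Finset.mem_range.1 hc
    have := Finset.mem_range.1 hj
    simp only [cutAB, rowLabel]
    rw [show n - 1 - c - j + 1 = n - c - j by omega, show n - c - (j + 1) = n - 1 - c - j by omega]
  have a2 := sum_tri_rotate (n - 1) (cutAB (rot F))
  have a3 := sum_tri_rotate (n - 1) fun p q r => cutAB (rot (rot F)) q r p
  have a4 := sum_tri_rotate (n - 1) (cutAB (rot (rot F)))
  rw [key, key, key, ← a2, ← a4, ← a3, unitCut_eq_sum hn, ← Finset.sum_add_distrib,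
    ← Finset.sum_add_distrib]
  rfl

/-- If in each direction the rows close to the side carry the label `z`, then three
disjoint corners have to be cut off. -/
lemma unitCut_ge_of_rows (h₁ : 3 * D + 1 ≤ n)
    (hc : ∀ a b c, a + b + c = n → (n - D ≤ a ∨ n - D ≤ b ∨ n - D ≤ c) → F a b c ≠ z)
    (hz₁ : ∀ c ≤ D, ∃ j ≤ n - c, rowLabel n F c j = z)
    (hz₂ : ∀ c ≤ D, ∃ j ≤ n - c, rowLabel n (rot F) c j = z)
    (hz₃ : ∀ c ≤ D, ∃ j ≤ n - c, rowLabel n (rot (rot F)) c j = z) :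
    6 * ((D : ℝ) + 1) ≤ unitCut n F := by
  have key : ∀ G : ℕ → ℕ → ℕ → Fin 5,
      (∀ a b c, a + b + c = n → (n - D ≤ a ∨ n - D ≤ b ∨ n - D ≤ c) → G a b c ≠ z) →
      (∀ c ≤ D, ∃ j ≤ n - c, rowLabel n G c j = z) →
      2 * ((D : ℝ) + 1) ≤ ∑ c ∈ Finset.range n, rowCut n G c := by
    intro G hG hz
    calc 2 * ((D : ℝ) + 1) = ∑ c ∈ Finset.range (D + 1), 2 := by simp; ring
      _ ≤ ∑ c ∈ Finset.range (D + 1), rowCut n G c := by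
        refine Finset.sum_le_sum fun c hc => ?_
        have := Finset.mem_range.1 hc
        exact two_le_rowCut (hG _ _ _ (by omega) (by omega)) (hG _ _ _ (by omega) (by omega))
          (hz c (by omega))
      _ ≤ _ := Finset.sum_le_sum_of_subset_of_nonneg
        (Finset.range_subset_range.2 (by omega)) fun _ _ _ => rowCut_nonneg _
  have k1 := key F hc hz₁
  have k2 := key (rot F) (fun a b c h h' => hc _ _ _ (by omega) (by omega)) hz₂
  have k3 := key (rot (rot F)) (fun a b c h h' => hc _ _ _ (by omega) (by omega)) hz₃
  rw [unitCut_eq_sum_rowCut (by omega)]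
  linarith

lemma sideDefect_le : sideDefect n D l₁ l₂ l₃ F ≤ 6 := by
  unfold sideDefect
  linarith [disc_le_one l₁ (F (n - D) D 0), disc_le_one l₁ (F (n - D) 0 D),
    disc_le_one l₂ (F D (n - D) 0), disc_le_one l₂ (F 0 (n - D) D),
    disc_le_one l₃ (F D 0 (n - D)), disc_le_one l₃ (F 0 D (n - D))]

lemma sideDefect_nonneg : 0 ≤ sideDefect n D l₁ l₂ l₃ F := by
  unfold sideDefect
  linarith [disc_nonneg l₁ (F (n - D) D 0), disc_nonneg l₁ (F (n - D) 0 D),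
    disc_nonneg l₂ (F D (n - D) 0), disc_nonneg l₂ (F 0 (n - D) D),
    disc_nonneg l₃ (F D 0 (n - D)), disc_nonneg l₃ (F 0 D (n - D))]

lemma wCut_ge (hF : IsLabelling n l₁ l₂ l₃ z F) (h₁ : 3 * D + 1 ≤ n) (h₂ : n ≤ 3 * D + 3)
    (hD : 1 ≤ D) : 2 * (n : ℝ) - 3 ≤ wCut n F := by
  have hG := hF.fillCorners h₁
  have hle := unitCut_fill_le hF h₁ h₂ hD (S₁ := ∅) (S₂ := ∅) (S₃ := ∅) (by simp) (by simp)
    (by simp)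
  set G := fillCorners n D l₁ l₂ l₃ F with hGdef
  simp only [Finset.card_empty, Nat.cast_zero, add_zero] at hle
  have c1 : (3 * D + 1 : ℝ) ≤ n := by exact_mod_cast h₁
  have c2 : (n : ℝ) ≤ 3 * D + 3 := by exact_mod_cast h₂
  have hdef : ((D : ℝ) + 1 - n / 3) * sideDefect n D l₁ l₂ l₃ F ≤ ((D : ℝ) + 1 - n / 3) * 6 :=
    mul_le_mul_of_nonneg_left sideDefect_le (by linarith)
  have small : 2 * (n : ℝ) + 1 ≤ unitCut n G → 2 * (n : ℝ) - 3 ≤ wCut n F := by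
    intro h; linarith
  by_cases z1 : ∀ c ≤ D, ∃ j ≤ n - c, rowLabel n G c j = z
  swap
  · push Not at z1
    obtain ⟨b, hb, hbz⟩ := z1
    exact small (unitCut_ge_of_row hG (by omega) hbz fun c hc => fillCorners_first (by omega))
  by_cases z2 : ∀ c ≤ D, ∃ j ≤ n - c, rowLabel n (rot G) c j = z
  swap
  · push Not at z2
    obtain ⟨b, hb, hbz⟩ := z2
    refine small ?_
    rw [← unitCut_rot (by omega)]
    exact unitCut_ge_of_row hG.rot (by omega) hbz fun c hc =>
      fillCorners_second (by omega) (by omega)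
  by_cases z3 : ∀ c ≤ D, ∃ j ≤ n - c, rowLabel n (rot (rot G)) c j = z
  swap
  · push Not at z3
    obtain ⟨b, hb, hbz⟩ := z3
    refine small ?_
    rw [← unitCut_rot (by omega), ← unitCut_rot (by omega)]
    exact unitCut_ge_of_row hG.rot.rot (by omega) hbz fun c hc =>
      fillCorners_third (by omega) (by omega) (by omega)
  have := unitCut_ge_of_rows h₁ (fun a b c hs h => by
    by_cases ha : n - D ≤ a
    · rw [hGdef, fillCorners_first ha]; exact hF.ne₁
    by_cases hb : n - D ≤ b
    · rw [hGdef, fillCorners_second (by omega) hb]; exact hF.ne₂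
    · rw [hGdef, fillCorners_third (by omega) (by omega) (by omega)]; exact hF.ne₃) z1 z2 z3
  linarith

end FillCorners

section FreeSide

variable {n D : ℕ} {l₁ l₂ l₃ z : Fin 5} {F : ℕ → ℕ → ℕ → Fin 5}

/-- The cells all of whose nodes have label `z`. -/
def monoCells (n : ℕ) (z : Fin 5) (F : ℕ → ℕ → ℕ → Fin 5) : Finset (ℕ × ℕ × ℕ) :=
  (tri (n - 1)).filter fun x => F (x.1 + 1) x.2.1 x.2.2 = z ∧ F x.1 (x.2.1 + 1) x.2.2 = z ∧
    F x.1 x.2.1 (x.2.2 + 1) = z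

lemma mem_monoCells {x : ℕ × ℕ × ℕ} : x ∈ monoCells n z F ↔ x.1 + x.2.1 + x.2.2 = n - 1 ∧
    F (x.1 + 1) x.2.1 x.2.2 = z ∧ F x.1 (x.2.1 + 1) x.2.2 = z ∧ F x.1 x.2.1 (x.2.2 + 1) = z := by
  simp [monoCells]

lemma two_mul_card_tri (N : ℕ) : 2 * (tri N).card = (N + 1) * (N + 2) := by
  have h := sum_tri_rows (n := N + 1) (by omega) fun _ _ _ => 1
  simp only [Finset.sum_const, Finset.card_range, nsmul_eq_mul, mul_one, Nat.add_sub_cancel] at h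
  have h2 : ∑ c ∈ Finset.range (N + 1), (N + 1 - c) = ∑ c ∈ Finset.range (N + 1), (c + 1) := by
    rw [← Finset.sum_range_reflect]
    refine Finset.sum_congr rfl fun c hc => ?_
    have := Finset.mem_range.1 hc
    omega
  have h3 : (tri N).card = ∑ c ∈ Finset.range (N + 1), (c + 1) := by
    rw [← h2]; exact_mod_cast h
  have h4 := Finset.sum_range_id_mul_two (N + 2)
  rw [Finset.sum_range_succ'] at h4
  rw [h3]
  rw [add_zero, show N + 2 - 1 = N + 1 by omega] at h4
  linarith

lemma card_monoCells_le (hn : 1 ≤ n) : 2 * (monoCells n z F).card ≤ n * (n + 1) := by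
  have h1 : (monoCells n z F).card ≤ (tri (n - 1)).card :=
    Finset.card_le_card (Finset.filter_subset _ _)
  have h2 := two_mul_card_tri (n - 1)
  rw [show n - 1 + 1 = n by omega, show n - 1 + 2 = n + 1 by omega] at h2
  rw [← h2]
  exact Nat.mul_le_mul_left 2 h1

/-- In a row, twice the number of cells with label `z` is at most the number of edges leaving
nodes with label `z` upwards. -/
lemma two_mul_card_row_le {G : ℕ → ℕ → ℕ → Fin 5} {c : ℕ} (hc : c < n)
    (hG : ∀ a b, a + b + c = n → G a b c = F a b c) :
    2 * (((monoCells n z F).filter fun x => x.2.2 = c).card : ℝ) ≤ upEdges n G {z} c := by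
  have h1 : ((monoCells n z F).filter fun x => x.2.2 = c).card
      ≤ ((Finset.range (n - c)).filter fun j => rowLabel n G c j = z ∧ rowLabel n G c (j + 1) = z).card := by
    refine Finset.card_le_card_of_injOn (fun x => x.2.1) (fun x hx => ?_) (fun x hx y hy hxy => ?_)
    · simp only [Finset.mem_coe, Finset.mem_filter, mem_monoCells] at hx
      obtain ⟨⟨hs, hA, hB, -⟩, rfl⟩ := hx
      change x.2.1 ∈ _
      refine Finset.mem_coe.2 (Finset.mem_filter.2 ⟨Finset.mem_range.2 (by omega), ?_, ?_⟩)
      · rw [rowLabel, hG _ _ (by omega), show n - x.2.2 - x.2.1 = x.1 + 1 by omega, hA]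
      · rw [rowLabel, hG _ _ (by omega), show n - x.2.2 - (x.2.1 + 1) = x.1 by omega, hB]
    · simp only [Finset.mem_coe, Finset.mem_filter, mem_monoCells] at hx hy
      simp only at hxy
      ext <;> omega
  have h2 : 2 * (((Finset.range (n - c)).filter fun j =>
      rowLabel n G c j = z ∧ rowLabel n G c (j + 1) = z).card : ℝ) ≤ upEdges n G {z} c := by
    rw [Finset.card_filter, upEdges, Nat.cast_sum, Finset.mul_sum]
    refine Finset.sum_le_sum fun j _ => ?_
    split_ifs with h
    · rw [h.1, h.2, ind_of_mem (by simp)]; norm_num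
    · have := ind_nonneg {z} (rowLabel n G c j)
      have := ind_nonneg {z} (rowLabel n G c (j + 1))
      push_cast; linarith
  have : (((monoCells n z F).filter fun x => x.2.2 = c).card : ℝ) ≤ _ := Nat.cast_le.2 h1
  linarith

end FreeSide

section FreeSideBound

variable {n D : ℕ} {l₁ l₂ l₃ z : Fin 5} {F : ℕ → ℕ → ℕ → Fin 5}

lemma card_monoCells_low_le (hn : 1 ≤ n) {S : Finset ℕ}
    (hS : ∀ x ∈ monoCells n z F, x.2.2 ≤ D → x.2.2 ∈ S) :
    ((monoCells n z F).filter fun x => x.2.2 ≤ D).card ≤ n * S.card := by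
  refine (Finset.card_le_mul_card_image (f := fun x : ℕ × ℕ × ℕ => x.2.2) _ n fun c _ => ?_).trans
    (Nat.mul_le_mul_left n (Finset.card_le_card ?_))
  · refine (Finset.card_le_card_of_injOn (t := Finset.range n) (fun x => x.2.1)
      (fun x hx => ?_) fun x hx y hy hxy => ?_).trans (Finset.card_range n).le
    · simp only [Finset.mem_coe, Finset.mem_filter, mem_monoCells] at hx
      simp only [Finset.mem_coe, Finset.mem_range]
      omega
    · simp only [Finset.mem_coe, Finset.mem_filter, mem_monoCells] at hx hy
      simp only at hxy
      ext <;> omega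
  · intro c hc
    simp only [Finset.mem_image, Finset.mem_filter] at hc
    obtain ⟨x, ⟨hx, hxD⟩, rfl⟩ := hc
    exact hS x hx hxD

lemma card_monoCells_high_le {S : Finset ℕ} (hD : D < n)
    (hS : ∀ x ∈ monoCells n z F, n - D ≤ x.2.2 → x.1 ∈ S) :
    ((monoCells n z F).filter fun x => n - D ≤ x.2.2).card ≤ D * S.card := by
  refine (Finset.card_le_mul_card_image (f := fun x : ℕ × ℕ × ℕ => x.1) _ D fun c _ => ?_).trans
    (Nat.mul_le_mul_left D (Finset.card_le_card ?_))
  · refine (Finset.card_le_card_of_injOn (t := Finset.range D) (fun x => x.2.1)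
      (fun x hx => ?_) fun x hx y hy hxy => ?_).trans (Finset.card_range D).le
    · simp only [Finset.mem_coe, Finset.mem_filter, mem_monoCells] at hx
      simp only [Finset.mem_coe, Finset.mem_range]
      omega
    · simp only [Finset.mem_coe, Finset.mem_filter, mem_monoCells] at hx hy
      simp only at hxy
      ext <;> omega
  · intro c hc
    simp only [Finset.mem_image, Finset.mem_filter] at hc
    obtain ⟨x, ⟨hx, hxD⟩, rfl⟩ := hc
    exact hS x hx hxD

lemma card_monoCells_split : (monoCells n z F).card
    = ((monoCells n z F).filter fun x => x.2.2 ≤ D).card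
      + ∑ c ∈ Finset.Ico (D + 1) (n - D), ((monoCells n z F).filter fun x => x.2.2 = c).card
      + ((monoCells n z F).filter fun x => D < x.2.2 ∧ n - D ≤ x.2.2).card := by
  rw [← Finset.card_filter_add_card_filter_not (s := monoCells n z F) (fun x => x.2.2 ≤ D), add_assoc]
  congr 1
  rw [← Finset.card_filter_add_card_filter_not (s := (monoCells n z F).filter fun x => ¬ x.2.2 ≤ D)
    (fun x => x.2.2 < n - D)]
  congr 1
  · rw [Finset.card_eq_sum_card_fiberwise (f := fun x : ℕ × ℕ × ℕ => x.2.2)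
      (t := Finset.Ico (D + 1) (n - D))]
    · refine Finset.sum_congr rfl fun c hc => ?_
      congr 1
      ext x
      simp only [Finset.mem_Ico, Finset.mem_filter] at *
      constructor
      · rintro ⟨⟨⟨h, _⟩, _⟩, h'⟩; exact ⟨h, h'⟩
      · rintro ⟨h, h'⟩; exact ⟨⟨⟨h, by omega⟩, by omega⟩, h'⟩
    · intro x hx
      simp only [Finset.mem_coe, Finset.mem_filter, Finset.mem_Ico] at *
      omega
  · congr 1
    ext x
    simp only [Finset.mem_filter, not_le, not_lt, and_assoc]

/-- A labelling that uses `z` on at most two sides. -/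
theorem wCut_ge_of_free_side (hF : IsLabelling n l₁ l₂ l₃ z F) (h₁ : 3 * D + 1 ≤ n)
    (h₂ : n ≤ 3 * D + 3) (hD : 1 ≤ D) (h0 : ∀ j ≤ n, rowLabel n F 0 j ≠ z) :
    2 * (n : ℝ) + 7 / 9 + 2 / 3 * (monoCells n z F).card / n
      ≤ wCut n F + ((D : ℝ) + 1 - n / 3) * sideDefect n D l₁ l₂ l₃ F := by
  classical
  have hG := hF.fillCorners h₁
  set G := fillCorners n D l₁ l₂ l₃ F with hGdef
  have c1 : (3 * D + 1 : ℝ) ≤ n := by exact_mod_cast h₁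
  have c2 : (n : ℝ) ≤ 3 * D + 3 := by exact_mod_cast h₂
  have cD : (1 : ℝ) ≤ D := by exact_mod_cast hD
  have hG0 : ∀ j ≤ n, rowLabel n G 0 j ≠ z := by
    intro j hj
    rw [rowLabel, hGdef]
    by_cases ha : n - D ≤ n - 0 - j
    · rw [fillCorners_first ha]; exact hF.ne₁
    by_cases hb : n - D ≤ j
    · rw [fillCorners_second (by omega) hb]; exact hF.ne₂
    · rw [fillCorners_of_lt (by omega) (by omega) (by omega)]; exact h0 j hj
  have hG1 : ∀ c ≤ D, G (n - c) 0 c = l₁ := fun c hc => fillCorners_first (by omega)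
  have hG2 : ∀ c ≤ D, G 0 (n - c) c = l₂ := fun c hc => fillCorners_second (by omega) (by omega)
  have hGmid : ∀ a b c, a < n - D → b < n - D → c < n - D → G a b c = F a b c :=
    fun a b c ha hb hc => fillCorners_of_lt ha hb hc
  by_cases hun : ∃ c ≤ n, ∀ j ≤ n - c, rowLabel n G c j = z
  · have hle := unitCut_fill_le hF h₁ h₂ hD (S₁ := ∅) (S₂ := ∅) (S₃ := ∅) (by simp) (by simp)
      (by simp)
    simp only [Finset.card_empty, Nat.cast_zero, add_zero] at hle
    obtain ⟨s, hs, hmax⟩ : ∃ s, (s ≤ n ∧ ∀ j ≤ n - s, rowLabel n G s j = z) ∧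
        ∀ c, s < c → c ≤ n → ∃ j ≤ n - c, rowLabel n G c j ≠ z := by
      let T := (Finset.range (n + 1)).filter fun c => ∀ j ≤ n - c, rowLabel n G c j = z
      have hT : T.Nonempty := by
        obtain ⟨c, hc, h⟩ := hun
        exact ⟨c, by simp only [T, Finset.mem_filter, Finset.mem_range]; exact ⟨by omega, h⟩⟩
      have hm := Finset.mem_filter.1 (T.max'_mem hT)
      refine ⟨T.max' hT, ?_, fun c hc hcn => ?_⟩
      · exact ⟨Nat.lt_succ_iff.1 (Finset.mem_range.1 hm.1), hm.2⟩
      · by_contra hcon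
        push Not at hcon
        have : c ∈ T := by
          simp only [T, Finset.mem_filter, Finset.mem_range]; exact ⟨by omega, hcon⟩
        have := T.le_max' c this
        omega
    have hsD : s < n - D := by
      by_contra hcon
      have h1 := hs.2 0 (Nat.zero_le _)
      rw [rowLabel, hGdef, fillCorners_third (by omega) (by omega) (by omega)] at h1
      exact hF.ne₃ h1
    have hup := unitCut_ge_add_upEdges hG hs.1 hG0 hmax
    have hval : upEdges n G {z} s = 2 * ((n : ℝ) - s) := by
      rw [upEdges, Finset.sum_congr rfl fun j hj => by
        have := Finset.mem_range.1 hj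
        rw [hs.2 j (by omega), hs.2 (j + 1) (by omega), ind_of_mem (by simp)]]
      rw [Finset.sum_const, Finset.card_range, nsmul_eq_mul, Nat.cast_sub hs.1]
      ring
    have c3 : (s : ℝ) + D + 1 ≤ n := by
      have : s + D + 1 ≤ n := by omega
      exact_mod_cast this
    have hβ : 2 * ((monoCells n z F).card : ℝ) ≤ n * (n + 1) := by
      exact_mod_cast card_monoCells_le (n := n) (z := z) (F := F) (by omega)
    have : 2 / 3 * ((monoCells n z F).card : ℝ) / n ≤ (n + 1) / 3 := by
      rw [div_le_iff₀ (by linarith)]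
      nlinarith
    linarith
  · push Not at hun
    let S₁ := (Finset.Icc 1 D).filter fun r =>
      (∃ a b, n - D ≤ a ∧ a + b + r = n ∧ F a b r = z) ∧ F (n - D - 1) (D - r + 1) r ≠ z
    let S₂ := (Finset.Icc 1 D).filter fun r =>
      (∃ a b, n - D ≤ a ∧ a + b + r = n ∧ F b a r = z) ∧ F (D - r + 1) (n - D - 1) r ≠ z
    let S₃ := (Finset.Icc 1 D).filter fun r =>
      (∃ a b, n - D ≤ a ∧ a + b + r = n ∧ F r b a = z) ∧ F r (D - r + 1) (n - D - 1) ≠ z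
    let K := (Finset.Icc 1 D).filter fun c => ∃ j ≤ n - c, rowLabel n G c j = z
    let T := (Finset.Icc 1 D).filter fun p => F p (D - p + 1) (n - D - 1) = z
    have hle := unitCut_fill_le hF h₁ h₂ hD (S₁ := S₁) (S₂ := S₂) (S₃ := S₃)
      (fun r hr => by
        simp only [S₁, Finset.mem_filter, Finset.mem_Icc] at hr; exact ⟨hr.1.1, hr.1.2, hr.2⟩)
      (fun r hr => by
        simp only [S₂, Finset.mem_filter, Finset.mem_Icc] at hr; exact ⟨hr.1.1, hr.1.2, hr.2⟩)
      (fun r hr => by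
        simp only [S₃, Finset.mem_filter, Finset.mem_Icc] at hr; exact ⟨hr.1.1, hr.1.2, hr.2⟩)
    have hK := unitCut_ge_add_card hG (D := D) (by omega) hun hG1 hG2 (S := K) (fun r hr => by
      simp only [K, Finset.mem_filter, Finset.mem_Icc] at hr; exact ⟨hr.1.1, hr.1.2, hr.2⟩)
    have hup : ∀ s ≤ n, 2 * (n : ℝ) + 1 + upEdges n G {z} s ≤ unitCut n G := fun s hs =>
      unitCut_ge_add_upEdges hG hs hG0 fun c _ hc => hun c hc
    have hlow : ((monoCells n z F).filter fun x => x.2.2 ≤ D).card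
        ≤ n * (S₁.card + S₂.card + K.card) := by
      refine (card_monoCells_low_le (by omega) (S := S₁ ∪ S₂ ∪ K) ?_).trans (Nat.mul_le_mul_left n
        ((Finset.card_union_le _ _).trans (Nat.add_le_add_right (Finset.card_union_le _ _) _)))
      intro x hx hxD
      obtain ⟨hs, hA, hB, hC⟩ := mem_monoCells.1 hx
      have hx0 : 1 ≤ x.2.2 := by
        by_contra hcon
        have e : x.2.2 = 0 := by omega
        refine h0 x.2.1 (by omega) ?_
        rw [rowLabel, show n - 0 - x.2.1 = x.1 + 1 by omega, ← e, hA]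
      have hmemK : ∀ a b, a + b + x.2.2 = n → a < n - D → b < n - D → F a b x.2.2 = z →
          x.2.2 ∈ K := by
        intro a b hab ha hb hz
        simp only [K, Finset.mem_filter, Finset.mem_Icc]
        refine ⟨⟨hx0, hxD⟩, b, by omega, ?_⟩
        rw [rowLabel, hGmid _ _ _ (by omega) hb (by omega), show n - x.2.2 - b = a by omega, hz]
      simp only [Finset.mem_union]
      by_cases ha : n - D ≤ x.1 + 1
      · by_cases hz : F (n - D - 1) (D - x.2.2 + 1) x.2.2 = z
        · exact Or.inr (hmemK _ _ (by omega) (by omega) (by omega) hz)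
        · refine Or.inl (Or.inl ?_)
          simp only [S₁, Finset.mem_filter, Finset.mem_Icc]
          exact ⟨⟨hx0, hxD⟩, ⟨_, _, ha, by omega, hA⟩, hz⟩
      by_cases hb : n - D ≤ x.2.1
      · by_cases hz : F (D - x.2.2 + 1) (n - D - 1) x.2.2 = z
        · exact Or.inr (hmemK _ _ (by omega) (by omega) (by omega) hz)
        · refine Or.inl (Or.inr ?_)
          simp only [S₂, Finset.mem_filter, Finset.mem_Icc]
          exact ⟨⟨hx0, hxD⟩, ⟨_, _, hb, by omega, hA⟩, hz⟩
      · exact Or.inr (hmemK _ _ (by omega) (by omega) (by omega) hA)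
    have hhigh : ((monoCells n z F).filter fun x => D < x.2.2 ∧ n - D ≤ x.2.2).card
        ≤ D * (1 + S₃.card + T.card) := by
      have : ((monoCells n z F).filter fun x => D < x.2.2 ∧ n - D ≤ x.2.2)
          ⊆ (monoCells n z F).filter fun x => n - D ≤ x.2.2 :=
        Finset.monotone_filter_right _ fun x _ h => h.2
      refine (Finset.card_le_card this).trans ((card_monoCells_high_le (S := {0} ∪ S₃ ∪ T) (by omega)
        ?_).trans (Nat.mul_le_mul_left D ((Finset.card_union_le _ _).trans
          (Nat.add_le_add_right ((Finset.card_union_le _ _).trans (by simp)) _))))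
      intro x hx hxD
      obtain ⟨hs, hA, hB, hC⟩ := mem_monoCells.1 hx
      simp only [Finset.mem_union, Finset.mem_singleton]
      by_cases hx0 : x.1 = 0
      · exact Or.inl (Or.inl hx0)
      by_cases hz : F x.1 (D - x.1 + 1) (n - D - 1) = z
      · refine Or.inr ?_
        simp only [T, Finset.mem_filter, Finset.mem_Icc]
        exact ⟨by omega, hz⟩
      · refine Or.inl (Or.inr ?_)
        simp only [S₃, Finset.mem_filter, Finset.mem_Icc]
        exact ⟨by omega, ⟨x.2.2 + 1, x.2.1, by omega, by omega, hC⟩, hz⟩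
    have hT : (T.card : ℝ) ≤ upEdges n G {z} (n - D - 1) := by
      have hTc : T.card ≤ ((Finset.range (n - (n - D - 1))).filter fun j =>
          rowLabel n G (n - D - 1) (j + 1) = z).card := by
        refine Finset.card_le_card_of_injOn (fun p => D - p) (fun p hp => ?_) fun p hp p' hp' h => ?_
        · simp only [T, Finset.mem_coe, Finset.mem_filter, Finset.mem_Icc] at hp
          simp only [Finset.mem_coe, Finset.mem_filter, Finset.mem_range]
          refine ⟨by omega, ?_⟩
          rw [rowLabel, hGmid _ _ _ (by omega) (by omega) (by omega),
            show n - (n - D - 1) - (D - p + 1) = p by omega, hp.2]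
        · simp only [T, Finset.mem_coe, Finset.mem_filter, Finset.mem_Icc] at hp hp'
          simp only at h
          omega
      refine (Nat.cast_le.2 hTc).trans ?_
      rw [Finset.card_filter, upEdges, Nat.cast_sum]
      refine Finset.sum_le_sum fun j _ => ?_
      have := ind_nonneg {z} (rowLabel n G (n - D - 1) j)
      split_ifs with h
      · rw [h, ind_of_mem (x := z) (by simp)]; push_cast; linarith
      · have := ind_nonneg {z} (rowLabel n G (n - D - 1) (j + 1))
        push_cast; linarith
    have hmid : (∑ c ∈ Finset.Ico (D + 1) (n - D),
        (((monoCells n z F).filter fun x => x.2.2 = c).card : ℝ))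
        ≤ ((n : ℝ) - 2 * D - 1) * ((unitCut n G - 2 * n - 1) / 2) := by
      calc _ ≤ ∑ c ∈ Finset.Ico (D + 1) (n - D), ((unitCut n G - 2 * n - 1) / 2) := by
            refine Finset.sum_le_sum fun c hc => ?_
            have := Finset.mem_Ico.1 hc
            have h3 := two_mul_card_row_le (n := n) (z := z) (F := F) (G := G) (c := c) (by omega) ?_
            · linarith [hup c (by omega)]
            · intro a b hab
              exact hGmid _ _ _ (by omega) (by omega) (by omega)
        _ = _ := by
            rw [Finset.sum_const, Nat.card_Ico, nsmul_eq_mul]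
            congr 1
            rw [Nat.cast_sub (by omega), Nat.cast_sub (by omega)]
            push_cast; ring
    have hsplit : ((monoCells n z F).card : ℝ) = _ := congrArg Nat.cast (card_monoCells_split (D := D))
    push_cast at hsplit
    have hlow' : (((monoCells n z F).filter fun x => x.2.2 ≤ D).card : ℝ)
        ≤ n * (S₁.card + S₂.card + K.card) := by exact_mod_cast hlow
    have hhigh' : (((monoCells n z F).filter fun x => D < x.2.2 ∧ n - D ≤ x.2.2).card : ℝ)
        ≤ D * (1 + S₃.card + T.card) := by exact_mod_cast hhigh
    have hTup := hup (n - D - 1) (by omega)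
    set Y := unitCut n G - 2 * n - 1 with hY
    have hKY : (K.card : ℝ) ≤ Y := by linarith
    have hTY : (T.card : ℝ) ≤ Y := by linarith
    have hY0 : 0 ≤ Y := (Nat.cast_nonneg _).trans hKY
    have p1 : (n : ℝ) * K.card ≤ n * Y := mul_le_mul_of_nonneg_left hKY (by linarith)
    have p2 : (D : ℝ) * T.card ≤ D * Y := mul_le_mul_of_nonneg_left hTY (by linarith)
    have p3 : (D : ℝ) * S₃.card ≤ n * S₃.card :=
      mul_le_mul_of_nonneg_right (by linarith) (Nat.cast_nonneg _)
    have p4 : 0 ≤ (n : ℝ) * S₁.card := by positivity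
    have p5 : 0 ≤ (n : ℝ) * S₂.card := by positivity
    have p6 : 0 ≤ (n : ℝ) * S₃.card := by positivity
    have main : 2 / 3 * ((monoCells n z F).card : ℝ) / n
        ≤ Y + S₁.card + S₂.card + S₃.card + 2 / 9 := by
      rw [div_le_iff₀ (by linarith)]
      nlinarith
    linarith


end FreeSideBound

section Enclosed

variable {n m D : ℕ} {l l₁ l₂ l₃ z : Fin 5} {F G : ℕ → ℕ → ℕ → Fin 5}

/-- All nodes on the boundary of the triangle of side length `m` at the first corner have
label `l`. -/
def MonoBoundary (n m : ℕ) (l : Fin 5) (F : ℕ → ℕ → ℕ → Fin 5) : Prop :=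
  ∀ a b c, a + b + c = n → n - m ≤ a → (b = 0 ∨ c = 0 ∨ a = n - m) → F a b c = l

/-- The number of cells with label `z` in the triangle of side length `m` at the first corner. -/
def cornerCount (n m : ℕ) (z : Fin 5) (F : ℕ → ℕ → ℕ → Fin 5) : ℕ :=
  ((monoCells n z F).filter fun x => n - m ≤ x.1).card

open Classical in
/-- The number of cells with label `z` in the triangle of side length `m` at the first corner if
its boundary has label `l`, and `0` otherwise. -/
noncomputable def enclosedCount (n m : ℕ) (l z : Fin 5) (F : ℕ → ℕ → ℕ → Fin 5) : ℕ :=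
  if MonoBoundary n m l F then cornerCount n m z F else 0

lemma MonoBoundary.congr (h : ∀ a b c, a + b + c = n → n - m ≤ a → F a b c = G a b c)
    (hF : MonoBoundary n m l F) : MonoBoundary n m l G :=
  fun a b c hs ha hb => (h a b c hs ha).symm.trans (hF a b c hs ha hb)

lemma cornerCount_congr (hn : 1 ≤ n)
    (h : ∀ a b c, a + b + c = n → n - m ≤ a → F a b c = G a b c) :
    cornerCount n m z F = cornerCount n m z G := by
  unfold cornerCount
  congr 1
  ext x
  simp only [Finset.mem_filter, mem_monoCells]
  constructor
  · rintro ⟨⟨hs, h1, h2, h3⟩, hx⟩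
    refine ⟨⟨hs, ?_, ?_, ?_⟩, hx⟩
    · rw [← h _ _ _ (by omega) (by omega), h1]
    · rw [← h _ _ _ (by omega) (by omega), h2]
    · rw [← h _ _ _ (by omega) (by omega), h3]
  · rintro ⟨⟨hs, h1, h2, h3⟩, hx⟩
    refine ⟨⟨hs, ?_, ?_, ?_⟩, hx⟩
    · rw [h _ _ _ (by omega) (by omega), h1]
    · rw [h _ _ _ (by omega) (by omega), h2]
    · rw [h _ _ _ (by omega) (by omega), h3]

lemma enclosedCount_congr (hn : 1 ≤ n)
    (h : ∀ a b c, a + b + c = n → n - m ≤ a → F a b c = G a b c) :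
    enclosedCount n m l z F = enclosedCount n m l z G := by
  unfold enclosedCount
  by_cases hF : MonoBoundary n m l F
  · rw [if_pos hF, if_pos (hF.congr h), cornerCount_congr hn h]
  · rw [if_neg hF, if_neg fun hG => hF (hG.congr fun a b c hs ha => (h a b c hs ha).symm)]

lemma cornerCount_eq_sum (hm : m < n) : (cornerCount n m z F : ℝ)
    = ∑ r ∈ Finset.range m, ∑ q ∈ Finset.range (m - r),
      if F (n - r - q) q r = z ∧ F (n - 1 - r - q) (q + 1) r = z ∧ F (n - 1 - r - q) q (r + 1) = z
      then (1 : ℝ) else 0 := by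
  have h := sum_tri_corner hm fun p q r =>
    if F (p + 1) q r = z ∧ F p (q + 1) r = z ∧ F p q (r + 1) = z then (1 : ℝ) else 0
  rw [cornerCount, monoCells, Finset.filter_filter]
  have : ∀ r ∈ Finset.range m, ∀ q ∈ Finset.range (m - r), n - r - q = n - 1 - r - q + 1 := by
    intro r hr q hq
    have := Finset.mem_range.1 hr
    have := Finset.mem_range.1 hq
    omega
  rw [Finset.sum_congr rfl fun r hr => Finset.sum_congr rfl fun q hq => by rw [this r hr q hq], ← h,
    Finset.card_filter, Finset.sum_filter, Nat.cast_sum]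
  refine Finset.sum_congr rfl fun x _ => ?_
  split_ifs <;> simp_all

lemma cornerCount_le (hm : m < n) (h2m : 2 * m < n) (hlz : l ≠ z) (hB : MonoBoundary n m l F) :
    2 / 3 * (cornerCount n m z F : ℝ) / n
      ≤ ∑ x ∈ (tri (n - 1)).filter (fun x => n - m ≤ x.1), wcellCut n F x.1 x.2.1 x.2.2 := by
  have hn : (0 : ℝ) < n := by exact_mod_cast (by omega : 0 < n)
  have hmn : (m : ℝ) ≤ n := by exact_mod_cast hm.le
  rw [sum_tri_corner hm (wcellCut n F), cornerCount_eq_sum hm, mul_div_assoc, Finset.sum_div,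
    Finset.mul_sum]
  refine Finset.sum_le_sum fun r hr => ?_
  have hr := Finset.mem_range.1 hr
  have hnn : ∀ q ∈ Finset.range (m - r), 0 ≤ wcellCut n F (n - 1 - r - q) q r := fun q hq => by
    have := Finset.mem_range.1 hq
    exact wcellCut_nonneg (by omega) (by omega)
  by_cases hz : ∃ q < m - r, F (n - r - q) q r = z
  · obtain ⟨q, hq, hqz⟩ := hz
    have hr0 : r ≠ 0 := by
      rintro rfl
      exact hlz ((hB _ _ _ (by omega) (by omega) (Or.inr (Or.inl rfl))).symm.trans hqz)
    have h1 := disc_add_disc_le_sum_range (fun q => F (n - r - q) q r) (show q ≤ m - r by omega)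
    simp only [hqz] at h1
    rw [hB (n - r - 0) 0 r (by omega) (by omega) (Or.inl rfl), disc_of_ne hlz] at h1
    have h2 : ∑ q ∈ Finset.range (m - r), disc (F (n - r - q) q r) (F (n - r - (q + 1)) (q + 1) r)
        ≤ ∑ q ∈ Finset.range (m - r), wcellCut n F (n - 1 - r - q) q r := by
      refine Finset.sum_le_sum fun q hq => ?_
      have := Finset.mem_range.1 hq
      have w : wt n (n - 1 - r - q) q r = 1 := by
        unfold wt
        rw [if_neg (by omega), if_neg (by omega), if_neg (by omega)]
      have w2 := mul_nonneg (wt_nonneg (p := q) (q := r) (r := n - 1 - r - q) (n := n) (by omega)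
        (by omega)) (cutBC_nonneg (F := F) (p := n - 1 - r - q) (q := q) (r := r))
      have w3 := mul_nonneg (wt_nonneg (p := r) (q := n - 1 - r - q) (r := q) (n := n) (by omega)
        (by omega)) (cutCA_nonneg (F := F) (p := n - 1 - r - q) (q := q) (r := r))
      rw [wcellCut, w, cutAB, one_mul, show n - 1 - r - q + 1 = n - r - q by omega,
        show n - r - (q + 1) = n - 1 - r - q by omega]
      linarith
    have h3 : ∑ q ∈ Finset.range (m - r),
        (if F (n - r - q) q r = z ∧ F (n - 1 - r - q) (q + 1) r = z ∧
          F (n - 1 - r - q) q (r + 1) = z then (1 : ℝ) else 0) ≤ n := by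
      calc _ ≤ ∑ q ∈ Finset.range (m - r), (1 : ℝ) :=
            Finset.sum_le_sum fun q _ => by split_ifs <;> norm_num
        _ = ((m - r : ℕ) : ℝ) := by simp
        _ ≤ n := by exact_mod_cast (by omega : m - r ≤ n)
    have h4 := div_le_one_of_le₀ h3 hn.le
    have h5 := disc_nonneg z (F (n - r - (m - r)) (m - r) r)
    linarith
  · push Not at hz
    rw [Finset.sum_eq_zero fun q hq => if_neg fun h => hz q (Finset.mem_range.1 hq) h.1]
    simpa using Finset.sum_nonneg hnn

/-- Filling an enclosed corner triangle saves the cut edges inside. -/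
lemma exists_filled (hF : IsLabelling n l₁ l₂ l₃ z F) (h2m : 2 * m < n) :
    ∃ G, IsLabelling n l₁ l₂ l₃ z G ∧ (∀ a b c, a < n - m → G a b c = F a b c) ∧
      wCut n G + 2 / 3 * (enclosedCount n m l₁ z F : ℝ) / n ≤ wCut n F := by
  by_cases hB : MonoBoundary n m l₁ F
  swap
  · exact ⟨F, hF, fun _ _ _ _ => rfl, by rw [enclosedCount, if_neg hB]; simp⟩
  refine ⟨fun a b c => if n - m ≤ a then l₁ else F a b c, ?_, fun a b c ha => by
    simp [not_le.2 ha], ?_⟩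
  · refine ⟨hF.ne₁₂, hF.ne₁₃, hF.ne₂₃, hF.ne₁, hF.ne₂, hF.ne₃, ?_, ?_, ?_, ?_, ?_, ?_, ?_⟩
    · intro a b c h
      have := hF.mem a b c h
      split_ifs <;> tauto
    · intro b c h
      simp only [show ¬ n - m ≤ 0 by omega, if_false]
      exact hF.supp₁ b c h
    · intro a c h
      have := hF.ne₁₂
      have := hF.supp₂ a c h
      split_ifs <;> assumption
    · intro a b h
      have := hF.ne₁₃
      have := hF.supp₃ a b h
      split_ifs <;> assumption
    · simp
    · simp only [show ¬ n - m ≤ 0 by omega, if_false]; exact hF.term₂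
    · simp only [show ¬ n - m ≤ 0 by omega, if_false]; exact hF.term₃
  · rw [enclosedCount, if_pos hB]
    have h1 := cornerCount_le (by omega) h2m hF.ne₁ hB
    rw [Finset.sum_filter] at h1
    refine (add_le_add_right h1 _).trans ?_
    rw [wCut, wCut, ← Finset.sum_add_distrib]
    refine Finset.sum_le_sum fun x hx => ?_
    have hs := mem_tri.1 hx
    by_cases hp : n - m ≤ x.1
    · simp only [hp, if_true, wcellCut, cutAB, cutBC, cutCA, show n - m ≤ x.1 + 1 by omega,
        disc_self]
      linarith
    · have key : ∀ b c, x.1 + 1 + b + c = n →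
          (if n - m ≤ x.1 + 1 then l₁ else F (x.1 + 1) b c) = F (x.1 + 1) b c := by
        intro b c hbc
        split_ifs with h
        · exact (hB _ _ _ hbc h (Or.inr (Or.inr (by omega)))).symm
        · rfl
      simp only [hp, if_false, wcellCut, cutAB, cutBC, cutCA, key x.2.1 x.2.2 (by omega)]
      linarith

/-- The lower bound for an arbitrary labelling. -/
theorem wCut_ge_of_enclosed (hF : IsLabelling n l₁ l₂ l₃ z F) (h₁ : 3 * D + 1 ≤ n)
    (h₂ : n ≤ 3 * D + 3) (hD : 1 ≤ D) (h2m : 2 * m < n) :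
    2 * (n : ℝ) - 3 + 2 / 3 * (enclosedCount n m l₁ z F : ℝ) / n
      + 2 / 3 * (enclosedCount n m l₂ z (rot F) : ℝ) / n
      + 2 / 3 * (enclosedCount n m l₃ z (rot (rot F)) : ℝ) / n ≤ wCut n F := by
  obtain ⟨G₁, hG₁, e₁, w₁⟩ := exists_filled hF h2m
  obtain ⟨G₂, hG₂, e₂, w₂⟩ := exists_filled hG₁.rot h2m
  obtain ⟨G₃, hG₃, e₃, w₃⟩ := exists_filled hG₂.rot h2m
  have c₁ : enclosedCount n m l₂ z (rot G₁) = enclosedCount n m l₂ z (rot F) :=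
    enclosedCount_congr (by omega) fun a b c hs ha => e₁ _ _ _ (by omega)
  have c₂ : enclosedCount n m l₃ z (rot G₂) = enclosedCount n m l₃ z (rot (rot F)) :=
    enclosedCount_congr (by omega) fun a b c hs ha =>
      (e₂ _ _ _ (by omega)).trans (e₁ _ _ _ (by omega))
  rw [wCut_rot, c₁] at w₂
  rw [wCut_rot, c₂] at w₃
  have := wCut_ge hG₃ h₁ h₂ hD
  linarith


end Enclosed

section CellSums

variable {n : ℕ}

/-- The node obtained from a cell by increasing one coordinate. -/
def corner (hn : 1 ≤ n) (y : Node (n - 1)) (i : Fin 4) : Node n :=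
  ⟨fun k => y.1 k + if k = i then 1 else 0, by
    rw [Finset.sum_add_distrib, y.2]; simp; omega⟩

lemma corner_apply (hn : 1 ≤ n) (y : Node (n - 1)) (i k : Fin 4) :
    (corner hn y i).1 k = y.1 k + if k = i then 1 else 0 := rfl

lemma corner_adj (hn : 1 ≤ n) (y : Node (n - 1)) {i j : Fin 4} (h : i ≠ j) :
    (graph n).Adj (corner hn y i) (corner hn y j) := by
  have key : ∀ i j : Fin 4, i ≠ j →
      ∑ k, |(if k = i then (1 : ℤ) else 0) - if k = j then 1 else 0| = 2 := by decide
  change ∑ k, |((corner hn y i).1 k : ℤ) - ((corner hn y j).1 k : ℤ)| = 2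
  rw [← key i j h]
  refine Finset.sum_congr rfl fun k _ => ?_
  congr 1
  simp only [corner_apply]
  push_cast
  ring

lemma corner_inj (hn : 1 ≤ n) {y y' : Node (n - 1)} {i j a b : Fin 4} (hij : i ≠ j)
    (h₁ : corner hn y i = corner hn y' a) (h₂ : corner hn y j = corner hn y' b) :
    i = a ∧ j = b ∧ y = y' := by
  have e₁ : ∀ k, y.1 k + (if k = i then 1 else 0) = y'.1 k + if k = a then 1 else 0 := fun k =>
    congrFun (congrArg Subtype.val h₁) k
  have e₂ : ∀ k, y.1 k + (if k = j then 1 else 0) = y'.1 k + if k = b then 1 else 0 := fun k =>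
    congrFun (congrArg Subtype.val h₂) k
  have hi : i = a := by
    by_contra hne
    have h1 := e₁ i
    have h2 := e₂ i
    rw [if_pos rfl, if_neg hne] at h1
    rw [if_neg hij] at h2
    omega
  subst hi
  have hy : y = y' := Subtype.ext (funext fun k => by have := e₁ k; omega)
  subst hy
  refine ⟨rfl, ?_, rfl⟩
  have h2 := e₂ j
  rw [if_pos rfl] at h2
  by_contra hne
  rw [if_neg hne] at h2
  omega

/-- The ordered pairs of coordinates. -/
def pairs : Finset (Fin 4 × Fin 4) := Finset.univ.filter fun e => e.1 < e.2

/-- The cost of a cut on the six edges of a cell. -/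
noncomputable def cellCost (hn : 1 ≤ n) (w : Sym2 (Node n) → ℝ) (P : Node n → Fin 5)
    (y : Node (n - 1)) : ℝ :=
  ∑ e ∈ pairs, w s(corner hn y e.1, corner hn y e.2)
    * disc (P (corner hn y e.1)) (P (corner hn y e.2))

lemma sum_cellCost_le_cost (hn : 1 ≤ n) {w : Sym2 (Node n) → ℝ} (hw : ∀ e, 0 ≤ w e)
    (P : Node n → Fin 5) : ∑ y, cellCost hn w P y ≤ cost w P := by
  let f : Node (n - 1) × (Fin 4 × Fin 4) → Sym2 (Node n) := fun t =>
    s(corner hn t.1 t.2.1, corner hn t.1 t.2.2)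
  let S := (Finset.univ ×ˢ pairs).filter fun t : Node (n - 1) × (Fin 4 × Fin 4) =>
    P (corner hn t.1 t.2.1) ≠ P (corner hn t.1 t.2.2)
  have hS : ∑ y, cellCost hn w P y = ∑ t ∈ S, w (f t) := by
    rw [Finset.sum_filter, Finset.sum_product]
    refine Finset.sum_congr rfl fun y _ => Finset.sum_congr rfl fun e _ => ?_
    simp only [f, disc]
    split_ifs <;> simp_all
  have hinj : Set.InjOn f S := by
    intro t ht t' ht' h
    simp only [S, Finset.mem_coe, Finset.mem_filter, Finset.mem_product, pairs, Finset.mem_univ,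
      true_and] at ht ht'
    rcases Sym2.eq_iff.1 h with ⟨h1, h2⟩ | ⟨h1, h2⟩
    · obtain ⟨a, b, c⟩ := corner_inj hn ht.1.ne h1 h2
      exact Prod.ext c (Prod.ext a b)
    · obtain ⟨a, b, -⟩ := corner_inj hn ht.1.ne h1 h2
      exact absurd (a ▸ b ▸ ht.1) (not_lt.2 ht'.1.le)
  rw [hS, cost, ← Finset.sum_image hinj]
  refine Finset.sum_le_sum_of_subset_of_nonneg (fun e he => ?_) fun e _ _ => hw e
  obtain ⟨t, ht, rfl⟩ := Finset.mem_image.1 he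
  simp only [S, Finset.mem_filter, Finset.mem_product, pairs, Finset.mem_univ,
      true_and] at ht
  simp only [cutSet, Finset.mem_filter, SimpleGraph.mem_edgeFinset, f, SimpleGraph.mem_edgeSet]
  exact ⟨corner_adj hn _ ht.1.ne, _, Sym2.mem_mk_left _ _, _, Sym2.mem_mk_right _ _, ht.2⟩

lemma cellCost_nonneg (hn : 1 ≤ n) {w : Sym2 (Node n) → ℝ} (hw : ∀ e, 0 ≤ w e)
    (P : Node n → Fin 5) (y : Node (n - 1)) : 0 ≤ cellCost hn w P y :=
  Finset.sum_nonneg fun _ _ => mul_nonneg (hw _) (disc_nonneg _ _)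

lemma sum_pairs (f : Fin 4 × Fin 4 → ℝ) : ∑ e ∈ pairs, f e
    = f (0, 1) + f (0, 2) + f (0, 3) + f (1, 2) + f (1, 3) + f (2, 3) := by
  have : pairs = {(0, 1), (0, 2), (0, 3), (1, 2), (1, 3), (2, 3)} := by decide
  rw [this]
  simp [Finset.sum_insert, add_assoc]

/-- A node of the face `x₄ = 0`. -/
def faceNode (n a b c : ℕ) : Node n :=
  if h : a + b + c = n then ⟨![a, b, c, 0], by simp [Fin.sum_univ_four, h]⟩ else terminal n 0

lemma faceNode_val {a b c : ℕ} (h : a + b + c = n) : (faceNode n a b c).1 = ![a, b, c, 0] := by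
  rw [faceNode, dif_pos h]

/-- The labelling of the face induced by a cut. -/
def faceLabel (P : Node n → Fin 5) (a b c : ℕ) : Fin 5 := P (faceNode n a b c)

lemma corner_faceNode (hn : 1 ≤ n) {p q r : ℕ} (h : p + q + r = n - 1) :
    corner hn (faceNode (n - 1) p q r) 0 = faceNode n (p + 1) q r ∧
    corner hn (faceNode (n - 1) p q r) 1 = faceNode n p (q + 1) r ∧
    corner hn (faceNode (n - 1) p q r) 2 = faceNode n p q (r + 1) := by
  refine ⟨?_, ?_, ?_⟩ <;>
  · refine Subtype.ext (funext fun k => ?_)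
    rw [corner_apply, faceNode_val h, faceNode_val (by omega)]
    fin_cases k <;> simp

/-- The nonzero edges of the face contribute to the cost of a cut. -/
lemma face_sum_le_cost (hn : 1 ≤ n) {w : Sym2 (Node n) → ℝ} (hw : ∀ e, 0 ≤ w e)
    (P : Node n → Fin 5) :
    ∑ x ∈ tri (n - 1),
      (w s(faceNode n (x.1 + 1) x.2.1 x.2.2, faceNode n x.1 (x.2.1 + 1) x.2.2)
          * cutAB (faceLabel P) x.1 x.2.1 x.2.2
        + w s(faceNode n x.1 (x.2.1 + 1) x.2.2, faceNode n x.1 x.2.1 (x.2.2 + 1))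
          * cutBC (faceLabel P) x.1 x.2.1 x.2.2
        + w s(faceNode n x.1 x.2.1 (x.2.2 + 1), faceNode n (x.1 + 1) x.2.1 x.2.2)
          * cutCA (faceLabel P) x.1 x.2.1 x.2.2) ≤ cost w P := by
  refine le_trans ?_ (sum_cellCost_le_cost hn hw P)
  have hinj : Set.InjOn (fun x : ℕ × ℕ × ℕ => faceNode (n - 1) x.1 x.2.1 x.2.2) (tri (n - 1)) := by
    intro x hx y hy h
    have h := congrArg Subtype.val h
    simp only [Finset.mem_coe, mem_tri] at hx hy
    simp only [faceNode_val hx, faceNode_val hy] at h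
    have h0 := congrFun h 0
    have h1 := congrFun h 1
    have h2 := congrFun h 2
    simp at h0 h1 h2
    exact Prod.ext h0 (Prod.ext h1 h2)
  calc _ ≤ ∑ x ∈ tri (n - 1), cellCost hn w P (faceNode (n - 1) x.1 x.2.1 x.2.2) := by
        refine Finset.sum_le_sum fun x hx => ?_
        obtain ⟨e0, e1, e2⟩ := corner_faceNode hn (mem_tri.1 hx)
        rw [cellCost, sum_pairs]
        simp only [e0, e1, e2]
        set y := faceNode (n - 1) x.1 x.2.1 x.2.2
        have a := mul_nonneg (hw s(faceNode n (x.1 + 1) x.2.1 x.2.2, corner hn y 3))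
          (disc_nonneg (P (faceNode n (x.1 + 1) x.2.1 x.2.2)) (P (corner hn y 3)))
        have b := mul_nonneg (hw s(faceNode n x.1 (x.2.1 + 1) x.2.2, corner hn y 3))
          (disc_nonneg (P (faceNode n x.1 (x.2.1 + 1) x.2.2)) (P (corner hn y 3)))
        have c := mul_nonneg (hw s(faceNode n x.1 x.2.1 (x.2.2 + 1), corner hn y 3))
          (disc_nonneg (P (faceNode n x.1 x.2.1 (x.2.2 + 1))) (P (corner hn y 3)))
        simp only [cutAB, cutBC, cutCA, faceLabel]
        rw [Sym2.eq_swap (a := faceNode n x.1 x.2.1 (x.2.2 + 1)) (b := faceNode n (x.1 + 1) x.2.1 x.2.2),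
          disc_comm (P (faceNode n x.1 x.2.1 (x.2.2 + 1)))]
        linarith
    _ = ∑ y ∈ (tri (n - 1)).image (fun x => faceNode (n - 1) x.1 x.2.1 x.2.2), cellCost hn w P y :=
        (Finset.sum_image hinj).symm
    _ ≤ _ := Finset.sum_le_sum_of_subset_of_nonneg (Finset.subset_univ _)
        fun y _ _ => cellCost_nonneg hn hw P y

lemma mem_support {x : Node n} {i : Fin 4} : i ∈ support x ↔ x.1 i ≠ 0 := by simp [support]

lemma isLabelling_faceLabel {P : Node n → Fin 5} (hP : IsNonOpposite P) :
    IsLabelling n 0 1 2 4 (faceLabel P) := by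
  have hterm : faceNode n n 0 0 = terminal n 0 ∧ faceNode n 0 n 0 = terminal n 1 ∧
      faceNode n 0 0 n = terminal n 2 := by
    refine ⟨?_, ?_, ?_⟩ <;>
    · refine Subtype.ext (funext fun k => ?_)
      rw [faceNode_val (by omega)]
      fin_cases k <;> simp [terminal]
  have hmem : ∀ a b c, a + b + c = n → faceLabel P a b c = 4 ∨ (a ≠ 0 ∧ faceLabel P a b c = 0) ∨
      (b ≠ 0 ∧ faceLabel P a b c = 1) ∨ (c ≠ 0 ∧ faceLabel P a b c = 2) := by
    intro a b c h
    rcases hP.2 (faceNode n a b c) with h' | ⟨i, hi, h'⟩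
    · exact Or.inl h'
    · rw [mem_support, faceNode_val h] at hi
      fin_cases i
      · exact Or.inr (Or.inl ⟨hi, h'⟩)
      · exact Or.inr (Or.inr (Or.inl ⟨hi, h'⟩))
      · exact Or.inr (Or.inr (Or.inr ⟨hi, h'⟩))
      · simp at hi
  refine ⟨by decide, by decide, by decide, by decide, by decide, by decide, ?_, ?_, ?_, ?_, ?_, ?_, ?_⟩
  · intro a b c h
    have := hmem a b c h
    tauto
  · intro b c h e
    rcases hmem 0 b c (by omega) with h' | ⟨h0, h'⟩ | ⟨-, h'⟩ | ⟨-, h'⟩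
    · rw [e] at h'; exact absurd h' (by decide)
    · exact h0 rfl
    · rw [e] at h'; exact absurd h' (by decide)
    · rw [e] at h'; exact absurd h' (by decide)
  · intro b c h e
    rcases hmem b 0 c (by omega) with h' | ⟨-, h'⟩ | ⟨h0, h'⟩ | ⟨-, h'⟩
    · rw [e] at h'; exact absurd h' (by decide)
    · rw [e] at h'; exact absurd h' (by decide)
    · exact h0 rfl
    · rw [e] at h'; exact absurd h' (by decide)
  · intro b c h e
    rcases hmem b c 0 (by omega) with h' | ⟨-, h'⟩ | ⟨-, h'⟩ | ⟨h0, h'⟩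
    · rw [e] at h'; exact absurd h' (by decide)
    · rw [e] at h'; exact absurd h' (by decide)
    · rw [e] at h'; exact absurd h' (by decide)
    · exact h0 rfl
  · rw [faceLabel, hterm.1]; exact hP.1 0
  · rw [faceLabel, hterm.2.1]; exact hP.1 1
  · rw [faceLabel, hterm.2.2]; exact hP.1 2

end CellSums

section Sperner

variable {n : ℕ}

/-- The label that all nodes of a cell have in common. -/
def IsMono (hn : 1 ≤ n) (P : Node n → Fin 5) (y : Node (n - 1)) (a : Fin 5) : Prop :=
  ∀ i, P (corner hn y i) = a

/-- The coordinate belonging to a label, the last one for the extra label. -/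
def coordOf (a : Fin 5) : Fin 4 := ⟨min a.1 3, by omega⟩

/-- A cell moved by one step from coordinate `i` to the last coordinate. -/
def shiftCell (y : Node n) (i : Fin 4) (h : y.1 i ≠ 0) : Node n :=
  ⟨fun k => y.1 k - (if k = i then 1 else 0) + if k = 3 then 1 else 0, by
    have h1 := y.2
    have h2 : ∑ k, (y.1 k - (if k = i then 1 else 0)) + 1 = ∑ k, y.1 k := by
      have e : ∀ k, y.1 k = (y.1 k - (if k = i then 1 else 0)) + if k = i then 1 else 0 := by
        intro k
        by_cases hk : k = i
        · subst hk; simp; omega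
        · simp [hk]
      conv_rhs => rw [Finset.sum_congr rfl fun k _ => e k, Finset.sum_add_distrib]
      simp
    rw [Finset.sum_add_distrib]
    simp only [Finset.sum_ite_eq', Finset.mem_univ, if_true]
    omega⟩

lemma isMono_coord_ne_zero (hn : 1 ≤ n) {P : Node n → Fin 5} (hP : IsNonOpposite P)
    {y : Node (n - 1)} {a : Fin 5} (hy : IsMono hn P y a) (hne : ¬ (a = 4 ∧ y.1 3 = 0)) :
    y.1 (coordOf a) ≠ 0 := by
  have key : ∀ i : Fin 4, a = i.castSucc → y.1 i ≠ 0 := by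
    intro i hi
    obtain ⟨j, hj⟩ : ∃ j : Fin 4, j ≠ i := ⟨i + 1, by fin_cases i <;> decide⟩
    have h1 := hy j
    rcases hP.2 (corner hn y j) with h2 | ⟨k, hk, h2⟩
    · rw [h2, hi] at h1
      exact absurd h1 (by fin_cases i <;> decide)
    · rw [h2, hi] at h1
      have : k = i := Fin.castSucc_injective _ h1
      subst this
      rw [mem_support, corner_apply, if_neg hj.symm] at hk
      simpa using hk
  fin_cases a
  · exact key 0 rfl
  · exact key 1 rfl
  · exact key 2 rfl
  · exact key 3 rfl
  · intro h
    exact hne ⟨rfl, h⟩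

open Classical in
/-- Every cell of the face without common label `5` accounts for a cell that is not
monochromatic. -/
lemma card_not_mono_ge (hn : 1 ≤ n) {P : Node n → Fin 5} (hP : IsNonOpposite P) :
    ((tri (n - 1)).card : ℤ) - (monoCells n 4 (faceLabel P)).card
      ≤ (Finset.univ.filter fun y : Node (n - 1) => ¬ ∃ a, IsMono hn P y a).card := by
  let M := Finset.univ.filter fun y : Node (n - 1) => (∃ a, IsMono hn P y a) ∧
    ¬ (IsMono hn P y 4 ∧ y.1 3 = 0)
  let Z := Finset.univ.filter fun y : Node (n - 1) => IsMono hn P y 4 ∧ y.1 3 = 0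
  let I := Finset.univ.filter fun y : Node (n - 1) => y.1 3 ≠ 0
  let B := Finset.univ.filter fun y : Node (n - 1) => ¬ y.1 3 ≠ 0
  have hM : M.card ≤ I.card := by
    have hc : ∀ y ∈ M, ∃ a, IsMono hn P y a ∧ y.1 (coordOf a) ≠ 0 := by
      intro y hy
      obtain ⟨-, ⟨a, ha⟩, h⟩ := Finset.mem_filter.1 hy
      refine ⟨a, ha, isMono_coord_ne_zero hn hP ha ?_⟩
      rintro ⟨rfl, h'⟩
      exact h ⟨ha, h'⟩
    choose col hcol hne using hc
    refine Finset.card_le_card_of_injOn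
      (fun y => if h : y ∈ M then shiftCell y (coordOf (col y h)) (hne y h) else y)
      (fun y hy => ?_) (fun y hy y' hy' h => ?_)
    · have hy := Finset.mem_coe.1 hy
      simp only [hy, dif_pos]
      refine Finset.mem_coe.2 (Finset.mem_filter.2 ⟨Finset.mem_univ _, ?_⟩)
      simp [shiftCell]
    · have hy := Finset.mem_coe.1 hy
      have hy' := Finset.mem_coe.1 hy'
      simp only [hy, hy', dif_pos] at h
      have e : ∀ k, y.1 k - (if k = coordOf (col y hy) then 1 else 0)
          = y'.1 k - (if k = coordOf (col y' hy') then 1 else 0) := by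
        intro k
        have := congrFun (congrArg Subtype.val h) k
        simp only [shiftCell] at this
        omega
      have n1 := hne y hy
      have n2 := hne y' hy'
      have e' : ∀ k, y.1 k + (if k = coordOf (col y' hy') then 1 else 0)
          = y'.1 k + (if k = coordOf (col y hy) then 1 else 0) := by
        intro k
        have h1 := e k
        by_cases k1 : k = coordOf (col y hy)
        · by_cases k2 : k = coordOf (col y' hy')
          · rw [if_pos k1, if_pos k2] at h1
            rw [if_pos k1, if_pos k2]
            rw [← k1] at n1
            rw [← k2] at n2
            omega
          · rw [if_pos k1, if_neg k2] at h1
            rw [if_pos k1, if_neg k2]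
            rw [← k1] at n1
            omega
        · by_cases k2 : k = coordOf (col y' hy')
          · rw [if_neg k1, if_pos k2] at h1
            rw [if_neg k1, if_pos k2]
            rw [← k2] at n2
            omega
          · rw [if_neg k1, if_neg k2] at h1
            rw [if_neg k1, if_neg k2]
            omega
      have hcor : corner hn y (coordOf (col y' hy')) = corner hn y' (coordOf (col y hy)) :=
        Subtype.ext (funext e')
      have hcc : col y hy = col y' hy' := by
        rw [← hcol y hy (coordOf (col y' hy')), hcor, hcol y' hy']
      refine Subtype.ext (funext fun k => ?_)
      have := e' k
      rw [hcc] at this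
      omega
  have hZ : Z.card ≤ (monoCells n 4 (faceLabel P)).card := by
    refine Finset.card_le_card_of_injOn (fun y => (y.1 0, y.1 1, y.1 2)) (fun y hy => ?_)
      (fun y hy y' hy' h => ?_)
    · obtain ⟨-, hy, h3⟩ := Finset.mem_filter.1 (Finset.mem_coe.1 hy)
      have hs : y.1 0 + y.1 1 + y.1 2 = n - 1 := by
        have := y.2
        rw [Fin.sum_univ_four] at this
        omega
      have hyn : faceNode (n - 1) (y.1 0) (y.1 1) (y.1 2) = y := by
        refine Subtype.ext (funext fun k => ?_)
        rw [faceNode_val hs]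
        fin_cases k <;> simp [h3]
      obtain ⟨e0, e1, e2⟩ := corner_faceNode hn hs
      rw [hyn] at e0 e1 e2
      refine Finset.mem_coe.2 (mem_monoCells.2 ⟨hs, ?_, ?_, ?_⟩)
      · exact (congrArg P e0).symm.trans (hy 0)
      · exact (congrArg P e1).symm.trans (hy 1)
      · exact (congrArg P e2).symm.trans (hy 2)
    · obtain ⟨-, -, h3⟩ := Finset.mem_filter.1 (Finset.mem_coe.1 hy)
      obtain ⟨-, -, h3'⟩ := Finset.mem_filter.1 (Finset.mem_coe.1 hy')
      simp only [Prod.mk.injEq] at h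
      refine Subtype.ext (funext fun k => ?_)
      fin_cases k
      · exact h.1
      · exact h.2.1
      · exact h.2.2
      · exact h3.trans h3'.symm
  have hB : (tri (n - 1)).card ≤ B.card := by
    refine Finset.card_le_card_of_injOn (fun x => faceNode (n - 1) x.1 x.2.1 x.2.2)
      (fun x hx => ?_) (fun x hx y hy h => ?_)
    · have hx := mem_tri.1 (Finset.mem_coe.1 hx)
      refine Finset.mem_coe.2 (Finset.mem_filter.2 ⟨Finset.mem_univ _, ?_⟩)
      rw [faceNode_val hx]; simp
    · have h := congrArg Subtype.val h
      simp only [Finset.mem_coe, mem_tri] at hx hy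
      simp only [faceNode_val hx, faceNode_val hy] at h
      have h0 := congrFun h 0
      have h1 := congrFun h 1
      have h2 := congrFun h 2
      simp at h0 h1 h2
      exact Prod.ext h0 (Prod.ext h1 h2)
  have hIB : I.card + B.card = (Finset.univ : Finset (Node (n - 1))).card :=
    Finset.card_filter_add_card_filter_not _
  have hall : (Finset.univ : Finset (Node (n - 1))).card ≤ M.card + Z.card
      + (Finset.univ.filter fun y : Node (n - 1) => ¬ ∃ a, IsMono hn P y a).card := by
    refine le_trans (Finset.card_le_card ?_) ((Finset.card_union_le _ _).trans
      (Nat.add_le_add_right (Finset.card_union_le _ _) _))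
    intro y _
    simp only [M, Z, Finset.mem_union, Finset.mem_filter, Finset.mem_univ, true_and]
    tauto
  omega

end Sperner

section Weights

variable {n : ℕ}

lemma support_subset_face {x : Node n} : support x ⊆ {0, 1, 2} ↔ x.1 3 = 0 := by
  constructor
  · intro h
    by_contra h3
    exact absurd (h (mem_support.2 h3)) (by decide)
  · intro h i hi
    have := mem_support.1 hi
    fin_cases i
    · decide
    · decide
    · decide
    · exact absurd h this

lemma mk_mem_faceEdges {x y : Node n} :
    s(x, y) ∈ faceEdges n ↔ (graph n).Adj x y ∧ x.1 3 = 0 ∧ y.1 3 = 0 := by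
  simp only [faceEdges, Set.mem_ofPred_eq, Sym2.ball, support_subset_face, SimpleGraph.mem_edgeSet]

lemma mk_mem_cornerEdges {x y : Node n} {i : Fin 4} : s(x, y) ∈ cornerEdges n i ↔
    ((graph n).Adj x y ∧ x.1 3 = 0 ∧ y.1 3 = 0) ∧ 2 * n < 3 * x.1 i ∧ 2 * n < 3 * y.1 i := by
  simp only [cornerEdges, Set.mem_ofPred_eq, Sym2.ball, mk_mem_faceEdges]

lemma mk_mem_boundary {x y : Node n} {i j : Fin 4} : s(x, y) ∈ boundary n i j ↔
    (graph n).Adj x y ∧ support x ⊆ {i, j} ∧ support y ⊆ {i, j} := by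
  simp only [boundary, Set.mem_ofPred_eq, Sym2.ball, SimpleGraph.mem_edgeSet]

lemma add_le_of_node (x : Node n) {i j : Fin 4} (h : i ≠ j) : x.1 i + x.1 j ≤ n := by
  have := Finset.sum_le_sum_of_subset (f := x.1) (Finset.subset_univ {i, j})
  rwa [Finset.sum_pair h, x.2] at this

lemma weight₁_of_corner {x y : Node n} {i : Fin 4} (hi : i ≠ 3) (h : s(x, y) ∈ cornerEdges n i) :
    weight₁ n s(x, y) = cornerWeight n i s(x, y) := by
  have hd : ∀ j, j ≠ i → s(x, y) ∉ cornerEdges n j := by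
    intro j hj hc
    have h1 := (mk_mem_cornerEdges.1 h).2.1
    have h2 := (mk_mem_cornerEdges.1 hc).2.1
    have := add_le_of_node x hj
    omega
  unfold weight₁
  fin_cases i
  · exact if_pos h
  · exact (if_neg (hd 0 (by decide))).trans (if_pos h)
  · exact (if_neg (hd 0 (by decide))).trans ((if_neg (hd 1 (by decide))).trans (if_pos h))
  · exact absurd rfl hi

lemma weight₁_of_face {x y : Node n} (hf : s(x, y) ∈ faceEdges n)
    (h : ∀ i : Fin 4, i ≠ 3 → s(x, y) ∉ cornerEdges n i) : weight₁ n s(x, y) = rho n := by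
  unfold weight₁
  rw [if_neg (h 0 (by decide)), if_neg (h 1 (by decide)), if_neg (h 2 (by decide)), if_pos hf]

lemma rho_nonneg : 0 ≤ rho n := by unfold rho; positivity

/-- The weight of the edge of a cell in the directions `i`, `j`. -/
lemma weight₁_edge (hn : 1 ≤ n) {x y : Node n} {i j k : Fin 4} (hij : i ≠ j) (hik : i ≠ k)
    (hjk : j ≠ k) (hi : i ≠ 3) (hj : j ≠ 3) (hk : k ≠ 3) {p q r : ℕ} (hs : p + q + r = n - 1)
    (hadj : (graph n).Adj x y) (hxi : x.1 i = p + 1) (hxj : x.1 j = q) (hxk : x.1 k = r)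
    (hx : x.1 3 = 0) (hyi : y.1 i = p) (hyj : y.1 j = q + 1) (hyk : y.1 k = r)
    (hy : y.1 3 = 0) : weight₁ n s(x, y) = rho n * wt n p q r := by
  have hall : ∀ t : Fin 4, t = i ∨ t = j ∨ t = k ∨ t = 3 := by
    revert hij hik hjk hi hj hk
    clear hxi hxj hxk hyi hyj hyk
    revert i j k
    decide
  have hsupp : ∀ a b : Fin 4, s(x, y) ∈ boundary n a b →
      (i = a ∨ i = b) ∧ (j = a ∨ j = b) ∧ (r ≠ 0 → k = a ∨ k = b) := by
    intro a b h
    obtain ⟨-, h1, h2⟩ := mk_mem_boundary.1 h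
    have a1 := h1 (mem_support.2 (show x.1 i ≠ 0 by omega))
    have a2 := h2 (mem_support.2 (show y.1 j ≠ 0 by omega))
    refine ⟨by simpa using a1, by simpa using a2, fun hr => ?_⟩
    have a3 := h1 (mem_support.2 (show x.1 k ≠ 0 by omega))
    simpa using a3
  have hbd : ∀ a b : Fin 4, (i = a ∨ i = b) → (j = a ∨ j = b) → r = 0 →
      s(x, y) ∈ boundary n a b := by
    intro a b h1 h2 hr
    refine mk_mem_boundary.2 ⟨hadj, fun t ht => ?_, fun t ht => ?_⟩
    · have ht := mem_support.1 ht
      simp only [Finset.mem_insert, Finset.mem_singleton]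
      rcases hall t with rfl | rfl | rfl | rfl
      · exact h1
      · exact h2
      · omega
      · omega
    · have ht := mem_support.1 ht
      simp only [Finset.mem_insert, Finset.mem_singleton]
      rcases hall t with rfl | rfl | rfl | rfl
      · exact h1
      · exact h2
      · omega
      · omega
  unfold wt
  by_cases c1 : 2 * n < 3 * r
  · have hc : s(x, y) ∈ cornerEdges n k := mk_mem_cornerEdges.2 ⟨⟨hadj, hx, hy⟩, by omega, by omega⟩
    rw [weight₁_of_corner hk hc, cornerWeight, if_pos c1, if_neg, if_pos, mul_zero]
    · simp [hxk, hyk]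
    · rintro ⟨t, -, -, ht⟩
      obtain ⟨h1, h2, -⟩ := hsupp _ _ ht
      have e1 := h1.resolve_left hik
      have e2 := h2.resolve_left hjk
      exact hij (e1.trans e2.symm)
  rw [if_neg c1]
  by_cases c2 : 2 * n < 3 * p
  · have hc : s(x, y) ∈ cornerEdges n i := mk_mem_cornerEdges.2 ⟨⟨hadj, hx, hy⟩, by omega, by omega⟩
    rw [weight₁_of_corner hi hc, cornerWeight]
    by_cases hr : r = 0
    · rw [if_pos ⟨j, hij.symm, hj, hbd _ _ (Or.inl rfl) (Or.inr rfl) hr⟩, if_pos ⟨hr, c2⟩, mul_comm]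
      congr 2
      simp only [depth, Sym2.map_mk, Sym2.sup_mk, hxi, hyi]
      rw [show (p + 1) ⊔ p = p + 1 from max_eq_left (by omega), show n - (p + 1) = q by omega]
    · rw [if_neg, if_neg, if_neg (by omega), if_neg (by omega), mul_one]
      · intro h
        have := h x (Sym2.mem_mk_left _ _) y (Sym2.mem_mk_right _ _)
        omega
      · rintro ⟨t, -, -, ht⟩
        obtain ⟨h1, h2, h3⟩ := hsupp _ _ ht
        have e2 := h2.resolve_left hij.symm
        have e3 := (h3 hr).resolve_left hik.symm
        exact hjk (e2.trans e3.symm)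
  rw [if_neg (by omega)]
  by_cases c3 : 2 * n < 3 * q
  · have hc : s(x, y) ∈ cornerEdges n j := mk_mem_cornerEdges.2 ⟨⟨hadj, hx, hy⟩, by omega, by omega⟩
    rw [weight₁_of_corner hj hc, cornerWeight]
    by_cases hr : r = 0
    · rw [if_pos ⟨i, hij, hi, hbd _ _ (Or.inr rfl) (Or.inl rfl) hr⟩, if_pos ⟨hr, c3⟩, mul_comm]
      congr 2
      simp only [depth, Sym2.map_mk, Sym2.sup_mk, hxj, hyj]
      rw [show q ⊔ (q + 1) = q + 1 from max_eq_right (by omega), show n - (q + 1) = p by omega]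
    · rw [if_neg, if_neg, if_neg (by omega), mul_one]
      · intro h
        have := h x (Sym2.mem_mk_left _ _) y (Sym2.mem_mk_right _ _)
        omega
      · rintro ⟨t, -, -, ht⟩
        obtain ⟨h1, h2, h3⟩ := hsupp _ _ ht
        have e2 := h1.resolve_left hij
        have e3 := (h3 hr).resolve_left hjk.symm
        exact hik (e2.trans e3.symm)
  rw [if_neg (by omega), mul_one]
  refine weight₁_of_face (mk_mem_faceEdges.2 ⟨hadj, hx, hy⟩) fun t _ ht => ?_
  obtain ⟨-, h1, h2⟩ := mk_mem_cornerEdges.1 ht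
  rcases hall t with rfl | rfl | rfl | rfl <;> omega

lemma faceNode_adj (hn : 1 ≤ n) {p q r : ℕ} (h : p + q + r = n - 1) :
    (graph n).Adj (faceNode n (p + 1) q r) (faceNode n p (q + 1) r) ∧
    (graph n).Adj (faceNode n p (q + 1) r) (faceNode n p q (r + 1)) ∧
    (graph n).Adj (faceNode n p q (r + 1)) (faceNode n (p + 1) q r) := by
  obtain ⟨e0, e1, e2⟩ := corner_faceNode hn h
  rw [← e0, ← e1, ← e2]
  exact ⟨corner_adj hn _ (by decide), corner_adj hn _ (by decide), corner_adj hn _ (by decide)⟩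

lemma cornerWeight_nonneg {x y : Node n} {i : Fin 4} (h : s(x, y) ∈ cornerEdges n i) :
    0 ≤ cornerWeight n i s(x, y) := by
  unfold cornerWeight
  split_ifs
  · refine mul_nonneg ?_ rho_nonneg
    have h1 := (mk_mem_cornerEdges.1 h).2.1
    have : 3 * depth i s(x, y) ≤ n := by
      simp only [depth, Sym2.map_mk, Sym2.sup_mk]
      have : x.1 i ≤ x.1 i ⊔ y.1 i := le_max_left _ _
      omega
    have : (3 * depth i s(x, y) : ℝ) ≤ n := by exact_mod_cast this
    linarith
  · exact le_rfl
  · exact rho_nonneg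

lemma weight₁_nonneg (e : Sym2 (Node n)) : 0 ≤ weight₁ n e := by
  induction e with
  | _ x y =>
    unfold weight₁
    split_ifs with h1 h2 h3
    · exact cornerWeight_nonneg h1
    · exact cornerWeight_nonneg h2
    · exact cornerWeight_nonneg h3
    · exact rho_nonneg
    · exact le_rfl

lemma rho_mul_wCut_le_cost (hn : 1 ≤ n) (P : Node n → Fin 5) :
    rho n * wCut n (faceLabel P) ≤ cost (weight₁ n) P := by
  refine le_trans (le_of_eq ?_) (face_sum_le_cost hn weight₁_nonneg P)
  rw [wCut, Finset.mul_sum]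
  refine Finset.sum_congr rfl fun x hx => ?_
  have hs := mem_tri.1 hx
  obtain ⟨a0, a1, a2⟩ := faceNode_adj hn hs
  have v0 := faceNode_val (n := n) (a := x.1 + 1) (b := x.2.1) (c := x.2.2) (by omega)
  have v1 := faceNode_val (n := n) (a := x.1) (b := x.2.1 + 1) (c := x.2.2) (by omega)
  have v2 := faceNode_val (n := n) (a := x.1) (b := x.2.1) (c := x.2.2 + 1) (by omega)
  rw [weight₁_edge hn (i := 0) (j := 1) (k := 2) (by decide) (by decide) (by decide) (by decide)
      (by decide) (by decide) (p := x.1) (q := x.2.1) (r := x.2.2) hs a0 (by rw [v0]; rfl)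
      (by rw [v0]; rfl) (by rw [v0]; rfl) (by rw [v0]; rfl) (by rw [v1]; rfl) (by rw [v1]; rfl)
      (by rw [v1]; rfl) (by rw [v1]; rfl),
    weight₁_edge hn (i := 1) (j := 2) (k := 0) (by decide) (by decide) (by decide) (by decide)
      (by decide) (by decide) (p := x.2.1) (q := x.2.2) (r := x.1) (by omega) a1 (by rw [v1]; rfl)
      (by rw [v1]; rfl) (by rw [v1]; rfl) (by rw [v1]; rfl) (by rw [v2]; rfl) (by rw [v2]; rfl)
      (by rw [v2]; rfl) (by rw [v2]; rfl),
    weight₁_edge hn (i := 2) (j := 0) (k := 1) (by decide) (by decide) (by decide) (by decide)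
      (by decide) (by decide) (p := x.2.2) (q := x.1) (r := x.2.1) (by omega) a2 (by rw [v2]; rfl)
      (by rw [v2]; rfl) (by rw [v2]; rfl) (by rw [v2]; rfl) (by rw [v0]; rfl) (by rw [v0]; rfl)
      (by rw [v0]; rfl) (by rw [v0]; rfl), wcellCut]
  ring

end Weights

section Sides

variable {n m : ℕ} {l z : Fin 5} {F : ℕ → ℕ → ℕ → Fin 5}

lemma sum_range_le_sum_tri {N k : ℕ} {f : ℕ → ℝ} {g : ℕ × ℕ × ℕ → ℝ} (e : ℕ → ℕ × ℕ × ℕ)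
    (hg : ∀ x ∈ tri N, 0 ≤ g x) (he : ∀ j < k, e j ∈ tri N)
    (hinj : ∀ i < k, ∀ j < k, e i = e j → i = j) (hf : ∀ j < k, f j ≤ g (e j)) :
    ∑ j ∈ Finset.range k, f j ≤ ∑ x ∈ tri N, g x := by
  have hi : Set.InjOn e (Finset.range k) := fun i hi j hj h =>
    hinj i (by simpa using hi) j (by simpa using hj) h
  calc _ ≤ ∑ j ∈ Finset.range k, g (e j) :=
        Finset.sum_le_sum fun j hj => hf j (Finset.mem_range.1 hj)
    _ = ∑ x ∈ (Finset.range k).image e, g x := (Finset.sum_image hi).symm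
    _ ≤ _ := Finset.sum_le_sum_of_subset_of_nonneg (fun x hx => by
        obtain ⟨j, hj, rfl⟩ := Finset.mem_image.1 hx
        exact he j (Finset.mem_range.1 hj)) fun x hx _ => hg x hx

/-- The number of cut edges on the three sides. -/
def sidesCut (n : ℕ) (F : ℕ → ℕ → ℕ → Fin 5) : ℝ :=
  rowCut n F 0 + rowCut n (rot F) 0 + rowCut n (rot (rot F)) 0

lemma rowCut_zero_le (hn : 1 ≤ n) : rowCut n F 0 ≤ ∑ x ∈ tri (n - 1),
    (if x.2.2 = 0 then 1 else 0) * cutAB F x.1 x.2.1 x.2.2 := by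
  refine sum_range_le_sum_tri (fun j => (n - 1 - j, j, 0))
    (fun x _ => mul_nonneg (by split_ifs <;> norm_num) cutAB_nonneg) (fun j hj => ?_)
    (fun i _ j _ h => ?_) fun j hj => ?_
  · simp only [mem_tri]; omega
  · simp only [Prod.mk.injEq] at h; exact h.2.1
  · simp only [if_true, one_mul, cutAB, rowLabel]
    rw [show n - 0 - j = n - 1 - j + 1 by omega, show n - 0 - (j + 1) = n - 1 - j by omega]

lemma sidesCut_le (hn : 1 ≤ n) : sidesCut n F ≤ ∑ x ∈ tri (n - 1),
    ((if x.2.2 = 0 then 1 else 0) * cutAB F x.1 x.2.1 x.2.2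
      + (if x.1 = 0 then 1 else 0) * cutBC F x.1 x.2.1 x.2.2
      + (if x.2.1 = 0 then 1 else 0) * cutCA F x.1 x.2.1 x.2.2) := by
  have h1 := rowCut_zero_le (F := F) hn
  have h2 := rowCut_zero_le (F := rot F) hn
  have h3 := rowCut_zero_le (F := rot (rot F)) hn
  have a2 := sum_tri_rotate (n - 1) fun p q r => (if r = 0 then 1 else 0) * cutAB (rot F) p q r
  have a3 := sum_tri_rotate (n - 1) fun p q r =>
    (if p = 0 then 1 else 0) * cutAB (rot (rot F)) q r p
  have a4 := sum_tri_rotate (n - 1) fun p q r =>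
    (if r = 0 then 1 else 0) * cutAB (rot (rot F)) p q r
  rw [← a2] at h2
  rw [← a4, ← a3] at h3
  rw [Finset.sum_add_distrib, Finset.sum_add_distrib]
  exact add_le_add (add_le_add h1 h2) h3

/-- The number of cut edges on the boundary of the triangle of side length `m` at the first
corner. -/
def redCut (n m : ℕ) (F : ℕ → ℕ → ℕ → Fin 5) : ℝ :=
  ∑ j ∈ Finset.range m, disc (F (n - j) j 0) (F (n - (j + 1)) (j + 1) 0)
    + ∑ j ∈ Finset.range m, disc (F (n - m) (m - j) j) (F (n - m) (m - (j + 1)) (j + 1))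
    + ∑ j ∈ Finset.range m, disc (F (n - j) 0 j) (F (n - (j + 1)) 0 (j + 1))

lemma redCut_nonneg : 0 ≤ redCut n m F :=
  add_nonneg (add_nonneg (Finset.sum_nonneg fun _ _ => disc_nonneg _ _)
    (Finset.sum_nonneg fun _ _ => disc_nonneg _ _)) (Finset.sum_nonneg fun _ _ => disc_nonneg _ _)

lemma redCut_le (hm : m < n) : redCut n m F ≤ ∑ x ∈ tri (n - 1),
    ((if x.2.2 = 0 ∧ n - m ≤ x.1 then 1 else 0) * cutAB F x.1 x.2.1 x.2.2
      + (if x.1 = n - m then 1 else 0) * cutBC F x.1 x.2.1 x.2.2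
      + (if x.2.1 = 0 ∧ n - m ≤ x.1 then 1 else 0) * cutCA F x.1 x.2.1 x.2.2) := by
  rw [Finset.sum_add_distrib, Finset.sum_add_distrib]
  refine add_le_add (add_le_add ?_ ?_) ?_
  · refine sum_range_le_sum_tri (fun j => (n - 1 - j, j, 0))
      (fun x _ => mul_nonneg (by split_ifs <;> norm_num) cutAB_nonneg) (fun j hj => ?_)
      (fun i _ j _ h => ?_) fun j hj => ?_
    · simp only [mem_tri]; omega
    · simp only [Prod.mk.injEq] at h; exact h.2.1
    · simp only [cutAB, true_and]
      rw [if_pos (by omega), one_mul, show n - j = n - 1 - j + 1 by omega,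
        show n - (j + 1) = n - 1 - j by omega]
  · refine sum_range_le_sum_tri (fun j => (n - m, m - (j + 1), j))
      (fun x _ => mul_nonneg (by split_ifs <;> norm_num) cutBC_nonneg) (fun j hj => ?_)
      (fun i _ j _ h => ?_) fun j hj => ?_
    · simp only [mem_tri]; omega
    · simp only [Prod.mk.injEq] at h; exact h.2.2
    · simp only [cutBC, if_true, one_mul]
      rw [show m - (j + 1) + 1 = m - j by omega]
  · refine sum_range_le_sum_tri (fun j => (n - 1 - j, 0, j))
      (fun x _ => mul_nonneg (by split_ifs <;> norm_num) cutCA_nonneg) (fun j hj => ?_)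
      (fun i _ j _ h => ?_) fun j hj => ?_
    · simp only [mem_tri]; omega
    · simp only [Prod.mk.injEq] at h; exact h.2.2
    · simp only [cutCA, true_and]
      rw [if_pos (by omega), one_mul, disc_comm, show n - j = n - 1 - j + 1 by omega,
        show n - (j + 1) = n - 1 - j by omega]

lemma two_le_redCut (hm : m < n) (hl : F n 0 0 = l) (hB : ¬ MonoBoundary n m l F) :
    2 ≤ redCut n m F := by
  unfold MonoBoundary at hB
  push Not at hB
  obtain ⟨a, b, c, hs, ha, hbd, hne⟩ := hB
  have e1 := disc_le_sum_range (fun j => F (n - j) j 0) m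
  have e2 := disc_le_sum_range (fun j => F (n - m) (m - j) j) m
  have e3 := disc_le_sum_range (fun j => F (n - j) 0 j) m
  simp only [Nat.sub_zero, Nat.sub_self, hl] at e1 e2 e3
  unfold redCut
  have comm₁ := disc_comm (F (n - m) m 0) l
  have comm₂ := disc_comm (F (n - m) 0 m) l
  have comm₃ := disc_comm (F (n - m) 0 m) (F (n - m) m 0)
  rcases hbd with h0 | h0 | h0
  · have e := disc_add_disc_le_sum_range (fun j => F (n - j) 0 j) (show c ≤ m by omega)
    simp only [Nat.sub_zero, hl] at e
    rw [h0] at hne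
    rw [show n - c = a by omega, disc_of_ne hne.symm] at e
    have t1 := disc_triangle (F a 0 c) (F (n - m) 0 m) l
    have t2 := disc_triangle (F (n - m) 0 m) (F (n - m) m 0) l
    rw [disc_of_ne hne] at t1
    linarith
  · have e := disc_add_disc_le_sum_range (fun j => F (n - j) j 0) (show b ≤ m by omega)
    simp only [Nat.sub_zero, hl] at e
    rw [h0] at hne
    rw [show n - b = a by omega, disc_of_ne hne.symm] at e
    have t1 := disc_triangle (F a b 0) (F (n - m) m 0) l
    have t2 := disc_triangle (F (n - m) m 0) (F (n - m) 0 m) l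
    rw [disc_of_ne hne] at t1
    linarith
  · have e := disc_add_disc_le_sum_range (fun j => F (n - m) (m - j) j) (show c ≤ m by omega)
    simp only [Nat.sub_zero, Nat.sub_self] at e
    rw [show m - c = b by omega, ← h0] at e
    have t1 := disc_triangle (F a b c) (F a m 0) l
    have t2 := disc_triangle (F a b c) (F a 0 m) l
    rw [disc_of_ne hne] at t1 t2
    rw [disc_comm (F a b c), disc_comm _ l] at t1
    rw [disc_comm (F a 0 m) l] at t2
    rw [← h0] at e1 e3
    rw [← h0]
    linarith

end Sides

section Costs

variable {n m : ℕ} {P : Node n → Fin 5}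

lemma weight₂_nonneg (e : Sym2 (Node n)) : 0 ≤ weight₂ n e := by
  unfold weight₂; split_ifs <;> norm_num

lemma weight₃_nonneg {c : ℝ} (hc : 0 < c) (e : Sym2 (Node n)) : 0 ≤ weight₃ n c e := by
  unfold weight₃; split_ifs <;> positivity

lemma support_faceNode_subset {a b c : ℕ} (h : a + b + c = n) {X : Finset (Fin 4)}
    (h0 : a ≠ 0 → 0 ∈ X) (h1 : b ≠ 0 → 1 ∈ X) (h2 : c ≠ 0 → 2 ∈ X) :
    support (faceNode n a b c) ⊆ X := by
  intro i hi
  rw [mem_support, faceNode_val h] at hi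
  fin_cases i
  · exact h0 hi
  · exact h1 hi
  · exact h2 hi
  · simp at hi

lemma third_mul_sidesCut_le_cost (hn : 1 ≤ n) (P : Node n → Fin 5) :
    1 / 3 * sidesCut n (faceLabel P) ≤ cost (weight₂ n) P := by
  refine le_trans ?_ (face_sum_le_cost hn weight₂_nonneg P)
  refine (mul_le_mul_of_nonneg_left (sidesCut_le hn) (by norm_num)).trans ?_
  rw [Finset.mul_sum]
  refine Finset.sum_le_sum fun x hx => ?_
  have hs := mem_tri.1 hx
  obtain ⟨a0, a1, a2⟩ := faceNode_adj hn hs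
  have key : ∀ (e : Sym2 (Node n)) (p : Prop) [Decidable p],
      (p → e ∈ boundary n 0 1 ∪ boundary n 1 2 ∪ boundary n 0 2) →
      1 / 3 * (if p then (1 : ℝ) else 0) ≤ weight₂ n e := by
    intro e p _ h
    by_cases hp : p
    · rw [if_pos hp, weight₂, if_pos (h hp)]; norm_num
    · rw [if_neg hp]; simpa using weight₂_nonneg e
  have k0 := key s(faceNode n (x.1 + 1) x.2.1 x.2.2, faceNode n x.1 (x.2.1 + 1) x.2.2)
    (x.2.2 = 0) fun h => Or.inl (Or.inl (mk_mem_boundary.2 ⟨a0,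
      support_faceNode_subset (by omega) (by simp) (by simp) (by omega),
      support_faceNode_subset (by omega) (by simp) (by simp) (by omega)⟩))
  have k1 := key s(faceNode n x.1 (x.2.1 + 1) x.2.2, faceNode n x.1 x.2.1 (x.2.2 + 1))
    (x.1 = 0) fun h => Or.inl (Or.inr (mk_mem_boundary.2 ⟨a1,
      support_faceNode_subset (by omega) (by omega) (by simp) (by simp),
      support_faceNode_subset (by omega) (by omega) (by simp) (by simp)⟩))
  have k2 := key s(faceNode n x.1 x.2.1 (x.2.2 + 1), faceNode n (x.1 + 1) x.2.1 x.2.2)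
    (x.2.1 = 0) fun h => Or.inr (mk_mem_boundary.2 ⟨a2,
      support_faceNode_subset (by omega) (by simp) (by omega) (by simp),
      support_faceNode_subset (by omega) (by simp) (by omega) (by simp)⟩)
  have m0 := mul_le_mul_of_nonneg_right k0 (cutAB_nonneg (F := faceLabel P) (p := x.1)
    (q := x.2.1) (r := x.2.2))
  have m1 := mul_le_mul_of_nonneg_right k1 (cutBC_nonneg (F := faceLabel P) (p := x.1)
    (q := x.2.1) (r := x.2.2))
  have m2 := mul_le_mul_of_nonneg_right k2 (cutCA_nonneg (F := faceLabel P) (p := x.1)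
    (q := x.2.1) (r := x.2.2))
  linarith

lemma disc_sum_ge_three (f : Fin 4 → Fin 5) (h : ¬ ∃ a, ∀ i, f i = a) :
    3 ≤ ∑ e ∈ pairs, disc (f e.1) (f e.2) := by
  rw [sum_pairs]
  simp only
  have t1 := disc_triangle (f 0) (f 2) (f 1)
  have t2 := disc_triangle (f 0) (f 3) (f 1)
  have t3 := disc_triangle (f 0) (f 3) (f 2)
  rw [disc_comm (f 2) (f 1)] at t1
  rw [disc_comm (f 3) (f 1)] at t2
  rw [disc_comm (f 3) (f 2)] at t3
  by_cases h1 : f 0 = f 1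
  · by_cases h2 : f 0 = f 2
    · by_cases h3 : f 0 = f 3
      · exact absurd ⟨f 0, fun i => by fin_cases i <;> simp [← h1, ← h2, ← h3]⟩ h
      · rw [← h1, ← h2, disc_of_ne h3]; norm_num
    · rw [disc_of_ne h2] at t3 ⊢
      rw [← h1, disc_of_ne h2]
      linarith [disc_nonneg (f 0) (f 0), disc_nonneg (f 0) (f 3)]
  · rw [disc_of_ne h1] at t1 t2 ⊢
    linarith [disc_nonneg (f 2) (f 3)]

lemma cost_weight₄_ge (hn : 1 ≤ n) (hP : IsNonOpposite P) :
    3 * (((tri (n - 1)).card : ℝ) - (monoCells n 4 (faceLabel P)).card) / (n : ℝ) ^ 2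
      ≤ cost (weight₄ n) P := by
  classical
  have hw : ∀ e, 0 ≤ weight₄ n e := fun e => by unfold weight₄; positivity
  refine le_trans ?_ (sum_cellCost_le_cost hn hw P)
  have h1 : ((tri (n - 1)).card : ℝ) - (monoCells n 4 (faceLabel P)).card
      ≤ (Finset.univ.filter fun y : Node (n - 1) => ¬ ∃ a, IsMono hn P y a).card := by
    exact_mod_cast card_not_mono_ge hn hP
  have h2 : ∑ y ∈ Finset.univ.filter (fun y : Node (n - 1) => ¬ ∃ a, IsMono hn P y a),
      3 / (n : ℝ) ^ 2 ≤ ∑ y, cellCost hn (weight₄ n) P y := by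
    refine (Finset.sum_le_sum fun y hy => ?_).trans (Finset.sum_le_sum_of_subset_of_nonneg
      (Finset.filter_subset _ _) fun y _ _ => cellCost_nonneg hn hw P y)
    have h3 := disc_sum_ge_three (fun i => P (corner hn y i)) (Finset.mem_filter.1 hy).2
    simp only [cellCost, weight₄]
    rw [← Finset.mul_sum, div_eq_mul_one_div, mul_comm]
    exact mul_le_mul_of_nonneg_left h3 (by positivity)
  refine le_trans ?_ h2
  rw [Finset.sum_const, nsmul_eq_mul, mul_div_right_comm, mul_comm]
  exact mul_le_mul_of_nonneg_right h1 (by positivity)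

lemma mem_redEdges_of_eq {c : ℝ} {k : Fin 4} {x y : Node n} (hm : m ≤ n)
    (hc : (m : ℝ) = c * n) (hadj : (graph n).Adj x y) (hx : x.1 3 = 0) (hy : y.1 3 = 0)
    (h : x.1 k = n - m ∧ y.1 k = n - m) : s(x, y) ∈ redEdges n c k := by
  refine ⟨mk_mem_faceEdges.2 ⟨hadj, hx, hy⟩, Or.inl ?_⟩
  rw [Sym2.ball, h.1, h.2, Nat.cast_sub hm, hc]
  constructor <;> ring

lemma mem_redEdges_of_le {c : ℝ} {j k : Fin 4} {x y : Node n} (hm : m ≤ n)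
    (hc : (m : ℝ) = c * n) (hjk : j ≠ k) (hj : j ≠ 3) (hadj : (graph n).Adj x y)
    (hx : x.1 3 = 0) (hy : y.1 3 = 0) (hxs : support x ⊆ {j, k}) (hys : support y ⊆ {j, k})
    (h : n - m ≤ x.1 k ∧ n - m ≤ y.1 k) : s(x, y) ∈ redEdges n c k := by
  refine ⟨mk_mem_faceEdges.2 ⟨hadj, hx, hy⟩, Or.inr ⟨j, hjk, hj,
    mk_mem_boundary.2 ⟨hadj, hxs, hys⟩, ?_⟩⟩
  have e : (1 - c) * (n : ℝ) = ((n - m : ℕ) : ℝ) := by rw [Nat.cast_sub hm, hc]; ring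
  rw [Sym2.ball, e]
  exact ⟨Nat.cast_le.2 h.1, Nat.cast_le.2 h.2⟩

lemma redCut_le_cost {c : ℝ} (hc : 0 < c) (hcm : (m : ℝ) = c * n) (h2m : 2 * m < n)
    (P : Node n → Fin 5) :
    1 / (9 * c) * (redCut n m (faceLabel P) + redCut n m (rot (faceLabel P))
      + redCut n m (rot (rot (faceLabel P)))) ≤ cost (weight₃ n c) P := by
  have hn : 1 ≤ n := by omega
  have hmn : m ≤ n := by omega
  refine le_trans ?_ (face_sum_le_cost hn (weight₃_nonneg hc) P)
  set F := faceLabel P with hF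
  have h1 := redCut_le (n := n) (m := m) (F := F) (by omega)
  have h2 := redCut_le (n := n) (m := m) (F := rot F) (by omega)
  have h3 := redCut_le (n := n) (m := m) (F := rot (rot F)) (by omega)
  let g : (ℕ → ℕ → ℕ → Fin 5) → ℕ → ℕ → ℕ → ℝ := fun F p q r =>
    (if r = 0 ∧ n - m ≤ p then 1 else 0) * cutAB F p q r
      + (if p = n - m then 1 else 0) * cutBC F p q r
      + (if q = 0 ∧ n - m ≤ p then 1 else 0) * cutCA F p q r
  have a2 := sum_tri_rotate (n - 1) (g (rot F))
  have a3 := sum_tri_rotate (n - 1) fun p q r => g (rot (rot F)) q r p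
  have a4 := sum_tri_rotate (n - 1) (g (rot (rot F)))
  refine (mul_le_mul_of_nonneg_left (add_le_add (add_le_add h1 (h2.trans a2.symm.le))
    (h3.trans (a4.symm.trans a3.symm).le)) (by positivity)).trans ?_
  rw [← Finset.sum_add_distrib, ← Finset.sum_add_distrib, Finset.mul_sum]
  refine Finset.sum_le_sum fun x hx => ?_
  have hs := mem_tri.1 hx
  obtain ⟨p, q, r⟩ := x
  simp only at hs ⊢
  obtain ⟨d0, d1, d2⟩ := faceNode_adj hn hs
  have v0 := faceNode_val (n := n) (a := p + 1) (b := q) (c := r) (by omega)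
  have v1 := faceNode_val (n := n) (a := p) (b := q + 1) (c := r) (by omega)
  have v2 := faceNode_val (n := n) (a := p) (b := q) (c := r + 1) (by omega)
  have key : ∀ (e : Sym2 (Node n)) (u v w : Prop) [Decidable u] [Decidable v] [Decidable w],
      ¬ (u ∧ v) → ¬ (u ∧ w) → ¬ (v ∧ w) → (u → e ∈ redEdges n c 0) → (v → e ∈ redEdges n c 1) →
      (w → e ∈ redEdges n c 2) →
      1 / (9 * c) * ((if u then (1 : ℝ) else 0) + (if v then 1 else 0) + (if w then 1 else 0))
        ≤ weight₃ n c e := by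
    intro e u v w _ _ _ huv huw hvw hu hv hw
    by_cases h : u ∨ v ∨ w
    · have hred : e ∈ redEdges n c 0 ∪ redEdges n c 1 ∪ redEdges n c 2 := by
        rcases h with h | h | h
        · exact Or.inl (Or.inl (hu h))
        · exact Or.inl (Or.inr (hv h))
        · exact Or.inr (hw h)
      rw [weight₃, if_pos hred]
      refine mul_le_of_le_one_right (by positivity) ?_
      by_cases h1 : u
      · rw [if_pos h1, if_neg (fun h => huv ⟨h1, h⟩), if_neg (fun h => huw ⟨h1, h⟩)]; norm_num
      · by_cases h2 : v
        · rw [if_neg h1, if_pos h2, if_neg (fun h => hvw ⟨h2, h⟩)]; norm_num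
        · rw [if_neg h1, if_neg h2]; split_ifs <;> norm_num
    · push Not at h
      rw [if_neg h.1, if_neg h.2.1, if_neg h.2.2]
      simpa using weight₃_nonneg hc e
  have k0 := key s(faceNode n (p + 1) q r, faceNode n p (q + 1) r) (r = 0 ∧ n - m ≤ p)
    (r = 0 ∧ n - m ≤ q) (r = n - m) (by omega) (by omega) (by omega)
    (fun h => mem_redEdges_of_le (j := 1) hmn hcm (by decide) (by decide) d0 (by rw [v0]; rfl)
      (by rw [v1]; rfl) (support_faceNode_subset (by omega) (by simp) (by simp) (by omega))
      (support_faceNode_subset (by omega) (by simp) (by simp) (by omega))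
      (by rw [v0, v1]; change n - m ≤ p + 1 ∧ n - m ≤ p; omega))
    (fun h => mem_redEdges_of_le (j := 0) hmn hcm (by decide) (by decide) d0 (by rw [v0]; rfl)
      (by rw [v1]; rfl) (support_faceNode_subset (by omega) (by simp) (by simp) (by omega))
      (support_faceNode_subset (by omega) (by simp) (by simp) (by omega))
      (by rw [v0, v1]; change n - m ≤ q ∧ n - m ≤ q + 1; omega))
    (fun h => mem_redEdges_of_eq hmn hcm d0 (by rw [v0]; rfl) (by rw [v1]; rfl)
      (by rw [v0, v1]; exact ⟨h, h⟩))
  have k1 := key s(faceNode n p (q + 1) r, faceNode n p q (r + 1)) (p = n - m)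
    (p = 0 ∧ n - m ≤ q) (p = 0 ∧ n - m ≤ r) (by omega) (by omega) (by omega)
    (fun h => mem_redEdges_of_eq hmn hcm d1 (by rw [v1]; rfl) (by rw [v2]; rfl)
      (by rw [v1, v2]; exact ⟨h, h⟩))
    (fun h => mem_redEdges_of_le (j := 2) hmn hcm (by decide) (by decide) d1 (by rw [v1]; rfl)
      (by rw [v2]; rfl) (support_faceNode_subset (by omega) (by omega) (by simp) (by simp))
      (support_faceNode_subset (by omega) (by omega) (by simp) (by simp))
      (by rw [v1, v2]; change n - m ≤ q + 1 ∧ n - m ≤ q; omega))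
    (fun h => mem_redEdges_of_le (j := 1) hmn hcm (by decide) (by decide) d1 (by rw [v1]; rfl)
      (by rw [v2]; rfl) (support_faceNode_subset (by omega) (by omega) (by simp) (by simp))
      (support_faceNode_subset (by omega) (by omega) (by simp) (by simp))
      (by rw [v1, v2]; change n - m ≤ r ∧ n - m ≤ r + 1; omega))
  have k2 := key s(faceNode n p q (r + 1), faceNode n (p + 1) q r) (q = 0 ∧ n - m ≤ p)
    (q = n - m) (q = 0 ∧ n - m ≤ r) (by omega) (by omega) (by omega)
    (fun h => mem_redEdges_of_le (j := 2) hmn hcm (by decide) (by decide) d2 (by rw [v2]; rfl)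
      (by rw [v0]; rfl) (support_faceNode_subset (by omega) (by simp) (by omega) (by simp))
      (support_faceNode_subset (by omega) (by simp) (by omega) (by simp))
      (by rw [v2, v0]; change n - m ≤ p ∧ n - m ≤ p + 1; omega))
    (fun h => mem_redEdges_of_eq hmn hcm d2 (by rw [v2]; rfl) (by rw [v0]; rfl)
      (by rw [v2, v0]; exact ⟨h, h⟩))
    (fun h => mem_redEdges_of_le (j := 0) hmn hcm (by decide) (by decide) d2 (by rw [v2]; rfl)
      (by rw [v0]; rfl) (support_faceNode_subset (by omega) (by simp) (by omega) (by simp))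
      (support_faceNode_subset (by omega) (by simp) (by omega) (by simp))
      (by rw [v2, v0]; change n - m ≤ r + 1 ∧ n - m ≤ r; omega))
  have m0 := mul_le_mul_of_nonneg_right k0 (cutAB_nonneg (F := F) (p := p) (q := q) (r := r))
  have m1 := mul_le_mul_of_nonneg_right k1 (cutBC_nonneg (F := F) (p := p) (q := q) (r := r))
  have m2 := mul_le_mul_of_nonneg_right k2 (cutCA_nonneg (F := F) (p := p) (q := q) (r := r))
  have s1 : cutAB (rot F) q r p = cutBC F p q r := rfl
  have s2 : cutBC (rot F) q r p = cutCA F p q r := rfl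
  have s3 : cutCA (rot F) q r p = cutAB F p q r := rfl
  have s4 : cutAB (rot (rot F)) r p q = cutCA F p q r := rfl
  have s5 : cutBC (rot (rot F)) r p q = cutAB F p q r := rfl
  have s6 : cutCA (rot (rot F)) r p q = cutBC F p q r := rfl
  simp only [g, s1, s2, s3, s4, s5, s6]
  linarith

end Costs

section Mixed

variable {n m D : ℕ} {l l₁ l₂ l₃ z : Fin 5} {F : ℕ → ℕ → ℕ → Fin 5}

/-- The cells with a node that does not have label `z`. -/
def mixedCells (n : ℕ) (z : Fin 5) (F : ℕ → ℕ → ℕ → Fin 5) : Finset (ℕ × ℕ × ℕ) :=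
  tri (n - 1) \ monoCells n z F

lemma card_mixedCells_add : (mixedCells n z F).card + (monoCells n z F).card = (tri (n - 1)).card :=
  Finset.card_sdiff_add_card_eq_card (Finset.filter_subset _ _)

lemma mem_mixedCells {x : ℕ × ℕ × ℕ} : x ∈ mixedCells n z F ↔ x.1 + x.2.1 + x.2.2 = n - 1 ∧
    ¬ (F (x.1 + 1) x.2.1 x.2.2 = z ∧ F x.1 (x.2.1 + 1) x.2.2 = z ∧ F x.1 x.2.1 (x.2.2 + 1) = z) := by
  rw [mixedCells, Finset.mem_sdiff, mem_tri, mem_monoCells]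
  tauto

lemma card_filter_mixedCells_rot (p : ℕ × ℕ × ℕ → Prop) [DecidablePred p] :
    ((mixedCells n z (rot F)).filter p).card
      = ((mixedCells n z F).filter fun x => p (x.2.1, x.2.2, x.1)).card := by
  refine Finset.card_nbij' (fun x => (x.2.2, x.1, x.2.1)) (fun x => (x.2.1, x.2.2, x.1))
    (fun x hx => ?_) (fun x hx => ?_) (fun _ _ => rfl) (fun _ _ => rfl)
  · simp only [Finset.mem_coe, Finset.mem_filter, mem_mixedCells, rot] at hx ⊢
    exact ⟨⟨by omega, fun h => hx.1.2 ⟨h.2.1, h.2.2, h.1⟩⟩, hx.2⟩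
  · simp only [Finset.mem_coe, Finset.mem_filter, mem_mixedCells, rot] at hx ⊢
    exact ⟨⟨by omega, fun h => hx.1.2 ⟨h.2.2, h.1, h.2.1⟩⟩, hx.2⟩

lemma card_monoCells_rot : (monoCells n z (rot F)).card = (monoCells n z F).card := by
  have h := card_filter_mixedCells_rot (n := n) (z := z) (F := F) fun _ => True
  rw [Finset.filter_true, Finset.filter_true] at h
  have h1 := card_mixedCells_add (n := n) (z := z) (F := F)
  have h2 := card_mixedCells_add (n := n) (z := z) (F := rot F)
  omega

lemma sum_range_sub_mul_two (m : ℕ) : 2 * ∑ r ∈ Finset.range m, ((m - r : ℕ) : ℝ) = m * (m + 1) := by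
  induction m with
  | zero => simp
  | succ k ih =>
    rw [Finset.sum_range_succ', mul_add]
    simp only [Nat.add_sub_add_right, ih]
    push_cast
    ring

/-- The number of cells with a node without label `z` in the triangle of side length `m` at the
first corner. -/
def mixedCount (n m : ℕ) (z : Fin 5) (F : ℕ → ℕ → ℕ → Fin 5) : ℕ :=
  ((mixedCells n z F).filter fun x => n - m ≤ x.1).card

lemma cornerCount_add_mixedCount (hm : m < n) :
    2 * ((cornerCount n m z F : ℝ) + mixedCount n m z F) = m * (m + 1) := by
  have h := sum_tri_corner hm fun _ _ _ => 1
  simp only [Finset.sum_const, Finset.card_range, nsmul_eq_mul, mul_one] at h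
  have hsub : monoCells n z F ⊆ tri (n - 1) := Finset.filter_subset _ _
  have e := Finset.card_sdiff_add_card_eq_card
    (Finset.filter_subset_filter (fun x : ℕ × ℕ × ℕ => n - m ≤ x.1) hsub)
  have e' : mixedCount n m z F = ((tri (n - 1)).filter (fun x => n - m ≤ x.1)
      \ (monoCells n z F).filter fun x => n - m ≤ x.1).card := by
    rw [mixedCount]
    congr 1
    ext x
    simp only [mixedCells, Finset.mem_filter, Finset.mem_sdiff]
    tauto
  rw [← sum_range_sub_mul_two, ← h, ← e, e', cornerCount]
  push_cast
  ring

lemma mixedCount_add_le (h2m : 2 * m < n) :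
    mixedCount n m z F + mixedCount n m z (rot F) + mixedCount n m z (rot (rot F))
      ≤ (mixedCells n z F).card := by
  have h1 := card_filter_mixedCells_rot (n := n) (z := z) (F := F) fun x => n - m ≤ x.1
  have h2 := card_filter_mixedCells_rot (n := n) (z := z) (F := rot F) fun x => n - m ≤ x.1
  have h3 := card_filter_mixedCells_rot (n := n) (z := z) (F := F) fun x => n - m ≤ x.2.1
  rw [mixedCount, mixedCount, mixedCount, h2, h1]
  simp only at h3 ⊢
  rw [h3, ← Finset.card_union_of_disjoint, ← Finset.card_union_of_disjoint]
  · refine Finset.card_le_card fun x hx => ?_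
    simp only [Finset.mem_union, Finset.mem_filter] at hx
    tauto
  · rw [Finset.disjoint_left]
    intro x hx hy
    simp only [Finset.mem_union, Finset.mem_filter, mem_mixedCells] at hx hy
    omega
  · rw [Finset.disjoint_left]
    intro x hx hy
    simp only [Finset.mem_filter, mem_mixedCells] at hx hy
    omega

lemma sidesCut_rot : sidesCut n (rot F) = sidesCut n F := by
  unfold sidesCut
  change _ + _ + rowCut n F 0 = _
  ring

lemma side_disc_le_rowCut {x y : Fin 5} (h : 2 * D ≤ n) (hx : F n 0 0 = x) (hy : F 0 n 0 = y) :
    disc x (F (n - D) D 0) + disc y (F D (n - D) 0) ≤ rowCut n F 0 := by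
  have := disc_add_three_le_sum_range (rowLabel n F 0) (show D ≤ n - D by omega) (show n - D ≤ n by omega)
  simp only [rowLabel, Nat.sub_zero, Nat.sub_self, hx, hy] at this
  rw [show n - (n - D) = D by omega, disc_comm (F D (n - D) 0)] at this
  rw [rowCut]
  simp only [rowLabel, Nat.sub_zero]
  linarith [disc_nonneg (F (n - D) D 0) (F D (n - D) 0)]

lemma sideDefect_le_sidesCut (hF : IsLabelling n l₁ l₂ l₃ z F) (h : 2 * D ≤ n) :
    sideDefect n D l₁ l₂ l₃ F ≤ sidesCut n F := by
  have h1 := side_disc_le_rowCut h hF.term₁ hF.term₂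
  have h2 := side_disc_le_rowCut h hF.rot.term₁ hF.rot.term₂
  have h3 := side_disc_le_rowCut h hF.rot.rot.term₁ hF.rot.rot.term₂
  unfold sideDefect sidesCut
  simp only [rot] at *
  linarith

lemma three_le_sidesCut (hF : IsLabelling n l₁ l₂ l₃ z F) : 3 ≤ sidesCut n F := by
  have h1 := one_le_rowCut_zero hF
  have h2 := one_le_rowCut_zero hF.rot
  have h3 := one_le_rowCut_zero hF.rot.rot
  unfold sidesCut
  linarith

/-- A labelling with a side without label `z`. -/
lemma wCut_ge_of_free_side_sidesCut (hF : IsLabelling n l₁ l₂ l₃ z F) (h₁ : 3 * D + 1 ≤ n)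
    (h₂ : n ≤ 3 * D + 3) (hD : 1 ≤ D) (h0 : ∀ j ≤ n, rowLabel n F 0 j ≠ z) :
    2 * (n : ℝ) + 7 / 9 + 2 / 3 * (monoCells n z F).card / n
      ≤ wCut n F + 2 / 3 * min (sidesCut n F) 6 := by
  refine (wCut_ge_of_free_side hF h₁ h₂ hD h0).trans (add_le_add_right (mul_le_mul ?_
    (le_min (sideDefect_le_sidesCut hF (by omega)) sideDefect_le) sideDefect_nonneg (by norm_num)) _)
  have : (3 * D + 1 : ℝ) ≤ n := by exact_mod_cast h₁
  linarith

lemma six_le_sidesCut (hF : IsLabelling n l₁ l₂ l₃ z F) (h₁ : ∃ j ≤ n, rowLabel n F 0 j = z)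
    (h₂ : ∃ j ≤ n, rowLabel n (rot F) 0 j = z) (h₃ : ∃ j ≤ n, rowLabel n (rot (rot F)) 0 j = z) :
    6 ≤ sidesCut n F := by
  have key : ∀ {l₁ l₂ l₃ : Fin 5} {F : ℕ → ℕ → ℕ → Fin 5}, IsLabelling n l₁ l₂ l₃ z F →
      (∃ j ≤ n, rowLabel n F 0 j = z) → 2 ≤ rowCut n F 0 := fun hF h =>
    two_le_rowCut (by rw [Nat.sub_zero, hF.term₁]; exact hF.ne₁)
      (by rw [Nat.sub_zero, hF.term₂]; exact hF.ne₂) h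
  unfold sidesCut
  linarith [key hF h₁, key hF.rot h₂, key hF.rot.rot h₃]

end Mixed

section Combination

variable {n m : ℕ} {P : Node n → Fin 5}

lemma cost_combinedWeight (c a₁ a₂ a₃ a₄ : ℝ) : cost (combinedWeight n c a₁ a₂ a₃ a₄) P
    = a₁ * cost (weight₁ n) P + a₂ * cost (weight₂ n) P + a₃ * cost (weight₃ n c) P
      + a₄ * cost (weight₄ n) P := by
  simp only [cost, combinedWeight, Finset.mul_sum, Finset.sum_add_distrib]

lemma minTerm_le {b x y : ℝ} (hb : 0 ≤ b) (hx : 0 ≤ x) (hy : 0 ≤ y) :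
    minTerm b x y ≤ b * min (0.4 * x) (3 * y) := by
  have hbdd : BddBelow ((fun α : ℝ => 0.4 * α * x + 3 * (b - α) * y) '' Set.Icc 0 b) := by
    refine ⟨0, ?_⟩
    rintro _ ⟨α, ⟨h0, h1⟩, rfl⟩
    have := sub_nonneg.2 h1
    positivity
  rw [mul_min_of_nonneg _ _ hb]
  refine le_min (csInf_le hbdd ⟨b, ⟨hb, le_rfl⟩, ?_⟩) (csInf_le hbdd ⟨0, ⟨le_rfl, hb⟩, ?_⟩)
  · simp only; ring
  · simp only; ring

/-- The bound for a cut that leaves a side of the face without the extra label, where `k` is the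
number of cut edges on the sides, `β` the number of cells of the face with the extra label and `t`
the number of cells of the face. -/
lemma free_side_estimate {n c a₁ a₂ a₃ a₄ k β t U c₁ c₂ c₃ c₄ : ℝ} (hn : 0 < n) (hc₀ : 0 < c)
    (hc₁ : c < 1 / 2) (h₁ : 0 ≤ a₁) (h₂ : 0 ≤ a₂) (h₃ : 0 ≤ a₃) (h₄ : 0 ≤ a₄) (hk : 3 ≤ k)
    (hβ : 0 ≤ β) (hβt : β ≤ t) (ht : 2 * t = n * (n + 1))
    (hU : 2 * n + 7 / 9 + 2 / 3 * β / n ≤ U + 2 / 3 * min k 6) (e₁ : 3 / (5 * n) * U ≤ c₁)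
    (e₂ : 1 / 3 * k ≤ c₂) (e₃ : 0 ≤ c₃) (e₄ : 3 * (t - β) / n ^ 2 ≤ c₄) :
    min (a₂ + (1.2 - 1 / n) * a₁ + minTerm (1 / 2) a₁ a₄)
      (2 * a₂ + (1.2 - 5 / (2 * n)) * a₁ + 3 * min (2 * a₃ / (9 * c)) (minTerm (c ^ 2 / 2) a₁ a₄))
      ≤ a₁ * c₁ + a₂ * c₂ + a₃ * c₃ + a₄ * c₄ := by
  set μ := min (0.4 * a₁) (3 * a₄) with hμ
  have hμ0 : 0 ≤ μ := le_min (by positivity) (by positivity)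
  have m1 : minTerm (1 / 2) a₁ a₄ ≤ 1 / 2 * μ := minTerm_le (by norm_num) h₁ h₄
  have m2 : minTerm (c ^ 2 / 2) a₁ a₄ ≤ c ^ 2 / 2 * μ := minTerm_le (by positivity) h₁ h₄
  have m3 : min (2 * a₃ / (9 * c)) (minTerm (c ^ 2 / 2) a₁ a₄) ≤ 1 / 8 * μ :=
    (min_le_right _ _).trans (m2.trans (mul_le_mul_of_nonneg_right (by nlinarith) hμ0))
  set κ := min k 6 with hκ
  have k3 : 3 ≤ κ := le_min hk (by norm_num)
  have k6 : κ ≤ 6 := min_le_right _ _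
  have kk : κ ≤ k := min_le_left _ _
  set A := a₂ + (1.2 - 1 / n) * a₁ + minTerm (1 / 2) a₁ a₄
  set B := 2 * a₂ + (1.2 - 5 / (2 * n)) * a₁
    + 3 * min (2 * a₃ / (9 * c)) (minTerm (c ^ 2 / 2) a₁ a₄)
  have hA : A ≤ a₂ + (1.2 - 1 / n) * a₁ + 1 / 2 * μ := by simp only [A]; linarith
  have hB : B ≤ 2 * a₂ + (1.2 - 5 / (2 * n)) * a₁ + 1 / 2 * μ := by simp only [B]; linarith
  have hmin : min A B ≤ (2 - κ / 3) * A + (κ / 3 - 1) * B := by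
    have x1 := mul_le_mul_of_nonneg_left (min_le_left A B) (show 0 ≤ 2 - κ / 3 by linarith)
    have x2 := mul_le_mul_of_nonneg_left (min_le_right A B) (show 0 ≤ κ / 3 - 1 by linarith)
    linarith
  have b1 := mul_le_mul_of_nonneg_left hA (show 0 ≤ 2 - κ / 3 by linarith)
  have b2 := mul_le_mul_of_nonneg_left hB (show 0 ≤ κ / 3 - 1 by linarith)
  have d1 : 1.2 - (2 - κ / 3) * (1 / n) - (κ / 3 - 1) * (5 / (2 * n)) + 0.4 * β / n ^ 2 ≤ c₁ := by
    refine le_trans ?_ ((mul_le_mul_of_nonneg_left (sub_le_iff_le_add.2 hU) (by positivity)).trans e₁)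
    have : 3 / (5 * n) * (2 * n + 7 / 9 + 2 / 3 * β / n - 2 / 3 * κ)
        - (1.2 - (2 - κ / 3) * (1 / n) - (κ / 3 - 1) * (5 / (2 * n)) + 0.4 * β / n ^ 2)
        = (κ / 10 - 1 / 30) / n := by
      field_simp
      ring
    have : 0 ≤ (κ / 10 - 1 / 30) / n := div_nonneg (by linarith) hn.le
    linarith
  have d4 : 1 / 2 * μ ≤ a₁ * (0.4 * β / n ^ 2) + a₄ * (3 * (t - β) / n ^ 2) := by
    have y1 : μ * β ≤ 0.4 * a₁ * β := mul_le_mul_of_nonneg_right (min_le_left _ _) hβ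
    have y2 : μ * (t - β) ≤ 3 * a₄ * (t - β) :=
      mul_le_mul_of_nonneg_right (min_le_right _ _) (sub_nonneg.2 hβt)
    have : a₁ * (0.4 * β / n ^ 2) + a₄ * (3 * (t - β) / n ^ 2)
        = (0.4 * a₁ * β + 3 * a₄ * (t - β)) / n ^ 2 := by ring
    rw [this, le_div_iff₀ (by positivity)]
    nlinarith [mul_nonneg hμ0 hn.le]
  have f1 := mul_le_mul_of_nonneg_left d1 h₁
  have f2 := mul_le_mul_of_nonneg_left ((mul_le_mul_of_nonneg_left kk (by norm_num)).trans e₂) h₂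
  have f3 := mul_nonneg h₃ e₃
  have f4 := mul_le_mul_of_nonneg_left e₄ h₄
  linarith

/-- The contribution of a corner of the face in the enclosed case. -/
lemma corner_estimate {n m : ℕ} {c a₁ a₃ a₄ : ℝ} {l z : Fin 5} {F : ℕ → ℕ → ℕ → Fin 5}
    (hm : m < n) (hc : 0 < c) (hcm : (m : ℝ) = c * n) (h₁ : 0 ≤ a₁) (h₃ : 0 ≤ a₃) (h₄ : 0 ≤ a₄)
    (hl : F n 0 0 = l) : min (2 * a₃ / (9 * c)) (minTerm (c ^ 2 / 2) a₁ a₄)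
      ≤ a₁ * (0.4 * enclosedCount n m l z F / (n : ℝ) ^ 2) + a₃ * (1 / (9 * c) * redCut n m F)
        + a₄ * (3 * mixedCount n m z F / (n : ℝ) ^ 2) := by
  have hn : (0 : ℝ) < n := by exact_mod_cast (Nat.zero_le m).trans_lt hm
  have hr := redCut_nonneg (n := n) (m := m) (F := F)
  by_cases hB : MonoBoundary n m l F
  · refine (min_le_right _ _).trans ((minTerm_le (by positivity) h₁ h₄).trans ?_)
    rw [enclosedCount, if_pos hB]
    have hs := cornerCount_add_mixedCount (z := z) (F := F) hm
    have x0 := mul_nonneg h₃ (mul_nonneg (show 0 ≤ 1 / (9 * c) by positivity) hr)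
    set μ := min (0.4 * a₁) (3 * a₄)
    have hμ0 : 0 ≤ μ := le_min (by positivity) (by positivity)
    set u : ℝ := ((cornerCount n m z F : ℕ) : ℝ)
    set v : ℝ := ((mixedCount n m z F : ℕ) : ℝ)
    have y1 : μ * u ≤ 0.4 * a₁ * u := mul_le_mul_of_nonneg_right (min_le_left _ _) (Nat.cast_nonneg _)
    have y2 : μ * v ≤ 3 * a₄ * v := mul_le_mul_of_nonneg_right (min_le_right _ _) (Nat.cast_nonneg _)
    have : c ^ 2 / 2 * μ ≤ (0.4 * a₁ * u + 3 * a₄ * v) / (n : ℝ) ^ 2 := by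
      rw [le_div_iff₀ (by positivity)]
      have z1 : c ^ 2 / 2 * μ * (n : ℝ) ^ 2 = μ * ((m : ℝ) ^ 2 / 2) := by rw [hcm]; ring
      have z2 : μ * (u + v) = μ * ((m : ℝ) ^ 2 / 2) + μ * (m / 2) := by
        rw [show u + v = (m : ℝ) * (m + 1) / 2 by linarith]; ring
      have z3 : 0 ≤ μ * ((m : ℝ) / 2) := by positivity
      linarith
    have e : (0.4 * a₁ * u + 3 * a₄ * v) / (n : ℝ) ^ 2
      = a₁ * (0.4 * u / (n : ℝ) ^ 2) + a₄ * (3 * v / (n : ℝ) ^ 2) := by ring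
    linarith
  · refine (min_le_left _ _).trans ?_
    have h2 := two_le_redCut hm hl hB
    have x1 : 0 ≤ a₁ * (0.4 * enclosedCount n m l z F / (n : ℝ) ^ 2) := by positivity
    have x2 : 0 ≤ a₄ * (3 * mixedCount n m z F / (n : ℝ) ^ 2) := by positivity
    have x3 := mul_le_mul_of_nonneg_left (mul_le_mul_of_nonneg_left h2
      (show 0 ≤ 1 / (9 * c) by positivity)) h₃
    have e : a₃ * (1 / (9 * c) * 2) = 2 * a₃ / (9 * c) := by ring
    linarith

end Combination
end MultiwayCut

open MultiwayCut in
theorem theorem4 (n : ℕ) (hn : 10 ≤ n) (c : ℝ) (hc₀ : 0 < c) (hc₁ : c < 1 / 2)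
    (hcn : ∃ m : ℤ, c * (n : ℝ) = (m : ℝ))
    (l₁ l₂ l₃ l₄ : ℝ) (hl₁ : 0 ≤ l₁) (hl₂ : 0 ≤ l₂) (hl₃ : 0 ≤ l₃) (hl₄ : 0 ≤ l₄)
    (hl : l₁ + l₂ + l₃ + l₄ = 1)
    (P : MultiwayCut.Node n → Fin 5) (hP : MultiwayCut.IsNonOpposite P) :
    min
      (l₂ + (1.2 - 1 / (n : ℝ)) * l₁ + MultiwayCut.minTerm (1 / 2) l₁ l₄)
      (2 * l₂ + (1.2 - 5 / (2 * (n : ℝ))) * l₁ +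
        3 * min (2 * l₃ / (9 * c)) (MultiwayCut.minTerm (c ^ 2 / 2) l₁ l₄))
      ≤ MultiwayCut.cost (MultiwayCut.combinedWeight n c l₁ l₂ l₃ l₄) P := by
  have hn0 : (0 : ℝ) < n := by positivity
  obtain ⟨m, hm⟩ : ∃ m : ℕ, (m : ℝ) = c * n := by
    obtain ⟨m, hm⟩ := hcn
    have : (0 : ℝ) ≤ m := hm ▸ (mul_pos hc₀ hn0).le
    lift m to ℕ using by exact_mod_cast this
    exact ⟨m, by simpa using hm.symm⟩
  have h2m : 2 * m < n := by
    have : (2 * m : ℝ) < n := by rw [hm]; nlinarith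
    exact_mod_cast this
  obtain ⟨D, hD₁, hD₂, hD⟩ : ∃ D, 3 * D + 1 ≤ n ∧ n ≤ 3 * D + 3 ∧ 1 ≤ D :=
    ⟨(n - 1) / 3, by omega, by omega, by omega⟩
  have hn1 : 1 ≤ n := by omega
  have hF := isLabelling_faceLabel hP
  have e₁ := rho_mul_wCut_le_cost hn1 P
  have e₂ := third_mul_sidesCut_le_cost hn1 P
  have e₃ := redCut_le_cost hc₀ hm h2m P
  have e₄ := cost_weight₄_ge hn1 hP
  rw [cost_combinedWeight]
  rw [rho] at e₁
  set F := faceLabel P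
  have hcard := card_mixedCells_add (n := n) (z := 4) (F := F)
  have hcard' : ((mixedCells n 4 F).card : ℝ) = (tri (n - 1)).card - (monoCells n 4 F).card := by
    rw [← hcard]; push_cast; ring
  have htri : 2 * ((tri (n - 1)).card : ℝ) = n * (n + 1) := by
    have := two_mul_card_tri (n - 1)
    rw [show n - 1 + 1 = n by omega, show n - 1 + 2 = n + 1 by omega] at this
    exact_mod_cast this
  have hR : 0 ≤ cost (weight₃ n c) P := Finset.sum_nonneg fun e _ => weight₃_nonneg hc₀ e
  have free : 2 * (n : ℝ) + 7 / 9 + 2 / 3 * (monoCells n 4 F).card / n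
      ≤ wCut n F + 2 / 3 * min (sidesCut n F) 6 → _ := fun hU =>
    free_side_estimate hn0 hc₀ hc₁ hl₁ hl₂ hl₃ hl₄ (three_le_sidesCut hF) (Nat.cast_nonneg _)
      (Nat.cast_le.2 (by omega)) htri hU e₁ e₂ hR e₄
  by_cases h0 : ∀ j ≤ n, rowLabel n F 0 j ≠ 4
  · exact free (wCut_ge_of_free_side_sidesCut hF hD₁ hD₂ hD h0)
  by_cases h1 : ∀ j ≤ n, rowLabel n (rot F) 0 j ≠ 4
  · have := wCut_ge_of_free_side_sidesCut hF.rot hD₁ hD₂ hD h1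
    rw [wCut_rot, sidesCut_rot, card_monoCells_rot] at this
    exact free this
  by_cases h2 : ∀ j ≤ n, rowLabel n (rot (rot F)) 0 j ≠ 4
  · have := wCut_ge_of_free_side_sidesCut hF.rot.rot hD₁ hD₂ hD h2
    rw [wCut_rot, wCut_rot, sidesCut_rot, sidesCut_rot, card_monoCells_rot,
      card_monoCells_rot] at this
    exact free this
  push Not at h0 h1 h2
  refine (min_le_right _ _).trans ?_
  have hκ := six_le_sidesCut hF h0 h1 h2
  have hU := wCut_ge_of_enclosed hF hD₁ hD₂ hD h2m
  have k1 := corner_estimate (m := m) (z := 4) (by omega) hc₀ hm hl₁ hl₃ hl₄ hF.term₁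
  have k2 := corner_estimate (m := m) (z := 4) (by omega) hc₀ hm hl₁ hl₃ hl₄ hF.rot.term₁
  have k3 := corner_estimate (m := m) (z := 4) (by omega) hc₀ hm hl₁ hl₃ hl₄ hF.rot.rot.term₁
  have hv : (mixedCount n m 4 F : ℝ) + mixedCount n m 4 (rot F) + mixedCount n m 4 (rot (rot F))
      ≤ (mixedCells n 4 F).card := by exact_mod_cast mixedCount_add_le h2m
  rw [← hcard'] at e₄
  have f4 := (div_le_div_of_nonneg_right (mul_le_mul_of_nonneg_left hv
    (zero_le_three (α := ℝ))) (sq_nonneg (n : ℝ))).trans e₄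
  have f1 : 1.2 - 5 / (2 * (n : ℝ)) + 0.4 * enclosedCount n m 0 4 F / (n : ℝ) ^ 2
      + 0.4 * enclosedCount n m 1 4 (rot F) / (n : ℝ) ^ 2
      + 0.4 * enclosedCount n m 2 4 (rot (rot F)) / (n : ℝ) ^ 2 ≤ cost (weight₁ n) P := by
    refine le_trans ?_ ((mul_le_mul_of_nonneg_left hU (by positivity)).trans e₁)
    have h : ∀ x y w : ℝ, 3 / (5 * (n : ℝ)) * (2 * n - 3 + 2 / 3 * x / n + 2 / 3 * y / n
        + 2 / 3 * w / n) - (1.2 - 5 / (2 * (n : ℝ)) + 0.4 * x / (n : ℝ) ^ 2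
        + 0.4 * y / (n : ℝ) ^ 2 + 0.4 * w / (n : ℝ) ^ 2) = 7 / 10 / n := fun x y w => by
      field_simp
      ring
    have : 0 ≤ 7 / 10 / (n : ℝ) := by positivity
    linarith [h (enclosedCount n m 0 4 F) (enclosedCount n m 1 4 (rot F))
      (enclosedCount n m 2 4 (rot (rot F)))]
  have g1 := mul_le_mul_of_nonneg_left f1 hl₁
  have g2 := mul_le_mul_of_nonneg_left ((mul_le_mul_of_nonneg_left hκ (by norm_num)).trans e₂) hl₂
  have g3 := mul_le_mul_of_nonneg_left e₃ hl₃
  have g4 := mul_le_mul_of_nonneg_left f4 hl₄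
  have s4 : l₄ * (3 * ((mixedCount n m 4 F : ℝ) + mixedCount n m 4 (rot F)
      + mixedCount n m 4 (rot (rot F))) / (n : ℝ) ^ 2)
      = l₄ * (3 * mixedCount n m 4 F / (n : ℝ) ^ 2)
        + l₄ * (3 * mixedCount n m 4 (rot F) / (n : ℝ) ^ 2)
        + l₄ * (3 * mixedCount n m 4 (rot (rot F)) / (n : ℝ) ^ 2) := by ring
  linarith
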